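/- **Schemes.** A (stateless) private quantum coin scheme $\mathsf{Pr\text{-}QC}$ consists, for each security parameter $\lambda$, of a distribution $\mathsf{keygen}$ of secret keys $sk$; a finite set of qubits that makes up a coin; a procedure $\mathsf{mint}(sk)$ that always outputs the same pure state $|\text{¢}_{sk}\rangle$; and a two-outcome verification $\mathsf{verify}(sk,\cdot)$. The algorithms need not be efficient. Assume perfect completeness ($\mathsf{verify}(sk,\mathsf{mint}(sk))$ accepts with probability $1$ for every key in the support) and that $\mathsf{verify}(sk,\cdot)$ is a projective measurement with a rank-one accepting projector. $\mathsf{Count}_{sk}$ verifies the submitted coins one by one and returns the number accepted. **Construction.** Fix $c>1$ and let $\kappa=\lceil(\log_2\lambda)^c\rceil$. A public coin of $\mathsf{Pk\text{-}QC}$ is $\kappa$ private coins of $\mathsf{Pr\text{-}QC}$ (same keys). Public verification of a new coin with a wallet of $m$ coins is the measurement $\{\Pi_{\rm Sym}, I-\Pi_{\rm Sym}\}$, where $\Pi_{\rm Sym}$ projects on the symmetric subspace of all $\kappa(m+1)$ private-coin registers of the wallet and the new coin; it accepts on $\Pi_{\rm Sym}$, and in both cases the post-measurement state on all $m+1$ coins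 is the new wallet. Public $\mathsf{Count}_{pk}$ starts with a wallet of one fresh coin, verifies the submitted coins one by one with the current wallet, and returns the number accepted. The bank's verification of a public coin lets $k$ be the $\mathsf{Pr\text{-}QC}$ count of its $\kappa$ registers, destroys the coin, and accepts with probability $k/\kappa$; $\mathsf{Count}_{sk}$ of $\mathsf{Pk\text{-}QC}$ applies it to the coins one by one and returns the number accepted. **Adversaries.** An adversary is a family, indexed by $\lambda$, of finite quantum programs with oracle queries, measurements, classical control and the possibility to halt. A *QPT* adversary uses only Hadamard, $T$ and CNOT gates, and its number of qubits and its running time (one unit per block and per command; a query that submits $r$ coins costs in addition $r+1$, any other query $1$) are polynomially bounded in $\lambda$. An *unbounded* adversary may use arbitrary unitaries; only the total cost of its queries is polynomially bounded. "At most negligible" means bounded above by a negligible function of $\lambda$. **Unforgeability.** The forger may query $\mathsf{mint}(sk)$, $\mathsf{Count}_{sk}$ and, for a public scheme, $\mathsf{Count}_{pk}$; count queries return only the number. Let $n$ be the number of minted coins, and $m$, $m'$ the sums of the outcomes of the $\mathsf{Count}_{pk}$ and $\mathsf{Count}_{sk}$ queries. A forger is *nonadaptive* if it makes at most one count query in total.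 A private scheme is *adaptive-unforgeable* (*nonadaptive-unforgeable*) if for every forger (nonadaptive forger) $\Pr[m+m'-n>0]$ is at most negligible. A public scheme is *(all-or-nothing) nonadaptive rationally unforgeable* if for every nonadaptive forger $\mathbb E[U]$ is at most negligible, where $U=m+m'-n$ if no verification in a $\mathsf{Count}_{pk}$ query failed, and $U=-n$ otherwise. **Sabotage.** The saboteur may query $\mathsf{mint}(sk)$ and the bank's verification (an accepted coin is replaced by a fresh one, a rejected one is destroyed), and finally submits $m$ possibly entangled coins. They are counted with $\mathsf{Count}_{pk}$; let $m'$ be the outcome and $\omega$ the final wallet, of $m+1$ coins. * *Private sabotage*: $\omega$ goes to the bank; let $r$ be its $\mathsf{Count}_{sk}$. The loss is $m+1-r$ if $m'=m$, and $1-r$ otherwise. The scheme is rationally secure against private sabotage if for every saboteur the expected loss is at most negligible. * *Public sabotage*, with parameters $m$, $k$ and $n_1,\dots,n_k$ such that $\sum_i n_i=m+1$ (they may depend on $\lambda$; the saboteur submits exactly $m$ coins): if $m'<m$, then $\omega$ goes to the bank and the loss is $1-r$ as before. If $m'=m$, then the coins of $\omega$ are divided, in order, into groups of $n_1,\dots,n_k$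 coins, each group is submitted to $\mathsf{Count}_{pk}$ with a new wallet, and the loss is $m+1$ minus the sum of those $n_i$ for which all the coins of group $i$ are accepted. The scheme is rationally secure against public sabotage if for all parameters and every such saboteur the expected loss is at most negligible. A public scheme is *nonadaptively rationally secure* if it is nonadaptive rationally unforgeable and rationally secure against private and against public sabotage. **Theorem.** Let $\mathsf{Pr\text{-}QC}$ be a private quantum coin scheme with perfect completeness whose verification is a rank-$1$ projective measurement. 1. If $\mathsf{Pr\text{-}QC}$ is adaptive-unforgeable (against QPT adversaries), then $\mathsf{Pk\text{-}QC}$ is nonadaptively rationally secure (against QPT adversaries). 2. If $\mathsf{Pr\text{-}QC}$ is nonadaptive-unforgeable against unbounded adversaries, then $\mathsf{Pk\text{-}QC}$ is nonadaptively rationally secure against unbounded adversaries. -/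

import Mathlib

noncomputable section

namespace QCoin

open scoped ComplexOrder
open Matrix

set_option linter.unusedSectionVars false

/-! ### Qubit registers and operators

A register is a finite type `ι` of qubits; its computational basis is `ι → Bool`, its Hilbert space
is `(ι → Bool) → ℂ`.  States are (unnormalised) density matrices. -/

abbrev Vec (ι : Type) := (ι → Bool) → ℂ

abbrev Op (ι : Type) := Matrix (ι → Bool) (ι → Bool) ℂ

section Registers

variable {α ι W : Type} [Fintype α] [DecidableEq α] [Fintype ι] [DecidableEq ι]
  [Fintype W] [DecidableEq W]

/-- The computational basis vector `z`. -/
def ket (z : α → Bool) : Vec α := Pi.single z 1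

def zeroKet : Vec α := ket fun _ => false

/-- The pure state `|ψ⟩⟨ψ|`. -/
def pure (ψ : Vec α) : Op α := vecMulVec ψ (star ψ)

/-- The map `ρ ↦ K ρ K†`. -/
def sandwich (K ρ : Op ι) : Op ι := K * ρ * Kᴴ

open Classical in
/-- `A` acting on the qubits in the range of `e`, tensored with the identity on all the others. -/
def liftOp (e : α ↪ ι) (A : Op α) : Op ι := fun x y =>
  if ∀ i, i ∉ Set.range e → x i = y i then A (x ∘ e) (y ∘ e) else 0

/-- Throw away the qubits `e` and put fresh qubits in the state `ψ` in their place. -/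
def replace (e : α ↪ ι) (ψ : Vec α) (ρ : Op ι) : Op ι :=
  ∑ z : α → Bool, sandwich (liftOp e (vecMulVec ψ (ket z))) ρ

/-- Throw away the qubits `e` and write the number `k` in unary on them. -/
def writeUnary {b : ℕ} (e : Fin b ↪ ι) (k : ℕ) (ρ : Op ι) : Op ι :=
  replace e (ket fun j => decide ((j : ℕ) < k)) ρ

/-- `ρ ⊗ |ψ⟩⟨ψ|`. -/
def adjoin (ρ : Op ι) (ψ : Vec W) : Op (ι ⊕ W) := fun x y =>
  ρ (x ∘ Sum.inl) (y ∘ Sum.inl) * pure ψ (x ∘ Sum.inr) (y ∘ Sum.inr)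

/-- The partial trace over the second register. -/
def discard (σ : Op (ι ⊕ W)) : Op ι := fun x y =>
  ∑ z : W → Bool, σ (Sum.elim x z) (Sum.elim y z)

/-- The projector on the outcome `b` of a measurement of qubit `i`. -/
def measure (i : ι) (b : Bool) : Op ι := diagonal fun x => if x i = b then 1 else 0

end Registers

/-! ### The projection on the symmetric subspace -/

section Symmetric

/-- The permutation of basis states that permutes the registers by `π`. -/
def permReg (R Q : Type) (π : Equiv.Perm R) : Equiv.Perm (R × Q → Bool) :=
  Equiv.arrowCongr (Equiv.prodCongr π (Equiv.refl Q)) (Equiv.refl Bool)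

variable (R Q : Type) [Fintype R] [DecidableEq R] [Fintype Q] [DecidableEq Q]

/-- The average of all permutations of the registers indexed by `R`, each of which consists of the
qubits `Q`. -/
def symProj : Op (R × Q) :=
  ((Fintype.card R).factorial : ℂ)⁻¹ • ∑ π : Equiv.Perm R, (permReg R Q π).permMatrix ℂ

theorem permReg_mul (π τ : Equiv.Perm R) :
    permReg R Q (π * τ) = permReg R Q π * permReg R Q τ := by
  ext f p
  rfl

theorem permReg_inv (π : Equiv.Perm R) : permReg R Q π⁻¹ = (permReg R Q π)⁻¹ := by
  ext f p
  rfl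

theorem perm_mul_symProj (π : Equiv.Perm R) :
    (permReg R Q π).permMatrix ℂ * symProj R Q = symProj R Q := by
  unfold symProj
  rw [Matrix.mul_smul, Finset.mul_sum]
  congr 1
  refine Fintype.sum_equiv (Equiv.mulRight π) _ _ fun τ => ?_
  rw [← Matrix.permMatrix_mul, ← permReg_mul]
  rfl

theorem symProj_isHermitian : (symProj R Q)ᴴ = symProj R Q := by
  unfold symProj
  rw [conjTranspose_smul, conjTranspose_sum]
  congr 1
  · simp
  · refine Fintype.sum_equiv (Equiv.inv _) _ _ fun τ => ?_
    rw [conjTranspose_permMatrix, ← permReg_inv]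
    rfl

theorem symProj_mul_self : symProj R Q * symProj R Q = symProj R Q := by
  conv_lhs => enter [1]; unfold symProj
  rw [Matrix.smul_mul, Finset.sum_mul]
  simp only [perm_mul_symProj, Finset.sum_const, Finset.card_univ, Fintype.card_perm]
  rw [← Nat.cast_smul_eq_nsmul ℂ, smul_smul, inv_mul_cancel₀, one_smul]
  exact_mod_cast Nat.factorial_ne_zero _

/-- `symProj` is the projection on the vectors that no permutation of the registers changes. -/
theorem symProj_mulVec_eq_iff (v : Vec (R × Q)) :
    symProj R Q *ᵥ v = v ↔ ∀ π : Equiv.Perm R, v ∘ permReg R Q π = v := by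
  constructor
  · intro h π
    rw [← Matrix.permMatrix_mulVec]
    conv_lhs => rw [← h]
    rw [mulVec_mulVec, perm_mul_symProj, h]
  · intro h
    unfold symProj
    rw [smul_mulVec, sum_mulVec]
    simp only [Matrix.permMatrix_mulVec, h, Finset.sum_const, Finset.card_univ,
      Fintype.card_perm]
    rw [← Nat.cast_smul_eq_nsmul ℂ, smul_smul, inv_mul_cancel₀, one_smul]
    exact_mod_cast Nat.factorial_ne_zero _

end Symmetric

/-! ### Tensor products over a family of registers -/

section Tensor

variable {V Q : Type} [Fintype V] [DecidableEq V] [Fintype Q] [DecidableEq Q]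

/-- `⨂ j, A j`. -/
def tensorOp (A : V → Op Q) : Op (V × Q) := fun x y =>
  ∏ j, A j (fun q => x (j, q)) (fun q => y (j, q))

/-- `ψ ⊗ ⋯ ⊗ ψ`. -/
def tensorVec (V : Type) [Fintype V] (ψ : Vec Q) : Vec (V × Q) := fun x =>
  ∏ j, ψ fun q => x (j, q)

theorem sum_prod_curry {M : Type} [CommSemiring M] (f : V → (Q → Bool) → M) :
    ∑ x : V × Q → Bool, ∏ j, f j (fun q => x (j, q)) = ∏ j, ∑ z, f j z := by
  rw [Finset.prod_univ_sum, Fintype.piFinset_univ]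
  exact Fintype.sum_equiv (Equiv.curry V Q Bool) _ _ fun x => rfl

theorem tensorOp_mul (A B : V → Op Q) :
    tensorOp A * tensorOp B = tensorOp fun j => A j * B j := by
  ext x y
  simp only [tensorOp, mul_apply, ← Finset.prod_mul_distrib]
  exact sum_prod_curry fun j z => A j (fun q => x (j, q)) z * B j z fun q => y (j, q)

theorem tensorOp_conjTranspose (A : V → Op Q) : (tensorOp A)ᴴ = tensorOp fun j => (A j)ᴴ := by
  ext x y
  simp [tensorOp, conjTranspose_apply]

theorem tensorOp_one : tensorOp (fun _ : V => (1 : Op Q)) = 1 := by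
  ext x y
  by_cases h : x = y
  · subst h
    simp [tensorOp]
  · rw [one_apply_ne h]
    obtain ⟨⟨j, q⟩, hp⟩ := Function.ne_iff.mp h
    refine Finset.prod_eq_zero (Finset.mem_univ j) (one_apply_ne fun hx => hp ?_)
    exact congrFun hx q

open scoped MatrixOrder in
theorem exists_sqrt {A : Op Q} (hA : A.PosSemidef) : ∃ C : Op Q, A = Cᴴ * C := by
  obtain ⟨X, hX, -, h⟩ :=
    CFC.exists_sqrt_of_isSelfAdjoint_of_quasispectrumRestricts hA.isHermitian
      (QuasispectrumRestricts.nnreal_of_nonneg hA.nonneg)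
  refine ⟨X, ?_⟩
  rw [← h]
  exact congrArg (· * X) hX.star_eq.symm

theorem tensorOp_posSemidef {A : V → Op Q} (hA : ∀ j, (A j).PosSemidef) :
    (tensorOp A).PosSemidef := by
  choose C hC using fun j => exists_sqrt (hA j)
  have : tensorOp A = (tensorOp C)ᴴ * tensorOp C := by
    rw [tensorOp_conjTranspose, tensorOp_mul]
    exact congrArg tensorOp (funext hC)
  rw [this]
  exact posSemidef_conjTranspose_mul_self _

/-- The effect `E` is observed on exactly the registers in `T`, its negation on the others. -/
def patternEffect (E : Op Q) (T : Finset V) : Op (V × Q) :=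
  tensorOp fun j => if j ∈ T then E else 1 - E

/-- Test each register with the effect `E` and accept with the probability `k / card V`, where `k`
is the number of registers that passed. -/
def fractionEffect (V : Type) [Fintype V] [DecidableEq V] (E : Op Q) : Op (V × Q) :=
  ∑ T : Finset V, ((T.card : ℝ) / Fintype.card V) • patternEffect E T

theorem sum_patternEffect (E : Op Q) : ∑ T : Finset V, patternEffect E T = 1 := by
  rw [← tensorOp_one]
  ext x y
  rw [Matrix.sum_apply]
  have h : ∀ j : V, (1 : Op Q) (fun q => x (j, q)) (fun q => y (j, q)) =
      E (fun q => x (j, q)) (fun q => y (j, q)) +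
        (1 - E) (fun q => x (j, q)) (fun q => y (j, q)) := by
    intro j
    rw [← Matrix.add_apply, add_sub_cancel]
  simp only [tensorOp, h, Finset.prod_add, Finset.powerset_univ]
  refine Finset.sum_congr rfl fun T _ => ?_
  unfold patternEffect tensorOp
  rw [← Finset.prod_mul_prod_compl T]
  congr 1
  · exact Finset.prod_congr rfl fun j hj => by simp only [if_pos hj]
  · rw [Finset.compl_eq_univ_sdiff]
    refine Finset.prod_congr rfl fun j hj => ?_
    simp only [if_neg (Finset.mem_sdiff.mp hj).2]

theorem patternEffect_posSemidef {E : Op Q} (h0 : E.PosSemidef) (h1 : (1 - E).PosSemidef)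
    (T : Finset V) : (patternEffect E T).PosSemidef := by
  refine tensorOp_posSemidef fun j => ?_
  split_ifs
  · exact h0
  · exact h1

theorem fractionEffect_posSemidef {E : Op Q} (h0 : E.PosSemidef) (h1 : (1 - E).PosSemidef) :
    (fractionEffect V E).PosSemidef := by
  unfold fractionEffect
  refine posSemidef_sum _ fun T _ => ?_
  exact (patternEffect_posSemidef h0 h1 T).smul (by positivity)

theorem one_sub_fractionEffect_posSemidef {E : Op Q} (h0 : E.PosSemidef)
    (h1 : (1 - E).PosSemidef) : (1 - fractionEffect V E).PosSemidef := by
  have : 1 - fractionEffect V E =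
      ∑ T : Finset V, (1 - (T.card : ℝ) / Fintype.card V) • patternEffect E T := by
    simp only [sub_smul, one_smul, Finset.sum_sub_distrib, sum_patternEffect]
    rfl
  rw [this]
  refine posSemidef_sum _ fun T _ => ?_
  refine (patternEffect_posSemidef h0 h1 T).smul (sub_nonneg.mpr ?_)
  exact div_le_one_of_le₀ (by exact_mod_cast T.card_le_univ) (by positivity)

theorem tensorVec_normalised {ψ : Vec Q} (h : ∑ x, ‖ψ x‖ ^ 2 = 1) :
    ∑ x, ‖tensorVec V ψ x‖ ^ 2 = 1 := by
  have h' := sum_prod_curry (V := V) fun _ z => ‖ψ z‖ ^ 2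
  rw [h, Finset.prod_const_one] at h'
  simpa only [tensorVec, norm_prod, Finset.prod_pow] using h'

end Tensor

/-! ### Coin schemes -/

/-- A (stateless) private quantum coin scheme.  For the security parameter `lam`, a coin consists of
the qubits `Qub lam`; `mint` always produces the same pure state `coin lam sk`; and
`verify lam sk` is the effect (POVM element) for acceptance.  -/
structure PrivateCoinScheme where
  Key : ℕ → Type
  keyGen : ∀ lam, PMF (Key lam)
  Qub : ℕ → Type
  [qubFintype : ∀ lam, Fintype (Qub lam)]
  [qubDecidableEq : ∀ lam, DecidableEq (Qub lam)]
  coin : ∀ lam, Key lam → Vec (Qub lam)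
  coin_normalised : ∀ lam sk, ∑ x, ‖coin lam sk x‖ ^ 2 = 1
  verify : ∀ lam, Key lam → Op (Qub lam)
  verify_nonneg : ∀ lam sk, (verify lam sk).PosSemidef
  verify_le_one : ∀ lam sk, (1 - verify lam sk).PosSemidef

attribute [instance] PrivateCoinScheme.qubFintype PrivateCoinScheme.qubDecidableEq

namespace PrivateCoinScheme

/-- Perfect completeness: every minted coin passes verification with probability one. -/
def Complete (S : PrivateCoinScheme) : Prop :=
  ∀ lam, ∀ sk ∈ (S.keyGen lam).support,
    star (S.coin lam sk) ⬝ᵥ (S.verify lam sk *ᵥ S.coin lam sk) = 1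

/-- Verification is a projective measurement whose accepting projector has rank one. -/
def RankOneProjective (S : PrivateCoinScheme) : Prop :=
  ∀ lam, ∀ sk ∈ (S.keyGen lam).support,
    ∃ ψ : Vec (S.Qub lam), ∑ x, ‖ψ x‖ ^ 2 = 1 ∧ S.verify lam sk = pure ψ

/-- The average over the keys. -/
def keyAverage (S : PrivateCoinScheme) (lam : ℕ) (f : S.Key lam → ℝ) : ℝ :=
  ∑' sk, (S.keyGen lam sk).toReal * f sk

end PrivateCoinScheme

/-- A comparison-based public quantum coin scheme with private verification.  The private
verification by the bank is the inherited `verify`.  Public verification measures a wallet of `n - 1`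
coins together with the new coin, in all `n` coins; the Kraus operators of its two outcomes are
`accept lam n` and `reject lam n`, and the post-measurement state is the new wallet. -/
structure PublicCoinScheme extends PrivateCoinScheme where
  accept : ∀ lam n, Op (Fin n × Qub lam)
  reject : ∀ lam n, Op (Fin n × Qub lam)
  complete_measurement : ∀ lam n,
    (accept lam n)ᴴ * accept lam n + (reject lam n)ᴴ * reject lam n = 1

/-! ### The construction -/

/-- The number `(log lam) ^ c` of private coins in a public coin. -/
def kappa (c : ℝ) (lam : ℕ) : ℕ := ⌈Real.logb 2 lam ^ c⌉₊

/-- The projection on the symmetric subspace of all `n * k` private coins in `n` public coins. -/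
def walletProj (n k : ℕ) (Q : Type) [Fintype Q] [DecidableEq Q] : Op (Fin n × (Fin k × Q)) :=
  (symProj (Fin n × Fin k) Q).submatrix
    (Equiv.arrowCongr (Equiv.prodAssoc (Fin n) (Fin k) Q).symm (Equiv.refl Bool))
    (Equiv.arrowCongr (Equiv.prodAssoc (Fin n) (Fin k) Q).symm (Equiv.refl Bool))

theorem walletProj_isHermitian (n k : ℕ) (Q : Type) [Fintype Q] [DecidableEq Q] :
    (walletProj n k Q)ᴴ = walletProj n k Q := by
  unfold walletProj
  rw [conjTranspose_submatrix, symProj_isHermitian]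

theorem walletProj_mul_self (n k : ℕ) (Q : Type) [Fintype Q] [DecidableEq Q] :
    walletProj n k Q * walletProj n k Q = walletProj n k Q := by
  unfold walletProj
  rw [submatrix_mul_equiv, symProj_mul_self]

/-- The public coin scheme obtained from the private coin scheme `S`: a public coin is `kappa c lam`
private coins; public verification is the projective measurement on the symmetric subspace; the bank
verifies the private coins in a public coin one by one and accepts with probability the fraction of
those that passed. -/
def PkQC (S : PrivateCoinScheme) (c : ℝ) : PublicCoinScheme where
  Key := S.Key
  keyGen := S.keyGen
  Qub lam := Fin (kappa c lam) × S.Qub lam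
  coin lam sk := tensorVec (Fin (kappa c lam)) (S.coin lam sk)
  coin_normalised lam sk := tensorVec_normalised (S.coin_normalised lam sk)
  verify lam sk := fractionEffect (Fin (kappa c lam)) (S.verify lam sk)
  verify_nonneg lam sk := fractionEffect_posSemidef (S.verify_nonneg lam sk) (S.verify_le_one lam sk)
  verify_le_one lam sk :=
    one_sub_fractionEffect_posSemidef (S.verify_nonneg lam sk) (S.verify_le_one lam sk)
  accept lam n := walletProj n (kappa c lam) (S.Qub lam)
  reject lam n := 1 - walletProj n (kappa c lam) (S.Qub lam)
  complete_measurement lam n := by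
    rw [conjTranspose_sub, conjTranspose_one, walletProj_isHermitian, mul_sub, sub_mul, mul_one,
      walletProj_mul_self]
    rw [sub_mul, one_mul, walletProj_mul_self]
    simp

/-! ### Counting procedures

Each procedure returns the list of its branches: a classical outcome and the corresponding
unnormalised state, whose trace is the probability of the branch. -/

section Counting

variable {ι : Type} [Fintype ι] [DecidableEq ι]

/-- Private verification of the single coin `e`; the coin is destroyed. -/
def PrivateCoinScheme.verifyDestroy (S : PrivateCoinScheme) {lam : ℕ} (sk : S.Key lam)
    (e : S.Qub lam ↪ ι) (ρ : Op ι) : List (Bool × Op ι) :=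
  [(true, replace e zeroKet (liftOp e (S.verify lam sk) * ρ)),
    (false, replace e zeroKet (liftOp e (1 - S.verify lam sk) * ρ))]

/-- The coin number `i` among the coins `e`. -/
def coinAt {r : ℕ} {W : Type} (e : Fin r × W ↪ ι) (i : Fin r) : W ↪ ι :=
  ⟨fun w => e (i, w), fun _ _ h => (Prod.mk.inj (e.injective h)).2⟩

/-- `Count` with the private key: verify the coins one by one and return the number accepted. -/
def PrivateCoinScheme.privCount (S : PrivateCoinScheme) {lam : ℕ} (sk : S.Key lam) {r : ℕ}
    (e : Fin r × S.Qub lam ↪ ι) (ρ : Op ι) : List (ℕ × Op ι) :=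
  (List.finRange r).foldl
    (fun L i => L.flatMap fun b =>
      (S.verifyDestroy sk (coinAt e i) b.2).map fun a => (b.1 + if a.1 then 1 else 0, a.2))
    [(0, ρ)]

/-- The first `n` coins among the coins `e`. -/
def firstCoins {r : ℕ} {W : Type} (e : Fin r × W ↪ ι) (n : ℕ) (h : n ≤ r) : Fin n × W ↪ ι :=
  ((Fin.castLEEmb h).prodMap (Function.Embedding.refl W)).trans e

/-- The wallet, preceded by a fresh coin: coin `0` is the fresh coin, coin `i + 1` is the
submitted coin `i`. -/
def walletCoins {m : ℕ} {W : Type} (e : Fin m × W ↪ ι) : Fin (m + 1) × W ↪ ι ⊕ W where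
  toFun p := Fin.cases (motive := fun _ => ι ⊕ W) (Sum.inr p.2) (fun i => Sum.inl (e (i, p.2))) p.1
  inj' := by
    rintro ⟨i, w⟩ ⟨j, v⟩ h
    induction i using Fin.cases with
    | zero =>
      induction j using Fin.cases with
      | zero => simpa using h
      | succ j => simp at h
    | succ i =>
      induction j using Fin.cases with
      | zero => simp at h
      | succ j => simpa using h

/-- Public `Count` in which the wallet has already been initialised with coin `0` of `e`: the coins
`1, …, m` are verified one by one, each time with the wallet left by the previous verification. -/
def PublicCoinScheme.walletCount (P : PublicCoinScheme) {lam : ℕ} {m : ℕ}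
    (e : Fin (m + 1) × P.Qub lam ↪ ι) (ρ : Op ι) : List (ℕ × Op ι) :=
  (List.finRange m).foldl
    (fun L (i : Fin m) => L.flatMap fun b =>
      [(b.1 + 1, sandwich (liftOp (firstCoins e (i.1 + 2) (by omega)) (P.accept lam (i.1 + 2))) b.2),
        (b.1, sandwich (liftOp (firstCoins e (i.1 + 2) (by omega)) (P.reject lam (i.1 + 2))) b.2)])
    [(0, ρ)]

/-- Public `Count` of the coins `e`: initialise a new wallet with a fresh coin, verify the coins one
by one, and return the number accepted, together with the final state of all coins. -/
def PublicCoinScheme.pubCount (P : PublicCoinScheme) {lam : ℕ} (sk : P.Key lam) {m : ℕ}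
    (e : Fin m × P.Qub lam ↪ ι) (ρ : Op ι) : List (ℕ × Op (ι ⊕ P.Qub lam)) :=
  P.walletCount (walletCoins e) (adjoin ρ (P.coin lam sk))

end Counting

/-! ### Oracle programs -/

def hadamardOp : Op (Fin 1) := fun x y => (if x 0 && y 0 then -1 else 1) / (Real.sqrt 2 : ℂ)

def tOp : Op (Fin 1) :=
  diagonal fun x => if x 0 then Complex.exp (Complex.I * Real.pi / 4) else 1

def cnotOp : Op (Fin 2) := fun x y =>
  if x 0 = y 0 ∧ x 1 = xor (y 0) (y 1) then 1 else 0

/-- Gates on `N` qubits: elementary gates, and arbitrary unitaries (which only computationally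
unbounded adversaries may use). -/
inductive Gate (N : ℕ)
  | hadamard (e : Fin 1 ↪ Fin N)
  | tgate (e : Fin 1 ↪ Fin N)
  | cnot (e : Fin 2 ↪ Fin N)
  | arbitrary (U : Matrix.unitaryGroup (Fin N → Bool) ℂ)

def Gate.op {N : ℕ} : Gate N → Op (Fin N)
  | hadamard e => liftOp e hadamardOp
  | tgate e => liftOp e tOp
  | cnot e => liftOp e cnotOp
  | arbitrary U => U

def Gate.Elementary {N : ℕ} : Gate N → Prop
  | arbitrary _ => False
  | _ => True

inductive Cmd (N : ℕ) (Q : Type)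
  | gate (g : Gate N)
  | query (q : Q)
  | halt

def Cmd.Elementary {N : ℕ} {Q : Type} : Cmd N Q → Prop
  | gate g => g.Elementary
  | _ => True

/-- A program on `N` qubits with oracle queries from `Q` is a list of blocks.  A block
`(none, cmds)` is executed; for a block `(some i, cmds)`, qubit `i` is measured, and `cmds` is
executed if the result is `1`. -/
abbrev Prog (N : ℕ) (Q : Type) := List (Option (Fin N) × List (Cmd N Q))

/-- One branch of an execution: has the program halted, the record `log` kept by the game, and the
unnormalised state. -/
structure Branch (N : ℕ) (T : Type) where
  halted : Bool
  log : T
  state : Op (Fin N)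

/-- What the oracles do with a query. -/
abbrev Oracle (N : ℕ) (Q T : Type) := Q → T → Op (Fin N) → List (Branch N T)

section Execution

variable {N : ℕ} {Q T : Type}

def Cmd.exec (O : Oracle N Q T) (b : Branch N T) : Cmd N Q → List (Branch N T)
  | gate g => [{ b with state := sandwich g.op b.state }]
  | query q => O q b.log b.state
  | halt => [{ b with halted := true }]

def execBlock (O : Oracle N Q T) (cmds : List (Cmd N Q)) (b : Branch N T) : List (Branch N T) :=
  cmds.foldl (fun L cmd => L.flatMap fun a => if a.halted then [a] else cmd.exec O a) [b]

def execGuarded (O : Oracle N Q T) (block : Option (Fin N) × List (Cmd N Q)) (b : Branch N T) :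
    List (Branch N T) :=
  if b.halted then [b] else
    match block.1 with
    | none => execBlock O block.2 b
    | some i => { b with state := sandwich (measure i false) b.state } ::
        execBlock O block.2 { b with state := sandwich (measure i true) b.state }

/-- All the branches of the execution that starts with all qubits in the state `0`. -/
def Prog.exec (O : Oracle N Q T) (log : T) (p : Prog N Q) : List (Branch N T) :=
  p.foldl (fun L block => L.flatMap (execGuarded O block)) [⟨false, log, pure zeroKet⟩]

/-- The cost of the queries in the program. -/
def Prog.queryCost (cost : Q → ℕ) (p : Prog N Q) : ℕ :=
  (p.map fun block => (block.2.map fun cmd =>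
    match cmd with
    | .query q => cost q
    | _ => 0).sum).sum

/-- The running time: one unit for each block and each command, plus the cost of the queries. -/
def Prog.time (cost : Q → ℕ) (p : Prog N Q) : ℕ :=
  (p.map fun block => 1 + block.2.length).sum + p.queryCost cost

end Execution

/-- The sum of `v` over the branches; if `v` is linear in the state this is an expectation. -/
def total {N : ℕ} {T : Type} (L : List (Branch N T)) (v : T → Op (Fin N) → ℝ) : ℝ :=
  (L.map fun b => v b.log b.state).sum

/-- A family of oracle programs, one for each security parameter. -/
structure Adversary (Q : ℕ → ℕ → Type) where
  qubits : ℕ → ℕ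
  prog : ∀ lam, Prog (qubits lam) (Q lam (qubits lam))

/-- Computationally bounded (quantum polynomial time) or unbounded adversaries. -/
inductive Model
  | qpt
  | unbounded

/-- A `qpt` adversary is a polynomial-size family of programs with elementary gates.  For an
`unbounded` adversary only the cost of the queries is polynomially bounded. -/
def Adversary.Admissible {Q : ℕ → ℕ → Type} (cost : ∀ {lam N}, Q lam N → ℕ) (A : Adversary Q) :
    Model → Prop
  | .qpt => (∀ lam, ∀ block ∈ A.prog lam, ∀ cmd ∈ block.2, Cmd.Elementary cmd) ∧
      ∃ p : Polynomial ℕ, ∀ lam, A.qubits lam + (A.prog lam).time cost ≤ p.eval lam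
  | .unbounded => ∃ p : Polynomial ℕ, ∀ lam, (A.prog lam).queryCost cost ≤ p.eval lam

/-- `f` is bounded above by a negligible function. -/
def AtMostNegligible (f : ℕ → ℝ) : Prop :=
  ∃ ε : ℕ → ℝ, Asymptotics.SuperpolynomialDecay Filter.atTop (fun lam : ℕ => (lam : ℝ)) ε ∧
    ∀ lam, f lam ≤ ε lam

/-! ### Unforgeability -/

/-- What the unforgeability game records: the number `n` of minted coins, the sums `m` and `m'` of
the outcomes of the public and private `Count` queries, whether a public verification has failed,
and the total number of `Count` queries. -/
structure ForgeLog where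
  n : ℕ
  m : ℕ
  m' : ℕ
  fail : Bool
  queries : ℕ

def ForgeLog.start : ForgeLog := ⟨0, 0, 0, false, 0⟩

/-- The utility `m + m' - n`. -/
def ForgeLog.flexible (l : ForgeLog) : ℝ := l.m + l.m' - l.n

/-- The utility that is `m + m' - n` if no public verification has failed, and `-n` otherwise. -/
def ForgeLog.allOrNothing (l : ForgeLog) : ℝ := if l.fail then -l.n else l.m + l.m' - l.n

/-- Queries of a forger of a private scheme with coins of qubits `W`.  The answer of `Count` is
written in unary on `out`. -/
inductive PrivForgeQuery (W : Type) (N : ℕ)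
  | mint (e : W ↪ Fin N)
  | count (r : ℕ) (coins : Fin r × W ↪ Fin N) (b : ℕ) (out : Fin b ↪ Fin N)

def PrivForgeQuery.cost {W : Type} {N : ℕ} : PrivForgeQuery W N → ℕ
  | mint _ => 1
  | count r _ _ _ => r + 1

/-- Queries of a forger of a public scheme: also public `Count`. -/
inductive PubForgeQuery (W : Type) (N : ℕ)
  | priv (q : PrivForgeQuery W N)
  | count (r : ℕ) (coins : Fin r × W ↪ Fin N) (b : ℕ) (out : Fin b ↪ Fin N)

def PubForgeQuery.cost {W : Type} {N : ℕ} : PubForgeQuery W N → ℕ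
  | priv q => q.cost
  | count r _ _ _ => r + 1

/-- The oracles `mint` and private `Count`. -/
def PrivateCoinScheme.forgeOracle (S : PrivateCoinScheme) {lam : ℕ} (sk : S.Key lam) (N : ℕ) :
    Oracle N (PrivForgeQuery (S.Qub lam) N) ForgeLog
  | .mint e, l, ρ => [⟨false, { l with n := l.n + 1 }, replace e (S.coin lam sk) ρ⟩]
  | .count _ coins _ out, l, ρ => (S.privCount sk coins ρ).map fun a =>
      ⟨false, { l with m' := l.m' + a.1, queries := l.queries + 1 }, writeUnary out a.1 a.2⟩

/-- The oracles `mint`, private `Count` and public `Count`.  The coins submitted to public `Count`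
and its wallet do not return to the adversary. -/
def PublicCoinScheme.forgeOracle (P : PublicCoinScheme) {lam : ℕ} (sk : P.Key lam) (N : ℕ) :
    Oracle N (PubForgeQuery (P.Qub lam) N) ForgeLog
  | .priv q, l, ρ => P.toPrivateCoinScheme.forgeOracle sk N q l ρ
  | .count r coins _ out, l, ρ => (P.pubCount sk coins ρ).map fun a =>
      ⟨false,
        { l with
          m := l.m + a.1
          fail := l.fail || decide (a.1 < r)
          queries := l.queries + 1 },
        writeUnary out a.1 (replace coins zeroKet (discard a.2))⟩

abbrev PrivateCoinScheme.Forger (S : PrivateCoinScheme) :=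
  Adversary fun lam N => PrivForgeQuery (S.Qub lam) N

abbrev PublicCoinScheme.Forger (P : PublicCoinScheme) :=
  Adversary fun lam N => PubForgeQuery (P.Qub lam) N

/-- The expectation of `u` at the end of the unforgeability game. -/
def PrivateCoinScheme.forgeExpectation (S : PrivateCoinScheme) (A : S.Forger)
    (u : ForgeLog → ℝ) (lam : ℕ) : ℝ :=
  S.keyAverage lam fun sk =>
    total (Prog.exec (S.forgeOracle sk (A.qubits lam)) ForgeLog.start (A.prog lam))
      fun l ρ => ρ.trace.re * u l

/-- The expectation of `u` at the end of the unforgeability game. -/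
def PublicCoinScheme.forgeExpectation (P : PublicCoinScheme) (A : P.Forger)
    (u : ForgeLog → ℝ) (lam : ℕ) : ℝ :=
  P.keyAverage lam fun sk =>
    total (Prog.exec (P.forgeOracle sk (A.qubits lam)) ForgeLog.start (A.prog lam))
      fun l ρ => ρ.trace.re * u l

open Classical in
/-- The indicator function of an event. -/
def ind (E : ForgeLog → Prop) (l : ForgeLog) : ℝ := if E l then 1 else 0

/-- A nonadaptive forger never makes more than one `Count` query. -/
def PrivateCoinScheme.Forger.Nonadaptive {S : PrivateCoinScheme} (A : S.Forger) : Prop :=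
  ∀ lam, S.forgeExpectation A (ind fun l => 1 < l.queries) lam = 0

def PublicCoinScheme.Forger.Nonadaptive {P : PublicCoinScheme} (A : P.Forger) : Prop :=
  ∀ lam, P.forgeExpectation A (ind fun l => 1 < l.queries) lam = 0

def PrivateCoinScheme.AdaptiveUnforgeable (S : PrivateCoinScheme) (M : Model) : Prop :=
  ∀ A : S.Forger, A.Admissible PrivForgeQuery.cost M →
    AtMostNegligible (S.forgeExpectation A (ind fun l => 0 < l.flexible))

def PrivateCoinScheme.NonadaptiveUnforgeable (S : PrivateCoinScheme) (M : Model) : Prop :=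
  ∀ A : S.Forger, A.Admissible PrivForgeQuery.cost M → A.Nonadaptive →
    AtMostNegligible (S.forgeExpectation A (ind fun l => 0 < l.flexible))

/-- Nonadaptive rational unforgeability with respect to the all-or-nothing utility. -/
def PublicCoinScheme.NonadaptivelyRationallyUnforgeable (P : PublicCoinScheme) (M : Model) : Prop :=
  ∀ A : P.Forger, A.Admissible PubForgeQuery.cost M → A.Nonadaptive →
    AtMostNegligible (P.forgeExpectation A ForgeLog.allOrNothing)

/-! ### Sabotage -/

/-- The coins that a saboteur submits. -/
structure Submission (W : Type) (N : ℕ) where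
  m : ℕ
  coins : Fin m × W ↪ Fin N

def Submission.empty (W : Type) (N : ℕ) : Submission W N :=
  ⟨0, ⟨fun p => p.1.elim0, fun p => p.1.elim0⟩⟩

/-- Queries of a saboteur.  `verify` writes its answer on `out`; `submit` ends the attack; a saboteur
who never submits has submitted no coins. -/
inductive SabotageQuery (W : Type) (N : ℕ)
  | mint (e : W ↪ Fin N)
  | verify (e : W ↪ Fin N) (out : Fin 1 ↪ Fin N)
  | submit (s : Submission W N)

def SabotageQuery.cost {W : Type} {N : ℕ} : SabotageQuery W N → ℕ
  | mint _ => 1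
  | verify _ _ => 1
  | submit s => s.m + 1

/-- The oracles `mint` and private verification.  A coin that passes private verification is replaced
by a fresh coin, a coin that fails is destroyed. -/
def PublicCoinScheme.sabotageOracle (P : PublicCoinScheme) {lam : ℕ} (sk : P.Key lam) (N : ℕ) :
    Oracle N (SabotageQuery (P.Qub lam) N) (Submission (P.Qub lam) N)
  | .mint e, l, ρ => [⟨false, l, replace e (P.coin lam sk) ρ⟩]
  | .verify e out, l, ρ => (P.verifyDestroy sk e ρ).map fun a =>
      if a.1 then ⟨false, l, writeUnary out 1 (replace e (P.coin lam sk) a.2)⟩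
      else ⟨false, l, writeUnary out 0 a.2⟩
  | .submit s, _, ρ => [⟨true, s, ρ⟩]

abbrev PublicCoinScheme.Saboteur (P : PublicCoinScheme) :=
  Adversary fun lam N => SabotageQuery (P.Qub lam) N

/-- The sum of `v` over the keys and the branches of the attack. -/
def PublicCoinScheme.sabotageExpectation (P : PublicCoinScheme) (A : P.Saboteur) (lam : ℕ)
    (v : P.Key lam → Submission (P.Qub lam) (A.qubits lam) → Op (Fin (A.qubits lam)) → ℝ) : ℝ :=
  P.keyAverage lam fun sk =>
    total (Prog.exec (P.sabotageOracle sk (A.qubits lam)) (Submission.empty _ _) (A.prog lam)) (v sk)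

section Loss

variable (P : PublicCoinScheme) {lam N : ℕ} (sk : P.Key lam)

/-- The expectation of `f` of the bank's refund `Count` for the coins `e`. -/
def PublicCoinScheme.refundExpectation {ι : Type} [Fintype ι] [DecidableEq ι] {r : ℕ}
    (e : Fin r × P.Qub lam ↪ ι) (σ : Op ι) (f : ℕ → ℝ) : ℝ :=
  ((P.privCount sk e σ).map fun a => a.2.trace.re * f a.1).sum

/-- The loss in the private sabotage game: the `m` submitted coins are counted publicly, and then the
bank counts the `m + 1` coins of the wallet.  The loss is `m + 1` minus the refund if all coins were
accepted, and `1` minus the refund otherwise. -/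
def PublicCoinScheme.privateLoss (s : Submission (P.Qub lam) N) (ρ : Op (Fin N)) : ℝ :=
  ((P.pubCount sk s.coins ρ).map fun a =>
    P.refundExpectation sk (walletCoins s.coins) a.2 fun refund =>
      if a.1 = s.m then s.m + 1 - refund else 1 - refund).sum

/-- The `i`-th group, in lexicographic order, when the coins `e` are divided into groups of
`n 0, n 1, …` coins. -/
def groupCoins {ι : Type} {r k : ℕ} {W : Type} (n : Fin k → ℕ) (h : ∑ i, n i = r)
    (e : Fin r × W ↪ ι) (i : Fin k) : Fin (n i) × W ↪ ι where
  toFun p := e (Fin.cast h (finSigmaFinEquiv ⟨i, p.1⟩), p.2)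
  inj' := by
    rintro ⟨a, w⟩ ⟨b, v⟩ hab
    have h1 := Prod.mk.inj (e.injective hab)
    have h2 := finSigmaFinEquiv.injective (Fin.cast_injective h h1.1)
    simp only [Sigma.mk.injEq, heq_eq_eq, true_and] at h2
    exact Prod.ext h2 h1.2

/-- Count the groups one after the other, each with a new wallet.  The outcome is the sum of the
sizes of the groups in which all coins were accepted. -/
def PublicCoinScheme.groupCount {ι : Type} [Fintype ι] [DecidableEq ι] {r k : ℕ} (n : Fin k → ℕ)
    (h : ∑ i, n i = r) (e : Fin r × P.Qub lam ↪ ι) (σ : Op ι) : List (ℕ × Op ι) :=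
  (List.finRange k).foldl
    (fun L i => L.flatMap fun b =>
      (P.pubCount sk (groupCoins n h e i) b.2).map fun a =>
        (b.1 + if a.1 = n i then n i else 0, discard a.2))
    [(0, σ)]

/-- The loss in the public sabotage game: the `m` submitted coins are counted publicly.  If all were
accepted, the `m + 1` coins of the wallet are paid out in groups of `n i` coins, and the loss is
`m + 1` minus the number of coins in groups that are accepted; otherwise the bank counts the wallet,
and the loss is `1` minus the refund. -/
def PublicCoinScheme.publicLoss {k : ℕ} (n : Fin k → ℕ) (s : Submission (P.Qub lam) N)
    (ρ : Op (Fin N)) : ℝ :=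
  if h : ∑ i, n i = s.m + 1 then
    ((P.pubCount sk s.coins ρ).map fun a =>
      if a.1 = s.m then
        ((P.groupCount sk n h (walletCoins s.coins) a.2).map fun b =>
          b.2.trace.re * ((s.m : ℝ) + 1 - b.1)).sum
      else P.refundExpectation sk (walletCoins s.coins) a.2 fun refund => 1 - refund).sum
  else 0

end Loss

def PublicCoinScheme.SecureAgainstPrivateSabotage (P : PublicCoinScheme) (M : Model) : Prop :=
  ∀ A : P.Saboteur, A.Admissible SabotageQuery.cost M →
    AtMostNegligible fun lam => P.sabotageExpectation A lam fun sk s ρ => P.privateLoss sk s ρ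

/-- The saboteur submits exactly `m lam` coins. -/
def PublicCoinScheme.Saboteur.Submits {P : PublicCoinScheme} (A : P.Saboteur) (m : ℕ → ℕ) : Prop :=
  ∀ lam, P.sabotageExpectation A lam (fun _ s ρ => if s.m = m lam then 0 else ρ.trace.re) = 0

def PublicCoinScheme.SecureAgainstPublicSabotage (P : PublicCoinScheme) (M : Model) : Prop :=
  ∀ (m k : ℕ → ℕ) (n : ∀ lam, Fin (k lam) → ℕ), (∀ lam, ∑ i, n lam i = m lam + 1) →
    ∀ A : P.Saboteur, A.Admissible SabotageQuery.cost M → A.Submits m →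
      AtMostNegligible fun lam =>
        P.sabotageExpectation A lam fun sk s ρ => P.publicLoss sk (n lam) s ρ

/-- Nonadaptive rational security: nonadaptive rational unforgeability and rational security against
private and public sabotage. -/
def PublicCoinScheme.NonadaptivelyRationallySecure (P : PublicCoinScheme) (M : Model) : Prop :=
  P.NonadaptivelyRationallyUnforgeable M ∧ P.SecureAgainstPrivateSabotage M ∧
    P.SecureAgainstPublicSabotage M

end QCoin

end

/-! Completeness and rank one force the accepting projector to be the projector on the minted state
itself (`verify_eq_pure_coin`). Call a private register good when it passes this projector, and let
t be the number of good registers among the K = (m+1)κ registers of a wallet with its fresh coin.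
The observable t commutes with all permutations of the registers, hence with both outcomes of every
public verification, so counting does not change its distribution (`ev_sector_pubCount`). All losses
can therefore be computed separately for each t, weighted by the distribution `weight` that t has
before the count. Since the fresh coin is good, only t ≥ κ occurs.

The symmetric subspaces are nested, so the event that all m coins are accepted amounts to one
application of the projection Π on the symmetric subspace of all K registers (`pubCount_accepted`).
The state before it lies in the range of the projection B that tests the fresh coin. By symmetry ΠBΠ
equals gΠ on the sector t, where g = C(t,κ)/C(K,κ); hence BΠB ≤ gB there, and within this sector all
coins are accepted with probability at most g ≤ (t/K)^κ (`symWeight_le`, via `ev_compress_le`).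

Private sabotage: the expected refund in the sector t is t/κ, so the loss is at most mg + 1 - t/κ.
With g replaced by its power bound this is convex in t/K; it vanishes at t = K and is at most
2·2^(-κ) at t = κ (`mul_goodFraction_sub_le`). As κ outgrows every multiple of log λ, this is
negligible.

Public sabotage: a group of an accepted wallet is in a permutation-invariant state. Its acceptance
probability is an average over permutations of the fresh and group registers; a permutation
contributes the probability that the registers it exchanges with the fresh coin are all good
(`ev_regPerm_adjoin`, `acceptProb_sandwich`). At most κ registers are exchanged, so each group
passes with probability at least g. This suffices with two or more bad registers; with exactly one,
the mean number of exchanged registers gives the exact probability (`public_loss_le`).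

Forgery: if n coins were minted, the expected gain of a single count of r coins is at most r times
the probability that more than κn submitted registers are good, plus 2·2^(-κ) when the count is
public (`refund_gain_le`, `pubCount_gain_le`). That event is a forgery of the private scheme. The
reduction mints κ private coins for each public coin, submits all registers to its first count and
halts, so it is nonadaptive. Its simulation is exact up to that count, and later actions cannot
increase the capped utility. Thus nonadaptive unforgeability of the private scheme suffices in both
statements. -/

noncomputable section

namespace QCoin

open scoped ComplexOrder
open Matrix

set_option linter.unusedSectionVars false

/-! ### Expectations -/

section Expectation

variable {n : Type} [Fintype n] [DecidableEq n]

/-- The (real part of the) expectation of `X` in the state `ρ`. -/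
def ev (X ρ : Matrix n n ℂ) : ℝ := (X * ρ).trace.re

theorem ev_add_left (X Y ρ : Matrix n n ℂ) : ev (X + Y) ρ = ev X ρ + ev Y ρ := by
  simp [ev, add_mul]

theorem ev_sub_left (X Y ρ : Matrix n n ℂ) : ev (X - Y) ρ = ev X ρ - ev Y ρ := by
  simp [ev, sub_mul]

theorem ev_smul_left (a : ℝ) (X ρ : Matrix n n ℂ) : ev (a • X) ρ = a * ev X ρ := by
  simp [ev]

theorem ev_sum_left {κ : Type} (s : Finset κ) (X : κ → Matrix n n ℂ) (ρ : Matrix n n ℂ) :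
    ev (∑ i ∈ s, X i) ρ = ∑ i ∈ s, ev (X i) ρ := by
  simp [ev, Finset.sum_mul, trace_sum]

theorem ev_one (ρ : Matrix n n ℂ) : ev 1 ρ = ρ.trace.re := by simp [ev]

theorem ev_zero_left (ρ : Matrix n n ℂ) : ev 0 ρ = 0 := by simp [ev]

theorem ev_mul_left (X Y ρ : Matrix n n ℂ) : ev (X * Y) ρ = ev X (Y * ρ) := by
  simp [ev, Matrix.mul_assoc]

/-- Passage to the Heisenberg picture. The operator `K` may be rectangular, so that adjoining a
register is covered as well. -/
theorem ev_conj {k : Type} [Fintype k] [DecidableEq k] (X : Matrix k k ℂ) (K : Matrix k n ℂ)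
    (ρ : Matrix n n ℂ) : ev X (K * ρ * Kᴴ) = ev (Kᴴ * X * K) ρ := by
  unfold ev
  rw [← Matrix.mul_assoc, trace_mul_comm]
  simp only [Matrix.mul_assoc]

theorem ev_mul_right (X Y ρ : Matrix n n ℂ) : ev X (ρ * Y) = ev (Y * X) ρ := by
  unfold ev
  rw [← Matrix.mul_assoc, trace_mul_comm]
  simp only [Matrix.mul_assoc]

theorem posSemidef_sqrt {A : Matrix n n ℂ} (hA : A.PosSemidef) :
    ∃ C : Matrix n n ℂ, A = Cᴴ * C := by
  open scoped MatrixOrder in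
  obtain ⟨X, hX, -, h⟩ :=
    CFC.exists_sqrt_of_isSelfAdjoint_of_quasispectrumRestricts hA.isHermitian
      (QuasispectrumRestricts.nnreal_of_nonneg hA.nonneg)
  refine ⟨X, ?_⟩
  rw [← h]
  exact congrArg (· * X) hX.star_eq.symm

theorem PosSemidef_trace_re_nonneg {A : Matrix n n ℂ} (hA : A.PosSemidef) : 0 ≤ A.trace.re :=
  (Complex.le_def.mp hA.trace_nonneg).1

theorem ev_nonneg {X ρ : Matrix n n ℂ} (hX : X.PosSemidef) (hρ : ρ.PosSemidef) : 0 ≤ ev X ρ := by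
  obtain ⟨C, rfl⟩ := posSemidef_sqrt hX
  have : ev (Cᴴ * C) ρ = ev 1 (C * ρ * Cᴴ) := by rw [ev_conj, Matrix.mul_one]
  rw [this, ev_one]
  exact PosSemidef_trace_re_nonneg (hρ.mul_mul_conjTranspose_same C)

end Expectation

/-! ### Operators that act on part of the qubits -/

section Lift

variable {α β ι : Type} [Fintype α] [DecidableEq α] [Fintype ι] [DecidableEq ι]
  [Fintype β] [DecidableEq β]

/-- Split the qubits into those in the range of `e` and the others. -/
def splitEquiv (e : α ↪ ι) :
    (ι → Bool) ≃ (α → Bool) × ({i // i ∉ Set.range e} → Bool) where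
  toFun x := (x ∘ e, fun i => x i)
  invFun p i := by
    classical
    exact if h : i ∈ Set.range e then p.1 h.choose else p.2 ⟨i, h⟩
  left_inv x := by
    funext i
    by_cases h : i ∈ Set.range e
    · simp only [h, dif_pos, Function.comp]
      rw [h.choose_spec]
    · simp only [h, dif_neg, not_false_eq_true]
  right_inv p := by
    ext j
    · have h : e j ∈ Set.range e := ⟨j, rfl⟩
      simp only [Function.comp, dif_pos h]
      rw [e.injective h.choose_spec]
    · simp only [dif_neg j.2]

open Classical in
-- After the basis is split along `e`, a lifted operator is a Kronecker product with the identity;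
-- multiplicativity is inherited from there.
theorem liftOp_eq (e : α ↪ ι) (A : Op α) :
    liftOp e A = (kroneckerMap (· * ·) A
      (1 : Matrix ({i // i ∉ Set.range e} → Bool) _ ℂ)).submatrix (splitEquiv e) (splitEquiv e) := by
  ext x y
  simp only [liftOp, submatrix_apply, kroneckerMap_apply, splitEquiv, Equiv.coe_fn_mk, one_apply,
    funext_iff, Subtype.forall]
  split_ifs <;> simp

theorem liftOp_mul (e : α ↪ ι) (A B : Op α) : liftOp e (A * B) = liftOp e A * liftOp e B := by
  classical
  simp only [liftOp_eq]
  rw [submatrix_mul_equiv, ← mul_kronecker_mul, Matrix.mul_one]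

theorem liftOp_one (e : α ↪ ι) : liftOp e (1 : Op α) = 1 := by
  classical
  rw [liftOp_eq, one_kronecker_one, submatrix_one_equiv]

theorem liftOp_add (e : α ↪ ι) (A B : Op α) : liftOp e (A + B) = liftOp e A + liftOp e B := by
  ext x y
  simp only [liftOp, Matrix.add_apply]
  split_ifs <;> simp

theorem liftOp_smul {R : Type} [Zero R] [SMulZeroClass R ℂ] (e : α ↪ ι) (a : R) (A : Op α) :
    liftOp e (a • A) = a • liftOp e A := by
  ext x y
  simp only [liftOp, Matrix.smul_apply]
  split_ifs <;> simp

theorem liftOp_zero (e : α ↪ ι) : liftOp e (0 : Op α) = 0 := by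
  ext x y
  simp [liftOp]

theorem liftOp_sub (e : α ↪ ι) (A B : Op α) : liftOp e (A - B) = liftOp e A - liftOp e B := by
  ext x y
  simp only [liftOp, Matrix.sub_apply]
  split_ifs <;> simp

theorem liftOp_sum {κ : Type} (e : α ↪ ι) (s : Finset κ) (A : κ → Op α) :
    liftOp e (∑ k ∈ s, A k) = ∑ k ∈ s, liftOp e (A k) := by
  classical
  induction s using Finset.induction_on with
  | empty => simp [liftOp_zero]
  | insert a s ha ih => rw [Finset.sum_insert ha, Finset.sum_insert ha, liftOp_add, ih]

theorem liftOp_conjTranspose (e : α ↪ ι) (A : Op α) : liftOp e Aᴴ = (liftOp e A)ᴴ := by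
  ext x y
  simp only [liftOp, conjTranspose_apply, eq_comm (a := x _)]
  split_ifs <;> simp

theorem liftOp_trans (e : α ↪ β) (f : β ↪ ι) (A : Op α) :
    liftOp (e.trans f) A = liftOp f (liftOp e A) := by
  ext x y
  simp only [liftOp]
  by_cases h : ∀ i, i ∉ Set.range f → x i = y i
  · rw [if_pos h]
    by_cases h' : ∀ j, j ∉ Set.range e → (x ∘ f) j = (y ∘ f) j
    · rw [if_pos h', if_pos]
      · rfl
      · intro i hi
        by_cases hf : i ∈ Set.range f
        · obtain ⟨j, rfl⟩ := hf
          exact h' j fun ⟨k, hk⟩ => hi ⟨k, by simp [hk]⟩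
        · exact h i hf
    · rw [if_neg h', if_neg]
      intro H
      refine h' fun j hj => H _ ?_
      rintro ⟨k, hk⟩
      exact hj ⟨k, f.injective hk⟩
  · rw [if_neg h, if_neg]
    intro H
    refine h fun i hi => H i ?_
    rintro ⟨k, rfl⟩
    exact hi ⟨e k, rfl⟩

theorem liftOp_equiv (e : α ≃ ι) (A : Op α) :
    liftOp e.toEmbedding A = A.submatrix (fun x => x ∘ e) (fun x => x ∘ e) := by
  ext x y
  simp only [liftOp, submatrix_apply]
  rw [if_pos]
  · rfl
  · intro i hi
    exact absurd (e.surjective i) hi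

theorem liftOp_posSemidef (e : α ↪ ι) {A : Op α} (hA : A.PosSemidef) : (liftOp e A).PosSemidef := by
  obtain ⟨C, rfl⟩ := posSemidef_sqrt hA
  rw [liftOp_mul, liftOp_conjTranspose]
  exact posSemidef_conjTranspose_mul_self _

theorem liftOp_inl_mul_inr (A : Op α) (B : Op β) :
    liftOp (Function.Embedding.inl : α ↪ α ⊕ β) A * liftOp Function.Embedding.inr B =
      of fun x y => A (x ∘ Sum.inl) (y ∘ Sum.inl) * B (x ∘ Sum.inr) (y ∘ Sum.inr) := by
  ext x y
  -- The left factor fixes the second half of the intermediate index and the right factor the first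
  -- half, so a single term survives.
  rw [of_apply, mul_apply, Finset.sum_eq_single (Sum.elim (y ∘ Sum.inl) (x ∘ Sum.inr))]
  · simp only [liftOp]
    rw [if_pos, if_pos]
    · rfl
    · rintro (i | i) hi
      · rfl
      · exact absurd ⟨i, rfl⟩ hi
    · rintro (i | i) hi
      · exact absurd ⟨i, rfl⟩ hi
      · rfl
  · intro z _ hz
    by_contra h
    apply hz
    rw [liftOp, liftOp] at h
    split_ifs at h with h1 h2
    · funext i
      rcases i with i | i
      · exact h2 (Sum.inl i) (by simp)
      · exact (h1 (Sum.inr i) (by simp)).symm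
    all_goals simp at h
  · intro h
    exact absurd (Finset.mem_univ _) h

/-- Taking adjoints in `liftOp_inl_mul_inr` reverses the product but gives the same matrix entries.
-/
theorem liftOp_inr_mul_inl (A : Op α) (B : Op β) :
    liftOp Function.Embedding.inr B * liftOp (Function.Embedding.inl : α ↪ α ⊕ β) A =
      liftOp (Function.Embedding.inl : α ↪ α ⊕ β) A * liftOp Function.Embedding.inr B := by
  have h := congrArg conjTranspose (liftOp_inl_mul_inr Aᴴ Bᴴ)
  rw [conjTranspose_mul, ← liftOp_conjTranspose, ← liftOp_conjTranspose, conjTranspose_conjTranspose,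
    conjTranspose_conjTranspose] at h
  rw [h, liftOp_inl_mul_inr]
  ext x y
  simp [conjTranspose_apply]

/-- The union of two disjoint registers. -/
def sumEmb (e : α ↪ ι) (f : β ↪ ι) (h : ∀ a b, e a ≠ f b) : α ⊕ β ↪ ι where
  toFun := Sum.elim e f
  inj' := e.injective.sumElim f.injective h

/-- Two disjoint registers embed jointly through `sumEmb`, which reduces the claim to the two halves
of a sum type. -/
theorem liftOp_commute (e : α ↪ ι) (f : β ↪ ι) (h : ∀ a b, e a ≠ f b) (A : Op α) (B : Op β) :
    Commute (liftOp e A) (liftOp f B) := by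
  have h1 : e = Function.Embedding.inl.trans (sumEmb e f h) := by ext; rfl
  have h2 : f = Function.Embedding.inr.trans (sumEmb e f h) := by ext; rfl
  unfold Commute SemiconjBy
  rw [h1]
  nth_rw 2 [h2]
  nth_rw 3 [h2]
  rw [liftOp_trans, liftOp_trans, ← liftOp_mul, ← liftOp_mul, liftOp_inr_mul_inl]

theorem liftOp_commute_of_commute (e : α ↪ ι) {A B : Op α} (h : Commute A B) :
    Commute (liftOp e A) (liftOp e B) := by
  unfold Commute SemiconjBy
  rw [← liftOp_mul, ← liftOp_mul, h.eq]

end Lift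

/-! ### Tensor products of projectors -/

section TensorAlgebra

variable {V Q : Type} [Fintype V] [DecidableEq V] [Fintype Q] [DecidableEq Q]

theorem tensorOp_eq_zero {A : V → Op Q} (j : V) (h : A j = 0) : tensorOp A = 0 := by
  ext x y
  exact Finset.prod_eq_zero (Finset.mem_univ j) (by simp [h])

/-- The projector `E` on the registers in `S`, tensored with the identity on the others. -/
def allOn (E : Op Q) (S : Finset V) : Op (V × Q) := tensorOp fun j => if j ∈ S then E else 1

/-- The function `f` of the number of registers on which the effect `E` is observed. -/
def sector (V : Type) [Fintype V] [DecidableEq V] (E : Op Q) (f : ℕ → ℝ) : Op (V × Q) :=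
  ∑ T : Finset V, f T.card • patternEffect E T

theorem sector_one (E : Op Q) : sector V E (fun _ => 1) = 1 := by
  simp [sector, sum_patternEffect]

theorem sector_sum {κ : Type} (E : Op Q) (s : Finset κ) (f : κ → ℕ → ℝ) :
    sector V E (fun t => ∑ k ∈ s, f k t) = ∑ k ∈ s, sector V E (f k) := by
  unfold sector
  simp only [Finset.sum_smul]
  rw [Finset.sum_comm]

theorem sector_smul (E : Op Q) (a : ℝ) (f : ℕ → ℝ) :
    sector V E (fun t => a * f t) = a • sector V E f := by
  simp [sector, Finset.smul_sum, smul_smul]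

theorem sector_congr (E : Op Q) {f g : ℕ → ℝ} (h : ∀ t ≤ Fintype.card V, f t = g t) :
    sector V E f = sector V E g :=
  Finset.sum_congr rfl fun T _ => by rw [h _ T.card_le_univ]

/-- The projector on the event that `E` is observed on exactly `t` registers. -/
def level (V : Type) [Fintype V] [DecidableEq V] (E : Op Q) (t : ℕ) : Op (V × Q) :=
  sector V E (Pi.single t 1)

theorem sector_eq_sum_level (E : Op Q) (f : ℕ → ℝ) :
    sector V E f = ∑ t ∈ Finset.range (Fintype.card V + 1), f t • level V E t := by
  simp only [level, ← sector_smul, ← sector_sum]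
  refine sector_congr E fun t ht => ?_
  rw [Finset.sum_eq_single t]
  · simp
  · intro s _ hs
    simp [hs.symm]
  · intro h
    exact absurd (Finset.mem_range.mpr (by omega)) h

variable {E : Op Q}

theorem patternEffect_conjTranspose (hH : Eᴴ = E) (T : Finset V) :
    (patternEffect E T)ᴴ = patternEffect E T := by
  unfold patternEffect
  rw [tensorOp_conjTranspose]
  congr 1
  funext j
  split_ifs <;> simp [hH]

theorem allOn_conjTranspose (hH : Eᴴ = E) (T : Finset V) : (allOn E T)ᴴ = allOn E T := by
  unfold allOn
  rw [tensorOp_conjTranspose]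
  congr 1
  funext j
  split_ifs <;> simp [hH]

theorem sector_conjTranspose (hH : Eᴴ = E) (f : ℕ → ℝ) : (sector V E f)ᴴ = sector V E f := by
  unfold sector
  rw [conjTranspose_sum]
  refine Finset.sum_congr rfl fun T _ => ?_
  rw [conjTranspose_smul, patternEffect_conjTranspose hH, star_trivial]

theorem allOn_mul_patternEffect (hE : E * E = E) (S T : Finset V) :
    allOn E S * patternEffect E T = if S ⊆ T then patternEffect E T else 0 := by
  unfold allOn patternEffect
  rw [tensorOp_mul]
  split_ifs with h
  · congr 1
    funext j
    by_cases hj : j ∈ S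
    · simp [hj, h hj, hE]
    · simp [hj]
  · obtain ⟨j, hjS, hjT⟩ := Finset.not_subset.mp h
    exact tensorOp_eq_zero j (by simp [hjS, hjT, mul_sub, hE])

theorem patternEffect_mul_allOn (hE : E * E = E) (S T : Finset V) :
    patternEffect E T * allOn E S = if S ⊆ T then patternEffect E T else 0 := by
  rw [← allOn_mul_patternEffect hE]
  unfold allOn patternEffect
  rw [tensorOp_mul, tensorOp_mul]
  congr 1
  funext j
  split_ifs <;> simp [mul_sub, sub_mul]

theorem patternEffect_mul_patternEffect (hE : E * E = E) (S T : Finset V) :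
    patternEffect E S * patternEffect E T = if S = T then patternEffect E T else 0 := by
  unfold patternEffect
  rw [tensorOp_mul]
  split_ifs with h
  · subst h
    congr 1
    funext j
    split_ifs <;> simp [mul_sub, sub_mul, hE]
  · have : ∃ j, ¬ (j ∈ S ↔ j ∈ T) := by
      by_contra! H
      exact h (Finset.ext H)
    obtain ⟨j, hj⟩ := this
    refine tensorOp_eq_zero j ?_
    by_cases hS : j ∈ S <;> by_cases hT : j ∈ T <;> simp_all [mul_sub, sub_mul]

theorem allOn_mul_allOn (hE : E * E = E) (S T : Finset V) :
    allOn E S * allOn E T = allOn E (S ∪ T) := by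
  unfold allOn
  rw [tensorOp_mul]
  congr 1
  funext j
  by_cases hS : j ∈ S <;> by_cases hT : j ∈ T <;> simp_all

/-- When `E` is idempotent the patterns are mutually orthogonal idempotents, so `sector` is the
functional calculus of the number of good registers. -/
theorem sector_mul_sector (hE : E * E = E) (f g : ℕ → ℝ) :
    sector V E f * sector V E g = sector V E fun t => f t * g t := by
  unfold sector
  rw [Finset.sum_mul]
  refine Finset.sum_congr rfl fun T _ => ?_
  rw [Finset.mul_sum, Finset.sum_eq_single T]
  · rw [smul_mul_smul_comm, patternEffect_mul_patternEffect hE, if_pos rfl]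
  · intro S _ hS
    rw [smul_mul_smul_comm, patternEffect_mul_patternEffect hE, if_neg hS.symm, smul_zero]
  · simp

theorem level_mul_self (hE : E * E = E) (t : ℕ) : level V E t * level V E t = level V E t := by
  unfold level
  rw [sector_mul_sector hE]
  congr 1
  funext s
  by_cases h : s = t
  · subst h; simp
  · simp [h]

theorem sector_commute_allOn (hE : E * E = E) (f : ℕ → ℝ) (S : Finset V) :
    Commute (sector V E f) (allOn E S) := by
  unfold sector
  refine Commute.sum_left _ _ _ fun T _ => Commute.smul_left ?_ _
  unfold Commute SemiconjBy
  rw [patternEffect_mul_allOn hE, allOn_mul_patternEffect hE]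

/-- Double counting: a pattern `T` survives the test of exactly those `s`-element sets that it
contains. -/
theorem sum_allOn_mul_sector (hE : E * E = E) (f : ℕ → ℝ) (s : ℕ) :
    (∑ S ∈ Finset.powersetCard s (Finset.univ : Finset V), allOn E S) * sector V E f =
      sector V E fun t => t.choose s * f t := by
  unfold sector
  rw [Finset.mul_sum]
  refine Finset.sum_congr rfl fun T _ => ?_
  rw [Finset.sum_mul]
  simp only [mul_smul_comm, allOn_mul_patternEffect hE]
  rw [← Finset.smul_sum, ← Finset.sum_filter, Finset.sum_const]
  have : (Finset.powersetCard s (Finset.univ : Finset V)).filter (· ⊆ T) =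
      Finset.powersetCard s T := by
    ext S
    simp [Finset.mem_powersetCard, and_comm]
  rw [this, Finset.card_powersetCard, ← Nat.cast_smul_eq_nsmul ℝ, smul_smul, mul_comm]

theorem allOn_empty : allOn E (∅ : Finset V) = 1 := by
  simp [allOn, tensorOp_one]

/-- The number of registers on which `E` is observed is the sum over the registers; this needs no
assumption on `E`. -/
theorem sector_id : sector V E (fun t => (t : ℝ)) = ∑ i, allOn E {i} := by
  have h : ∀ i : V, allOn E {i} = ∑ T : Finset V, if i ∈ T then patternEffect E T else 0 := by
    intro i
    ext x y
    simp only [Matrix.sum_apply]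
    -- Each register other than `i` contributes `1 = E + (1 - E)`, while `i` contributes `E + 0`; in
    -- this form `Finset.prod_add` reassembles the patterns.
    have h1 : ∀ T : Finset V, (if i ∈ T then patternEffect E T else 0 : Op (V × Q)) x y =
        (∏ j ∈ T, (if j = i then E else E) (fun q => x (j, q)) fun q => y (j, q)) *
          ∏ j ∈ Finset.univ \ T, (if j = i then 0 else 1 - E) (fun q => x (j, q))
            fun q => y (j, q) := by
      intro T
      split_ifs with hi
      · unfold patternEffect tensorOp
        rw [← Finset.prod_mul_prod_compl T, Finset.compl_eq_univ_sdiff]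
        congr 1
        · exact Finset.prod_congr rfl fun j hj => by simp [hj]
        · refine Finset.prod_congr rfl fun j hj => ?_
          have hj' := (Finset.mem_sdiff.mp hj).2
          have : j ≠ i := fun h => hj' (h ▸ hi)
          simp [hj', this]
      · rw [Finset.prod_eq_zero (s := Finset.univ \ T) (i := i)]
        · simp
        · simp [hi]
        · simp
    simp only [h1]
    rw [← Finset.powerset_univ, ← Finset.prod_add]
    unfold allOn tensorOp
    refine Finset.prod_congr rfl fun j _ => ?_
    by_cases hj : j = i
    · simp [hj]
    · simp only [Finset.mem_singleton, hj, if_false]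
      rw [← Matrix.add_apply, add_sub_cancel]
  simp only [h]
  rw [Finset.sum_comm]
  unfold sector
  refine Finset.sum_congr rfl fun T _ => ?_
  rw [Finset.sum_ite_mem, Finset.univ_inter, Finset.sum_const, ← Nat.cast_smul_eq_nsmul ℝ]

/-- The register `i`. -/
def regEmb (i : V) : Q ↪ V × Q := ⟨fun q => (i, q), fun _ _ h => (Prod.mk.inj h).2⟩

theorem liftOp_regEmb (i : V) (A : Op Q) : liftOp (regEmb i) A = allOn A ({i} : Finset V) := by
  ext x y
  have hr : ∀ p : V × Q, p ∉ Set.range (regEmb (Q := Q) i) ↔ p.1 ≠ i := by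
    rintro ⟨j, q⟩
    constructor
    · rintro h rfl
      exact h ⟨q, rfl⟩
    · rintro h ⟨q', hq⟩
      exact h (Prod.mk.inj hq).1.symm
  simp only [liftOp, allOn, tensorOp, Finset.mem_singleton]
  split_ifs with h
  · rw [Finset.prod_eq_single i]
    · rw [if_pos rfl]
      rfl
    · intro j _ hj
      rw [if_neg hj, one_apply, if_pos]
      funext q
      exact h (j, q) ((hr _).mpr hj)
    · simp
  · push Not at h
    obtain ⟨⟨j, q⟩, hj, hne⟩ := h
    rw [Finset.prod_eq_zero (Finset.mem_univ j)]
    rw [if_neg ((hr _).mp hj), one_apply_ne]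
    exact fun H => hne (congrFun H q)

end TensorAlgebra

/-! ### Permutations of registers -/

section Permutations

variable {V Q : Type} [Fintype V] [DecidableEq V] [Fintype Q] [DecidableEq Q] {E : Op Q}

/-- The operator that permutes the registers. -/
def regPerm (Q : Type) [Fintype Q] [DecidableEq Q] (π : Equiv.Perm V) : Op (V × Q) :=
  (permReg V Q π).permMatrix ℂ

/-- The order is reversed because `permMatrix` is contravariant while `permReg` is a homomorphism.
-/
theorem regPerm_mul (π τ : Equiv.Perm V) : regPerm Q π * regPerm Q τ = regPerm Q (τ * π) := by
  unfold regPerm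
  rw [permReg_mul, Matrix.permMatrix_mul]

theorem regPerm_conjTranspose (π : Equiv.Perm V) : (regPerm Q π)ᴴ = regPerm Q π⁻¹ := by
  unfold regPerm
  rw [conjTranspose_permMatrix, permReg_inv]

theorem regPerm_mul_apply (π : Equiv.Perm V) (M : Op (V × Q)) (x y) :
    (regPerm Q π * M) x y = M (fun p => x (π.symm p.1, p.2)) y := by
  unfold regPerm
  rw [Equiv.Perm.permMatrix, PEquiv.toMatrix_toPEquiv_mul]
  rfl

theorem mul_regPerm_apply (π : Equiv.Perm V) (M : Op (V × Q)) (x y) :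
    (M * regPerm Q π) x y = M x (fun p => y (π p.1, p.2)) := by
  unfold regPerm
  rw [Equiv.Perm.permMatrix, PEquiv.mul_toMatrix_toPEquiv]
  rfl

theorem regPerm_mul_tensorOp (π : Equiv.Perm V) (A : V → Op Q) :
    regPerm Q π * tensorOp A = tensorOp (A ∘ π) * regPerm Q π := by
  ext x y
  rw [regPerm_mul_apply, mul_regPerm_apply]
  unfold tensorOp
  refine Fintype.prod_equiv π.symm _ _ fun j => ?_
  simp

theorem regPerm_mul_allOn (π : Equiv.Perm V) (S : Finset V) :
    regPerm Q π * allOn E S = allOn E (S.map π.symm.toEmbedding) * regPerm Q π := by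
  unfold allOn
  rw [regPerm_mul_tensorOp]
  congr 2
  funext j
  simp only [Function.comp, Finset.mem_map_equiv, Equiv.symm_symm]

theorem allOn_mul_regPerm (π : Equiv.Perm V) (S : Finset V) :
    allOn E S * regPerm Q π = regPerm Q π * allOn E (S.map π.toEmbedding) := by
  rw [regPerm_mul_allOn, Finset.map_map]
  congr 2
  ext j
  simp

theorem regPerm_mul_patternEffect (π : Equiv.Perm V) (S : Finset V) :
    regPerm Q π * patternEffect E S =
      patternEffect E (S.map π.symm.toEmbedding) * regPerm Q π := by
  unfold patternEffect
  rw [regPerm_mul_tensorOp]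
  congr 2
  funext j
  simp only [Function.comp, Finset.mem_map_equiv, Equiv.symm_symm]

/-- A permutation carries patterns to patterns of the same size, and the coefficients depend on the
size only. -/
theorem regPerm_commute_sector (π : Equiv.Perm V) (f : ℕ → ℝ) :
    Commute (regPerm Q π) (sector V E f) := by
  unfold Commute SemiconjBy sector
  rw [Finset.mul_sum, Finset.sum_mul]
  refine Fintype.sum_equiv (Equiv.finsetCongr π.symm) _ _ fun T => ?_
  rw [mul_smul_comm, smul_mul_assoc, regPerm_mul_patternEffect, Equiv.finsetCongr_apply,
    Finset.card_map]

theorem symProj_eq (V Q : Type) [Fintype V] [DecidableEq V] [Fintype Q] [DecidableEq Q] :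
    symProj V Q = ((Fintype.card V).factorial : ℂ)⁻¹ • ∑ π : Equiv.Perm V, regPerm Q π := rfl

theorem regPerm_mul_symProj (π : Equiv.Perm V) : regPerm Q π * symProj V Q = symProj V Q :=
  perm_mul_symProj V Q π

theorem symProj_mul_regPerm (π : Equiv.Perm V) : symProj V Q * regPerm Q π = symProj V Q := by
  have := congrArg conjTranspose (regPerm_mul_symProj (Q := Q) π⁻¹)
  rwa [conjTranspose_mul, regPerm_conjTranspose, inv_inv, symProj_isHermitian] at this

theorem symProj_commute_of_regPerm {X : Op (V × Q)} (h : ∀ π, Commute (regPerm Q π) X) :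
    Commute (symProj V Q) X := by
  rw [symProj_eq]
  exact Commute.smul_left (Commute.sum_left _ _ _ fun π _ => h π) _

theorem symProj_commute_sector (f : ℕ → ℝ) : Commute (symProj V Q) (sector V E f) :=
  symProj_commute_of_regPerm fun π => regPerm_commute_sector π f

theorem exists_perm_map {S T : Finset V} (h : S.card = T.card) :
    ∃ π : Equiv.Perm V, S.map π.toEmbedding = T := by
  have e : {x // x ∈ S} ≃ {x // x ∈ T} := Fintype.equivOfCardEq (by simpa using h)
  refine ⟨e.extendSubtype, ?_⟩
  refine Finset.eq_of_subset_of_card_le ?_ (by rw [Finset.card_map, h])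
  intro x hx
  obtain ⟨y, hy, rfl⟩ := Finset.mem_map.mp hx
  exact e.extendSubtype_mem y hy

/-- A permutation that carries `S` to `T` is absorbed by the symmetric projection on either side. -/
theorem symProj_allOn_symProj_eq {S T : Finset V} (h : S.card = T.card) :
    symProj V Q * allOn E S * symProj V Q = symProj V Q * allOn E T * symProj V Q := by
  obtain ⟨π, rfl⟩ := exists_perm_map h
  calc _ = symProj V Q * allOn E S * (regPerm Q π * symProj V Q) := by rw [regPerm_mul_symProj]
    _ = symProj V Q * (allOn E S * regPerm Q π) * symProj V Q := by simp only [Matrix.mul_assoc]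
    _ = _ := by rw [allOn_mul_regPerm, ← Matrix.mul_assoc (symProj V Q), symProj_mul_regPerm]

/-- The probability that the registers `S` are all in `E`, given that exactly `t` of them are, in a
permutation-invariant state. -/
theorem symProj_allOn_symProj_sector (hE : E * E = E) (S : Finset V) (f : ℕ → ℝ) :
    symProj V Q * allOn E S * symProj V Q * sector V E f =
      symProj V Q * sector V E fun t =>
        ((t.choose S.card : ℝ) / (Fintype.card V).choose S.card) * f t := by
  set N := (Fintype.card V).choose S.card
  have hN : (N : ℝ) ≠ 0 := by
    have : 0 < N := Nat.choose_pos S.card_le_univ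
    positivity
  have hcomm := (symProj_commute_sector (V := V) (E := E) f).eq
  -- All `N` sets of the size of `S` contribute equally, so the single set may be replaced by the
  -- sum over all of them, which is a binomial coefficient on each pattern.
  have h1 : (N : ℝ) • (symProj V Q * allOn E S * symProj V Q * sector V E f) =
      symProj V Q * sector V E fun t => t.choose S.card * f t := by
    rw [← sum_allOn_mul_sector hE]
    have : (N : ℝ) • (symProj V Q * allOn E S * symProj V Q * sector V E f) =
        ∑ T ∈ Finset.powersetCard S.card (Finset.univ : Finset V),
          symProj V Q * allOn E T * symProj V Q * sector V E f := by
      rw [Finset.sum_congr rfl (g := fun _ => symProj V Q * allOn E S * symProj V Q * sector V E f),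
        Finset.sum_const, Finset.card_powersetCard, Nat.cast_smul_eq_nsmul]
      · rfl
      · intro T hT
        rw [symProj_allOn_symProj_eq (Finset.mem_powersetCard.mp hT).2]
    rw [this]
    calc _ = symProj V Q * ((∑ T ∈ Finset.powersetCard S.card (Finset.univ : Finset V),
          allOn E T) * sector V E f) * symProj V Q := by
          rw [← Finset.sum_mul, ← Finset.sum_mul, ← Finset.mul_sum, Matrix.mul_assoc _ _ (sector V E f),
            hcomm]
          simp only [Matrix.mul_assoc]
      _ = _ := by
          rw [sum_allOn_mul_sector hE, Matrix.mul_assoc, ← (symProj_commute_sector _).eq,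
            ← Matrix.mul_assoc, symProj_mul_self]
  have h2 : (fun t : ℕ => ((t.choose S.card : ℝ) / N) * f t) =
      fun t => (N : ℝ)⁻¹ * (t.choose S.card * f t) := by
    funext t
    ring
  rw [h2, sector_smul, Matrix.mul_smul, ← h1, smul_smul, inv_mul_cancel₀ hN, one_smul]

/-- Registers in one and the same pure state may be permuted among themselves. Rank one matters: it
separates the ket factor, a product over `U` invariant under the permutation, from the bra factor.
-/
theorem regPerm_mul_allOn_of_fixes (ψ : Vec Q) (U : Finset V) (π : Equiv.Perm V)
    (h : ∀ v, v ∉ U → π v = v) : regPerm Q π * allOn (pure ψ) U = allOn (pure ψ) U := by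
  have h' : ∀ v, v ∉ U → π.symm v = v := fun v hv => by
    rw [Equiv.symm_apply_eq, h v hv]
  have key : ∀ x y : V × Q → Bool, allOn (pure ψ) U x y =
      (∏ j, if j ∈ U then ψ (fun q => x (j, q)) else 1) *
        ∏ j, if j ∈ U then star (ψ fun q => y (j, q)) else
          (1 : Op Q) (fun q => x (j, q)) (fun q => y (j, q)) := by
    intro x y
    unfold allOn tensorOp
    rw [← Finset.prod_mul_distrib]
    refine Finset.prod_congr rfl fun j _ => ?_
    by_cases hj : j ∈ U
    · simp only [if_pos hj]
      rfl
    · simp only [if_neg hj, one_mul]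
  have hmem : ∀ v, π.symm v ∈ U ↔ v ∈ U := by
    intro v
    constructor
    · intro hv
      by_contra hn
      rw [h' v hn] at hv
      exact hn hv
    · intro hv
      by_contra hn
      have := h _ hn
      rw [Equiv.apply_symm_apply] at this
      rw [← this] at hn
      exact hn hv
  ext x y
  rw [regPerm_mul_apply, key, key]
  congr 1
  · refine Fintype.prod_equiv π.symm _ _ fun j => ?_
    simp only [hmem]
  · refine Finset.prod_congr rfl fun j _ => ?_
    by_cases hj : j ∈ U
    · simp only [if_pos hj]
    · rw [if_neg hj, if_neg hj]
      exact congrArg (fun v => (1 : Op Q) (fun q => x (v, q)) fun q => y (j, q)) (h' j hj)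

/-- The two permutations differ by one that only moves registers of `U`. -/
theorem regPerm_mul_allOn_congr (ψ : Vec Q) (U : Finset V) (π τ : Equiv.Perm V)
    (h : ∀ v, v ∉ U → π.symm v = τ.symm v) :
    regPerm Q π * allOn (pure ψ) U = regPerm Q τ * allOn (pure ψ) U := by
  have h1 : regPerm Q π = regPerm Q τ * regPerm Q (π * τ⁻¹) := by
    rw [regPerm_mul]
    congr 1
    group
  rw [h1, Matrix.mul_assoc, regPerm_mul_allOn_of_fixes]
  intro v hv
  change π (τ.symm v) = v
  rw [← h v hv, Equiv.apply_symm_apply]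

/-- Seen from outside the registers `F`, all of which are in the state `ψ`, a permutation acts as a
projection on `ψ` followed by a permutation that does not touch `F`. -/
theorem exists_allOn_regPerm_allOn (ψ : Vec Q) (hE : pure ψ * pure ψ = pure ψ) (F : Finset V)
    (π : Equiv.Perm V) : ∃ τ : Equiv.Perm V, (∀ v ∈ F, τ v = v) ∧
      allOn (pure ψ) F * regPerm Q π * allOn (pure ψ) F =
        regPerm Q τ * allOn (pure ψ) (F.map π.toEmbedding ∪ F) := by
  set U := F.map π.toEmbedding ∪ F
  have hU : ∀ v, v ∉ U → π.symm v ∉ F := by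
    intro v hv hF
    exact hv (Finset.mem_union_left _ (Finset.mem_map_equiv.mpr hF))
  -- The prescription is the identity on `F` and the inverse of `π` outside `U`. It is injective
  -- because that inverse sends nothing outside `U` into `F`; hence it extends to a permutation.
  obtain ⟨ρ, hρ⟩ : ∃ ρ : Equiv.Perm V, (∀ v ∈ F, ρ v = v) ∧ ∀ v, v ∉ U → ρ v = π.symm v := by
    have hFU : F ⊆ U := Finset.subset_union_right
    let p : V → Prop := fun v => v ∈ F ∨ v ∉ U
    let g : {v // p v} → V := fun v => if v.1 ∈ F then v.1 else π.symm v.1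
    have hg : Function.Injective g := by
      rintro ⟨v, hv⟩ ⟨w, hw⟩ h
      simp only [g, Subtype.mk.injEq] at h ⊢
      split_ifs at h with h1 h2 h2
      · exact h
      · exact absurd (h ▸ h1) (hU w (hw.resolve_left h2))
      · exact absurd (h ▸ h2) (hU v (hv.resolve_left h1))
      · exact π.symm.injective h
    classical
    refine ⟨(Equiv.ofInjective g hg).extendSubtype (q := fun x => x ∈ Set.range g), ?_, ?_⟩
    · intro v hv
      rw [Equiv.extendSubtype_apply_of_mem _ v (Or.inl hv : p v), Equiv.ofInjective_apply]
      exact if_pos hv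
    · intro v hv
      rw [Equiv.extendSubtype_apply_of_mem _ v (Or.inr hv : p v), Equiv.ofInjective_apply]
      exact if_neg fun h => hv (hFU h)
  refine ⟨ρ.symm, fun v hv => by rw [Equiv.symm_apply_eq, hρ.1 v hv], ?_⟩
  rw [allOn_mul_regPerm, Matrix.mul_assoc, allOn_mul_allOn hE]
  refine regPerm_mul_allOn_congr ψ U π _ fun v hv => ?_
  rw [Equiv.symm_symm, hρ.2 v hv]

/-- The image of a point is uniformly distributed: a transposition shows that the count is the same
for all points, and summed over all points each permutation contributes the size of `F`. -/
theorem sum_perm_mem_mul_card (F : Finset V) (i : V) :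
    (∑ π : Equiv.Perm V, if π i ∈ F then 1 else 0) * Fintype.card V =
      (Fintype.card V).factorial * F.card := by
  have h : ∀ j, (∑ π : Equiv.Perm V, if π j ∈ F then 1 else 0) =
      ∑ π : Equiv.Perm V, if π i ∈ F then 1 else 0 := by
    intro j
    refine Fintype.sum_equiv (Equiv.mulRight (Equiv.swap i j)) _ _ fun π => ?_
    simp
  calc _ = ∑ j : V, ∑ π : Equiv.Perm V, (if π j ∈ F then 1 else 0) := by
        simp only [h, Finset.sum_const, Finset.card_univ, smul_eq_mul]
        rw [mul_comm]
    _ = ∑ π : Equiv.Perm V, F.card := by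
        rw [Finset.sum_comm]
        refine Finset.sum_congr rfl fun π _ => ?_
        rw [Equiv.sum_comp π (fun j => if j ∈ F then 1 else 0)]
        simp
    _ = _ := by simp [Fintype.card_perm]

/-- The average size of the part of the image of `F` that lies outside `F`. -/
theorem sum_perm_card_sdiff (F : Finset V) :
    (∑ π : Equiv.Perm V, (F.map π.toEmbedding \ F).card) * Fintype.card V =
      (Fintype.card V).factorial * (F.card * (Fintype.card V - F.card)) := by
  have h : ∀ π : Equiv.Perm V, (F.map π.toEmbedding \ F).card =
      ∑ i ∈ F, if π i ∈ Fᶜ then 1 else 0 := by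
    intro π
    rw [← Finset.card_filter, ← Finset.card_map (s := F.filter _) π.toEmbedding]
    congr 1
    ext v
    simp only [Finset.mem_sdiff, Finset.mem_map_equiv, Finset.mem_filter, Finset.mem_compl,
      Equiv.apply_symm_apply]
  simp only [h]
  rw [Finset.sum_comm, Finset.sum_mul]
  simp only [sum_perm_mem_mul_card, Finset.sum_const, Finset.card_compl, smul_eq_mul]
  ring

end Permutations

/-! ### Compression of a projection -/

section Compression

variable {n : Type} [Fintype n] [DecidableEq n]

theorem mul_eq_self_comm {B ρ : Matrix n n ℂ} (hB : Bᴴ = B) (hρ : ρ.PosSemidef) (h : B * ρ = ρ) :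
    ρ * B = ρ := by
  have := congrArg conjTranspose h
  rwa [conjTranspose_mul, hB, hρ.1.eq] at this

/-- If `Π B Π` is the scalar `g` on the range of the projection `P`, then a state in the range of
`B` passes `Π` with probability at most `g` within `P`. -/
theorem ev_compress_le {R B P ρ : Matrix n n ℂ} {g : ℝ} (hg : 0 ≤ g)
    (hRH : Rᴴ = R) (hB : B * B = B) (hBH : Bᴴ = B) (hP : P * P = P) (hPH : Pᴴ = P)
    (hPB : Commute P B) (hPR : Commute P R) (h : R * B * R * P = g • (R * P))
    (hρ : ρ.PosSemidef) (hBρ : B * ρ = ρ) : ev (R * P) ρ ≤ g * ev P ρ := by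
  have hρB := mul_eq_self_comm hBH hρ hBρ
  have hPB' : ∀ X, P * (B * X) = B * (P * X) := fun X => by
    rw [← Matrix.mul_assoc, hPB.eq, Matrix.mul_assoc]
  have hPR' : ∀ X, P * (R * X) = R * (P * X) := fun X => by
    rw [← Matrix.mul_assoc, hPR.eq, Matrix.mul_assoc]
  have hB' : ∀ X, B * (B * X) = B * X := fun X => by rw [← Matrix.mul_assoc, hB]
  have h' : R * (B * (R * P)) = g • (R * P) := by rw [← h]; simp only [Matrix.mul_assoc]
  -- `A` is Hermitian with `A * A = g • A`, and it lives below `B * P`. Its complement `Y = g • (B *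
  -- P) - A` then satisfies the same relation and is therefore positive; its expectation in `ρ` is
  -- the claim.
  set A := B * R * B * P with hA
  have hAH : Aᴴ = A := by
    rw [hA]
    simp only [conjTranspose_mul, hBH, hRH, hPH, Matrix.mul_assoc, hPR', hPB.eq]
  have hAA : A * A = g • A := by
    rw [hA]
    simp only [Matrix.mul_assoc, hPB', hPR', hB', hP]
    have : R * (B * (R * (B * P))) = g • (R * (B * P)) := by
      rw [← hPB.eq, ← Matrix.mul_assoc R P B, ← Matrix.mul_assoc B (R * P) B,
        ← Matrix.mul_assoc R, h', Matrix.smul_mul]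
    rw [this, Matrix.mul_smul]
  set Y := g • (B * P) - A with hY
  have hYH : Yᴴ = Y := by
    rw [hY, conjTranspose_sub, hAH, conjTranspose_smul, conjTranspose_mul, hBH, hPH, hPB.eq,
      star_trivial]
  have hYY : Y * Y = g • Y := by
    have e1 : B * P * (B * P) = B * P := by
      simp only [Matrix.mul_assoc, hPB', hB', hP]
    have e2 : B * P * A = A := by
      rw [hA]
      simp only [Matrix.mul_assoc, hPB', hPR', hB', hP]
    have e3 : A * (B * P) = A := by
      rw [hA]
      simp only [Matrix.mul_assoc, hPB', hB', hP]
    rw [hY, sub_mul, mul_sub, mul_sub, Matrix.smul_mul, Matrix.smul_mul, Matrix.mul_smul,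
      Matrix.mul_smul, e1, e2, e3, hAA, sub_self, sub_zero, smul_sub]
  have hYpos : Y.PosSemidef := by
    -- For `g = 0` one cannot divide by `g`, but then the square of the Hermitian `A` vanishes, and
    -- so does `A`.
    rcases hg.eq_or_lt with h0 | h0
    · have : A = 0 := by
        rw [← conjTranspose_mul_self_eq_zero, hAH, hAA, ← h0, zero_smul]
      rw [hY, this, ← h0, zero_smul, sub_zero]
      exact PosSemidef.zero
    · have : Y = g⁻¹ • (Yᴴ * Y) := by
        rw [hYH, hYY, smul_smul, inv_mul_cancel₀ h0.ne', one_smul]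
      rw [this]
      exact (posSemidef_conjTranspose_mul_self Y).smul (by positivity)
  have h1 := ev_nonneg hYpos hρ
  have e1 : ev (B * P) ρ = ev P ρ := by rw [← hPB.eq, ev_mul_left, hBρ]
  have e2 : ev A ρ = ev (R * P) ρ := by
    have : A = B * (R * P) * B := by
      rw [hA]
      simp only [Matrix.mul_assoc, hPB.eq]
    rw [this, ev_mul_left, hBρ, ← ev_mul_right, hρB]
  rw [hY, ev_sub_left, ev_smul_left, e1, e2] at h1
  linarith

end Compression

/-! ### Registers inside larger families of registers -/

section SubRegisters

variable {V V' Q : Type} [Fintype V] [DecidableEq V] [Fintype V'] [DecidableEq V']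
  [Fintype Q] [DecidableEq Q]

/-- The qubits of the registers in the range of `f`. -/
def regMap (Q : Type) (f : V' ↪ V) : V' × Q ↪ V × Q := f.prodMap (Function.Embedding.refl Q)

theorem mem_range_regMap (f : V' ↪ V) (p : V × Q) :
    p ∈ Set.range (regMap Q f) ↔ p.1 ∈ Set.range f := by
  constructor
  · rintro ⟨⟨j, q⟩, rfl⟩
    exact ⟨j, rfl⟩
  · rintro ⟨j, hj⟩
    exact ⟨(j, p.2), Prod.ext hj rfl⟩

theorem liftOp_regMap_tensorOp (f : V' ↪ V) (B : V → Op Q) (h : ∀ j, j ∉ Set.range f → B j = 1) :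
    liftOp (regMap Q f) (tensorOp fun j => B (f j)) = tensorOp B := by
  ext x y
  simp only [liftOp, mem_range_regMap]
  have hp : tensorOp B x y = (∏ j, B (f j) (fun q => x (f j, q)) fun q => y (f j, q)) *
      ∏ j ∈ (Finset.univ.map f)ᶜ, (1 : Op Q) (fun q => x (j, q)) fun q => y (j, q) := by
    unfold tensorOp
    rw [← Finset.prod_mul_prod_compl (Finset.univ.map f), Finset.prod_map]
    congr 1
    refine Finset.prod_congr rfl fun j hj => ?_
    rw [h j]
    rintro ⟨i, rfl⟩
    simp at hj
  rw [hp]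
  split_ifs with hc
  · rw [Finset.prod_eq_one (s := (Finset.univ.map f)ᶜ), mul_one]
    · rfl
    · intro j hj
      rw [one_apply, if_pos]
      funext q
      refine hc (j, q) ?_
      rintro ⟨i, rfl⟩
      simp at hj
  · push Not at hc
    obtain ⟨⟨j, q⟩, hj, hne⟩ := hc
    rw [Finset.prod_eq_zero (i := j), mul_zero]
    · simp only [Finset.mem_compl, Finset.mem_map, Finset.mem_univ, true_and]
      exact hj
    · exact one_apply_ne fun H => hne (congrFun H q)

theorem liftOp_regMap_allOn (f : V' ↪ V) (E : Op Q) (S : Finset V') :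
    liftOp (regMap Q f) (allOn E S) = allOn E (S.map f) := by
  unfold allOn
  rw [← liftOp_regMap_tensorOp f]
  · congr 2
    funext j
    simp
  · intro j hj
    rw [if_neg]
    intro h
    obtain ⟨i, -, rfl⟩ := Finset.mem_map.mp h
    exact hj ⟨i, rfl⟩

theorem liftOp_regMap_regPerm (f : V' ↪ V) (π : Equiv.Perm V') :
    liftOp (regMap Q f) (regPerm Q π) = regPerm Q (π.viaEmbedding f) := by
  have key : ∀ (U : Type) [Fintype U] [DecidableEq U] (τ : Equiv.Perm U) (x y : U × Q → Bool),
      regPerm Q τ x y = if ∀ p, x p = y (τ p.1, p.2) then 1 else 0 := by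
    intro U _ _ τ x y
    rw [← Matrix.one_mul (regPerm Q τ), mul_regPerm_apply, one_apply]
    simp only [funext_iff]
  ext x y
  simp only [liftOp, key, mem_range_regMap]
  rw [← ite_and]
  refine if_congr ?_ rfl rfl
  constructor
  · rintro ⟨h1, h2⟩ ⟨j, q⟩
    by_cases hj : j ∈ Set.range f
    · obtain ⟨i, rfl⟩ := hj
      rw [Equiv.Perm.viaEmbedding_apply]
      exact h2 (i, q)
    · rw [Equiv.Perm.viaEmbedding_apply_of_notMem _ _ _ hj]
      exact h1 _ hj
  · intro h
    constructor
    · rintro ⟨j, q⟩ hj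
      rw [h, Equiv.Perm.viaEmbedding_apply_of_notMem _ _ _ hj]
    · rintro ⟨i, q⟩
      have := h (f i, q)
      rwa [Equiv.Perm.viaEmbedding_apply] at this

theorem liftOp_regMap_symProj (f : V' ↪ V) :
    liftOp (regMap Q f) (symProj V' Q) = ((Fintype.card V').factorial : ℂ)⁻¹ •
      ∑ π : Equiv.Perm V', regPerm Q (π.viaEmbedding f) := by
  rw [symProj_eq, liftOp_smul, liftOp_sum]
  simp only [liftOp_regMap_regPerm]

/-- A permutation of some of the registers, extended by the identity, is a permutation of all of
them and is absorbed. -/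
theorem symProj_mul_liftOp_symProj (f : V' ↪ V) :
    symProj V Q * liftOp (regMap Q f) (symProj V' Q) = symProj V Q := by
  rw [liftOp_regMap_symProj, Matrix.mul_smul, Finset.mul_sum]
  simp only [symProj_mul_regPerm, Finset.sum_const, Finset.card_univ, Fintype.card_perm]
  rw [← Nat.cast_smul_eq_nsmul ℂ, smul_smul, inv_mul_cancel₀, one_smul]
  exact_mod_cast Nat.factorial_ne_zero _

theorem liftOp_symProj_commute (f : V' ↪ V) {X : Op (V × Q)}
    (h : ∀ π, Commute (regPerm Q π) X) : Commute (liftOp (regMap Q f) (symProj V' Q)) X := by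
  rw [liftOp_regMap_symProj]
  exact Commute.smul_left (Commute.sum_left _ _ _ fun π _ => h _) _

end SubRegisters

/-! ### Adjoining and discarding registers -/

section Adjoin

variable {α ι W : Type} [Fintype α] [DecidableEq α] [Fintype ι] [DecidableEq ι]
  [Fintype W] [DecidableEq W]

/-- The map `v ↦ v ⊗ ψ`. -/
def adjoinMap (ι : Type) [Fintype ι] [DecidableEq ι] (ψ : Vec W) :
    Matrix (ι ⊕ W → Bool) (ι → Bool) ℂ :=
  of fun x y => if x ∘ Sum.inl = y then ψ (x ∘ Sum.inr) else 0

theorem adjoin_eq (ρ : Op ι) (ψ : Vec W) :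
    adjoin ρ ψ = adjoinMap ι ψ * ρ * (adjoinMap ι ψ)ᴴ := by
  ext x y
  rw [mul_apply, Finset.sum_eq_single (y ∘ Sum.inl)]
  · rw [mul_apply, Finset.sum_eq_single (x ∘ Sum.inl)]
    · simp only [adjoin, adjoinMap, pure, vecMulVec_apply, of_apply, if_true, conjTranspose_apply,
        Pi.star_apply]
      ring
    · intro z _ hz
      simp [adjoinMap, hz.symm]
    · simp
  · intro z _ hz
    simp [adjoinMap, hz.symm]
  · simp

theorem adjoin_posSemidef {ρ : Op ι} (hρ : ρ.PosSemidef) (ψ : Vec W) :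
    (adjoin ρ ψ).PosSemidef := by
  rw [adjoin_eq]
  exact hρ.mul_mul_conjTranspose_same _

theorem sum_sumElim {M : Type} [AddCommMonoid M] (f : (ι ⊕ W → Bool) → M) :
    ∑ x, f x = ∑ a : ι → Bool, ∑ b : W → Bool, f (Sum.elim a b) := by
  rw [← Fintype.sum_prod_type']
  refine Fintype.sum_equiv (Equiv.sumArrowEquivProdArrow ι W Bool) _ _ fun x => ?_
  congr 1
  funext i
  rcases i with i | i <;> rfl

theorem adjoinMap_conjTranspose_mul (ψ φ : Vec W) :
    (adjoinMap ι ψ)ᴴ * adjoinMap ι φ = (star ψ ⬝ᵥ φ) • (1 : Op ι) := by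
  ext x y
  rw [mul_apply, sum_sumElim, Finset.sum_eq_single x]
  · have : ∀ b : W → Bool, Sum.elim x b ∘ Sum.inr = b := fun b => rfl
    simp only [adjoinMap, conjTranspose_apply, of_apply, Sum.elim_comp_inl, if_true,
      Matrix.smul_apply, one_apply, this, dotProduct, Pi.star_apply, smul_eq_mul]
    split_ifs <;> simp
  · intro z _ hz
    simp [adjoinMap, hz]
  · simp

theorem liftOp_inl_mul_adjoinMap (X : Op ι) (ψ : Vec W) :
    liftOp (Function.Embedding.inl : ι ↪ ι ⊕ W) X * adjoinMap ι ψ = adjoinMap ι ψ * X := by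
  ext x y
  rw [mul_apply, mul_apply, Finset.sum_eq_single (Sum.elim y (x ∘ Sum.inr)),
    Finset.sum_eq_single (x ∘ Sum.inl)]
  · simp only [liftOp, adjoinMap, of_apply]
    rw [if_pos, if_pos, if_true, mul_comm]
    · rfl
    · rfl
    · rintro (i | i) hi
      · exact absurd ⟨i, rfl⟩ hi
      · rfl
  · intro z _ hz
    simp [adjoinMap, hz.symm]
  · simp
  · intro z _ hz
    by_contra h
    apply hz
    rw [liftOp, adjoinMap, of_apply] at h
    split_ifs at h with h1 h2
    · funext i
      rcases i with i | i
      · exact congrFun h2 i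
      · exact (h1 (Sum.inr i) (by simp)).symm
    all_goals simp at h
  · simp

theorem liftOp_inr_mul_adjoinMap (A : Op W) (ψ : Vec W) :
    liftOp (Function.Embedding.inr : W ↪ ι ⊕ W) A * adjoinMap ι ψ = adjoinMap ι (A *ᵥ ψ) := by
  ext x y
  rw [mul_apply, sum_sumElim, Finset.sum_eq_single y]
  · have e1 : ∀ b : W → Bool, Sum.elim y b ∘ Sum.inr = b := fun b => rfl
    have e2 : ∀ b : W → Bool, Sum.elim y b ∘ (Function.Embedding.inr : W ↪ ι ⊕ W) = b :=
      fun b => rfl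
    have hc : ∀ b : W → Bool, (∀ i, i ∉ Set.range (Function.Embedding.inr : W ↪ ι ⊕ W) →
        x i = Sum.elim y b i) ↔ x ∘ Sum.inl = y := by
      intro b
      constructor
      · intro h
        funext i
        exact h (Sum.inl i) (by simp)
      · rintro rfl (i | i) hi
        · rfl
        · exact absurd ⟨i, rfl⟩ hi
    simp only [liftOp, adjoinMap, of_apply, e1, e2, hc, Sum.elim_comp_inl, if_true]
    split_ifs with h
    · rfl
    · simp
  · intro z _ hz
    refine Finset.sum_eq_zero fun b _ => ?_
    simp [adjoinMap, hz]
  · simp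

theorem sum_adjoinMap_ket : ∑ z : W → Bool, adjoinMap ι (ket z) * (adjoinMap ι (ket z))ᴴ = 1 := by
  ext x y
  rw [Matrix.sum_apply, Finset.sum_eq_single (x ∘ Sum.inr)]
  · rw [mul_apply, Finset.sum_eq_single (x ∘ Sum.inl)]
    · simp only [adjoinMap, of_apply, ket, conjTranspose_apply, if_true, Pi.single_apply, one_apply]
      have : x = y ↔ y ∘ Sum.inl = x ∘ Sum.inl ∧ y ∘ Sum.inr = x ∘ Sum.inr := by
        constructor
        · rintro rfl; exact ⟨rfl, rfl⟩
        · rintro ⟨h1, h2⟩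
          funext i
          rcases i with i | i
          · exact (congrFun h1 i).symm
          · exact (congrFun h2 i).symm
      simp only [this]
      split_ifs <;> simp_all
    · intro z _ hz
      simp [adjoinMap, hz.symm]
    · simp
  · intro z _ hz
    rw [mul_apply]
    refine Finset.sum_eq_zero fun w _ => ?_
    simp [adjoinMap, ket, Pi.single_apply, hz.symm]
  · simp

theorem discard_eq (σ : Op (ι ⊕ W)) :
    discard σ = ∑ z : W → Bool, (adjoinMap ι (ket z))ᴴ * σ * adjoinMap ι (ket z) := by
  ext x y
  rw [Matrix.sum_apply]
  refine Finset.sum_congr rfl fun z _ => ?_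
  rw [mul_apply, Finset.sum_eq_single (Sum.elim y z)]
  · rw [mul_apply, Finset.sum_eq_single (Sum.elim x z)]
    · have : ∀ x : ι → Bool, Sum.elim x z ∘ Sum.inr = z := fun b => rfl
      simp [adjoinMap, ket, this]
    · intro w _ hw
      by_contra h
      apply hw
      simp only [conjTranspose_apply, adjoinMap, of_apply, ket, Pi.single_apply] at h
      split_ifs at h with h1 h2
      · rw [← h1, ← h2, Sum.elim_comp_inl_inr]
      all_goals simp at h
    · simp
  · intro w _ hw
    by_contra h
    apply hw
    simp only [adjoinMap, of_apply, ket, Pi.single_apply] at h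
    split_ifs at h with h1 h2
    · rw [← h1, ← h2, Sum.elim_comp_inl_inr]
    all_goals simp at h
  · simp

theorem discard_posSemidef {σ : Op (ι ⊕ W)} (hσ : σ.PosSemidef) : (discard σ).PosSemidef := by
  rw [discard_eq]
  exact posSemidef_sum _ fun z _ => hσ.conjTranspose_mul_mul_same _

theorem ev_sum_right {n κ : Type} [Fintype n] [DecidableEq n] (s : Finset κ) (X : Matrix n n ℂ)
    (ρ : κ → Matrix n n ℂ) : ev X (∑ i ∈ s, ρ i) = ∑ i ∈ s, ev X (ρ i) := by
  simp [ev, Finset.mul_sum, trace_sum]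

theorem ev_discard (X : Op ι) (σ : Op (ι ⊕ W)) :
    ev X (discard σ) = ev (liftOp (Function.Embedding.inl : ι ↪ ι ⊕ W) X) σ := by
  rw [discard_eq, ev_sum_right]
  have : liftOp (Function.Embedding.inl : ι ↪ ι ⊕ W) X =
      ∑ z : W → Bool, adjoinMap ι (ket z) * X * (adjoinMap ι (ket z))ᴴ := by
    simp only [← liftOp_inl_mul_adjoinMap, Matrix.mul_assoc]
    rw [← Finset.mul_sum, sum_adjoinMap_ket, Matrix.mul_one]
  rw [this, ev_sum_left]
  refine Finset.sum_congr rfl fun z _ => ?_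
  have := ev_conj X (adjoinMap ι (ket z))ᴴ σ
  rw [conjTranspose_conjTranspose] at this
  exact this

theorem ev_adjoin (Z : Op (ι ⊕ W)) (ρ : Op ι) (ψ : Vec W) :
    ev Z (adjoin ρ ψ) = ev ((adjoinMap ι ψ)ᴴ * Z * adjoinMap ι ψ) ρ := by
  rw [adjoin_eq, ev_conj]

theorem liftOp_inl_mul_adjoin (X ρ : Op ι) (ψ : Vec W) :
    liftOp (Function.Embedding.inl : ι ↪ ι ⊕ W) X * adjoin ρ ψ = adjoin (X * ρ) ψ := by
  rw [adjoin_eq, adjoin_eq, ← Matrix.mul_assoc, ← Matrix.mul_assoc, liftOp_inl_mul_adjoinMap]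
  simp only [Matrix.mul_assoc]

theorem liftOp_inr_mul_adjoin {A : Op W} (ρ : Op ι) {ψ : Vec W} (h : A *ᵥ ψ = ψ) :
    liftOp (Function.Embedding.inr : W ↪ ι ⊕ W) A * adjoin ρ ψ = adjoin ρ ψ := by
  rw [adjoin_eq, ← Matrix.mul_assoc, ← Matrix.mul_assoc, liftOp_inr_mul_adjoinMap, h]

theorem dotProduct_of_normalised {ψ : Vec W} (h : ∑ x, ‖ψ x‖ ^ 2 = 1) : star ψ ⬝ᵥ ψ = 1 := by
  simp only [dotProduct, Pi.star_apply, RCLike.star_def, Complex.conj_mul']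
  exact_mod_cast h

theorem ev_inl_adjoin (X ρ : Op ι) {ψ : Vec W} (h : ∑ x, ‖ψ x‖ ^ 2 = 1) :
    ev (liftOp (Function.Embedding.inl : ι ↪ ι ⊕ W) X) (adjoin ρ ψ) = ev X ρ := by
  rw [ev_adjoin, Matrix.mul_assoc, liftOp_inl_mul_adjoinMap, ← Matrix.mul_assoc,
    adjoinMap_conjTranspose_mul, dotProduct_of_normalised h, one_smul, Matrix.one_mul]

theorem trace_adjoin (ρ : Op ι) {ψ : Vec W} (h : ∑ x, ‖ψ x‖ ^ 2 = 1) :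
    (adjoin ρ ψ).trace.re = ρ.trace.re := by
  have := ev_inl_adjoin 1 ρ h
  rwa [liftOp_one, ev_one, ev_one] at this

theorem trace_discard (σ : Op (ι ⊕ W)) : (discard σ).trace.re = σ.trace.re := by
  rw [← ev_one, ev_discard, liftOp_one, ev_one]

/-- Contracting the adjoined register commutes with lifting. -/
theorem adjoinMap_conj_liftOp (e : α ↪ ι) (Z : Op (α ⊕ W)) (ψ : Vec W) :
    (adjoinMap ι ψ)ᴴ * liftOp (e.sumMap (Function.Embedding.refl W)) Z * adjoinMap ι ψ =
      liftOp e ((adjoinMap α ψ)ᴴ * Z * adjoinMap α ψ) := by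
  have key : ∀ (β : Type) [Fintype β] [DecidableEq β] (Y : Op (β ⊕ W)) (x y : β → Bool),
      ((adjoinMap β ψ)ᴴ * Y * adjoinMap β ψ) x y =
        ∑ b, ∑ a, star (ψ a) * Y (Sum.elim x a) (Sum.elim y b) * ψ b := by
    intro β _ _ Y x y
    rw [mul_apply, sum_sumElim, Finset.sum_eq_single y]
    · refine Finset.sum_congr rfl fun b _ => ?_
      rw [mul_apply, sum_sumElim, Finset.sum_eq_single x]
      · have e1 : ∀ (w : β → Bool) (b : W → Bool), Sum.elim w b ∘ Sum.inr = b := fun w b => rfl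
        simp only [adjoinMap, conjTranspose_apply, of_apply, Sum.elim_comp_inl, if_true, e1,
          Finset.sum_mul]
      · intro z _ hz
        refine Finset.sum_eq_zero fun a _ => ?_
        simp [adjoinMap, hz]
      · simp
    · intro z _ hz
      refine Finset.sum_eq_zero fun a _ => ?_
      simp [adjoinMap, hz]
    · simp
  ext x y
  rw [key]
  have hc : ∀ a b : W → Bool, (∀ i, i ∉ Set.range (e.sumMap (Function.Embedding.refl W)) →
      Sum.elim x a i = Sum.elim y b i) ↔ ∀ i, i ∉ Set.range e → x i = y i := by
    intro a b
    constructor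
    · intro h i hi
      refine h (Sum.inl i) ?_
      rintro ⟨j | j, hj⟩
      · exact hi ⟨j, Sum.inl_injective hj⟩
      · exact absurd hj (by simp)
    · rintro h (i | i) hi
      · refine h i ?_
        rintro ⟨j, rfl⟩
        exact hi ⟨Sum.inl j, rfl⟩
      · exact absurd ⟨Sum.inr i, rfl⟩ hi
  have e2 : ∀ (w : ι → Bool) (a : W → Bool),
      Sum.elim w a ∘ (e.sumMap (Function.Embedding.refl W)) = Sum.elim (w ∘ e) a := by
    intro w a
    funext i
    rcases i with i | i <;> rfl
  simp only [liftOp, hc, e2]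
  split_ifs with h
  · rw [key]
  · simp

end Adjoin

/-! ### Replacing registers -/

section Replace

variable {α β ι : Type} [Fintype α] [DecidableEq α] [Fintype ι] [DecidableEq ι]
  [Fintype β] [DecidableEq β]

theorem replace_posSemidef (e : α ↪ ι) (ψ : Vec α) {ρ : Op ι} (hρ : ρ.PosSemidef) :
    (replace e ψ ρ).PosSemidef :=
  posSemidef_sum _ fun _ _ => hρ.mul_mul_conjTranspose_same _

theorem sum_vecMulVec_ket {ψ : Vec α} (h : ∑ x, ‖ψ x‖ ^ 2 = 1) :
    ∑ z : α → Bool, (vecMulVec ψ (ket z))ᴴ * vecMulVec ψ (ket z) = 1 := by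
  have h1 := dotProduct_of_normalised h
  have : ∀ z : α → Bool, (vecMulVec ψ (ket z))ᴴ * vecMulVec ψ (ket z) =
      vecMulVec (ket z) (ket z) := by
    intro z
    rw [conjTranspose_vecMulVec, vecMulVec_mul_vecMulVec, h1]
    simp only [one_smul]
    congr 1
    funext x
    simp only [Pi.star_apply, ket, Pi.single_apply]
    split_ifs <;> simp
  simp only [this]
  ext x y
  rw [Matrix.sum_apply]
  simp only [vecMulVec_apply, ket, Pi.single_apply, one_apply]
  rw [Finset.sum_eq_single x]
  · simp [eq_comm]
  · intro z _ hz
    simp [hz.symm]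
  · simp

theorem ev_replace (e : α ↪ ι) {ψ : Vec α} (h : ∑ x, ‖ψ x‖ ^ 2 = 1) {X : Op ι}
    (hX : ∀ A, Commute X (liftOp e A)) (ρ : Op ι) : ev X (replace e ψ ρ) = ev X ρ := by
  unfold replace sandwich
  rw [ev_sum_right]
  simp only [ev_conj]
  rw [← ev_sum_left]
  congr 1
  simp only [Matrix.mul_assoc, (hX _).eq]
  simp only [← Matrix.mul_assoc, ← Finset.sum_mul, ← liftOp_conjTranspose, ← liftOp_mul,
    ← liftOp_sum]
  rw [sum_vecMulVec_ket h, liftOp_one, Matrix.one_mul]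

theorem trace_replace (e : α ↪ ι) {ψ : Vec α} (h : ∑ x, ‖ψ x‖ ^ 2 = 1) (ρ : Op ι) :
    (replace e ψ ρ).trace.re = ρ.trace.re := by
  rw [← ev_one, ev_replace e h (fun A => Commute.one_left _), ev_one]

theorem ket_normalised (z : α → Bool) : ∑ x, ‖(ket z : Vec α) x‖ ^ 2 = 1 := by
  rw [Finset.sum_eq_single z]
  · simp [ket]
  · intro x _ hx
    simp [ket, hx]
  · simp

theorem trace_writeUnary {b : ℕ} (e : Fin b ↪ ι) (k : ℕ) (ρ : Op ι) :
    (writeUnary e k ρ).trace.re = ρ.trace.re :=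
  trace_replace e (ket_normalised _) ρ

theorem writeUnary_posSemidef {b : ℕ} (e : Fin b ↪ ι) (k : ℕ) {ρ : Op ι} (hρ : ρ.PosSemidef) :
    (writeUnary e k ρ).PosSemidef := replace_posSemidef e _ hρ

/-- Cyclicity of the partial trace: `replace` traces out the register on which `A` acts. -/
theorem replace_liftOp_mul (e : α ↪ ι) (ψ : Vec α) (A : Op α) (σ : Op ι) :
    replace e ψ (liftOp e A * σ) = replace e ψ (σ * liftOp e A) := by
  have h1 : ∀ z : α → Bool, vecMulVec ψ (ket z) * A = ∑ w, A z w • vecMulVec ψ (ket w) := by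
    intro z
    ext x y
    rw [mul_apply, Matrix.sum_apply]
    simp only [vecMulVec_apply, Matrix.smul_apply, ket, Pi.single_apply, smul_eq_mul]
    simp [mul_comm]
  have h2 : ∀ z : α → Bool, A * (vecMulVec ψ (ket z))ᴴ =
      ∑ w, A w z • (vecMulVec ψ (ket w))ᴴ := by
    intro z
    ext x y
    rw [mul_apply, Matrix.sum_apply]
    simp only [vecMulVec_apply, Matrix.smul_apply, ket, Pi.single_apply, smul_eq_mul,
      conjTranspose_apply]
    simp only [mul_ite, mul_one, mul_zero, apply_ite star, star_zero]
    rw [Finset.sum_ite_eq' Finset.univ z, Finset.sum_ite_eq Finset.univ x]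
    simp
  unfold replace sandwich
  have e1 : ∀ z : α → Bool, liftOp e (vecMulVec ψ (ket z)) * (liftOp e A * σ) *
      (liftOp e (vecMulVec ψ (ket z)))ᴴ = ∑ w : α → Bool, A z w •
        (liftOp e (vecMulVec ψ (ket w)) * σ * (liftOp e (vecMulVec ψ (ket z)))ᴴ) := by
    intro z
    rw [← Matrix.mul_assoc, ← liftOp_mul, h1, liftOp_sum]
    simp only [liftOp_smul, Finset.sum_mul, Matrix.smul_mul]
  have e2 : ∀ z : α → Bool, liftOp e (vecMulVec ψ (ket z)) * (σ * liftOp e A) *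
      (liftOp e (vecMulVec ψ (ket z)))ᴴ = ∑ w : α → Bool, A w z •
        (liftOp e (vecMulVec ψ (ket z)) * σ * (liftOp e (vecMulVec ψ (ket w)))ᴴ) := by
    intro z
    rw [Matrix.mul_assoc, Matrix.mul_assoc, ← liftOp_conjTranspose, ← liftOp_mul, h2, liftOp_sum]
    simp only [liftOp_smul, Finset.mul_sum, Matrix.mul_smul, ← Matrix.mul_assoc,
      liftOp_conjTranspose]
  simp only [e1, e2]
  rw [Finset.sum_comm]

/-- `verifyDestroy` multiplies by the effect from the left only. Cyclicity moves one half of `A = Cᴴ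
* C` to the other side, which turns the product into a sandwich. -/
theorem replace_liftOp_mul_posSemidef (e : α ↪ ι) (ψ : Vec α) {A : Op α} (hA : A.PosSemidef)
    {ρ : Op ι} (hρ : ρ.PosSemidef) : (replace e ψ (liftOp e A * ρ)).PosSemidef := by
  obtain ⟨C, rfl⟩ := posSemidef_sqrt hA
  rw [liftOp_mul, Matrix.mul_assoc, replace_liftOp_mul]
  refine replace_posSemidef e ψ ?_
  have := hρ.mul_mul_conjTranspose_same (liftOp e C)
  rwa [← liftOp_conjTranspose, liftOp_conjTranspose, ← liftOp_conjTranspose] at this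

end Replace

/-! ### Private counting -/

section PrivateCount

variable {ι : Type} [Fintype ι] [DecidableEq ι]

theorem coinAt_eq {r : ℕ} {W : Type} (e : Fin r × W ↪ ι) (i : Fin r) :
    coinAt e i = (regEmb i).trans e := rfl

/-- All the coins but the last. -/
def initCoins {r : ℕ} {W : Type} (e : Fin (r + 1) × W ↪ ι) : Fin r × W ↪ ι :=
  (Fin.castSuccEmb.prodMap (Function.Embedding.refl W)).trans e

theorem initCoins_ne {r : ℕ} {W : Type} (e : Fin (r + 1) × W ↪ ι) (a : Fin r × W) (b : W) :
    initCoins e a ≠ coinAt e (Fin.last r) b := by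
  intro H
  exact absurd (Prod.mk.inj (e.injective H)).1 (Fin.castSucc_lt_last a.1).ne

theorem liftOp_tensorOp_succ {r : ℕ} {W : Type} [Fintype W] [DecidableEq W]
    (e : Fin (r + 1) × W ↪ ι) (A : Fin (r + 1) → Op W) :
    liftOp e (tensorOp A) =
      liftOp (coinAt e (Fin.last r)) (A (Fin.last r)) *
        liftOp (initCoins e) (tensorOp fun i => A i.castSucc) := by
  have h1 : liftOp (regMap W Fin.castSuccEmb) (tensorOp fun i : Fin r => A i.castSucc) =
      tensorOp fun j => if j = Fin.last r then 1 else A j := by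
    rw [← liftOp_regMap_tensorOp Fin.castSuccEmb]
    · congr 2
      funext i
      simp [(Fin.castSucc_lt_last i).ne]
    · intro j hj
      rw [if_pos]
      by_contra h
      exact hj ⟨j.castPred h, by simp⟩
  rw [coinAt_eq, liftOp_trans, liftOp_regEmb, initCoins, liftOp_trans]
  change _ = _ * liftOp e (liftOp (regMap W Fin.castSuccEmb) _)
  rw [h1, ← liftOp_mul, allOn, tensorOp_mul]
  congr 2
  funext j
  by_cases h : j = Fin.last r
  · subst h; simp
  · simp [h]

/-- The loops act on each branch independently; this allows induction from a single starting branch.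
-/
theorem foldl_flatMap {β γ : Type} (f : γ → β → List β) (l : List γ) (L : List β) :
    l.foldl (fun L c => L.flatMap (f c)) L =
      L.flatMap fun b => l.foldl (fun L c => L.flatMap (f c)) [b] := by
  induction l generalizing L with
  | nil => simp
  | cons c l ih =>
    simp only [List.foldl_cons]
    rw [ih, List.flatMap_assoc]
    congr 1
    funext b
    rw [List.flatMap_singleton, ih (f c b)]

theorem sum_map_flatMap {β γ : Type} (L : List β) (f : β → List γ) (g : γ → ℝ) :
    ((L.flatMap f).map g).sum = (L.map fun b => ((f b).map g).sum).sum := by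
  induction L with
  | nil => simp
  | cons b L ih => simp [ih]

variable (S : PrivateCoinScheme) {lam : ℕ} (sk : S.Key lam)

theorem privCount_succ {r : ℕ} (e : Fin (r + 1) × S.Qub lam ↪ ι) (ρ : Op ι) :
    S.privCount sk e ρ = (S.privCount sk (initCoins e) ρ).flatMap fun b =>
      (S.verifyDestroy sk (coinAt e (Fin.last r)) b.2).map fun a =>
        (b.1 + if a.1 then 1 else 0, a.2) := by
  unfold PrivateCoinScheme.privCount
  rw [List.finRange_succ_last, List.foldl_append, List.foldl_map]
  rfl

theorem privCount_posSemidef {r : ℕ} (e : Fin r × S.Qub lam ↪ ι) {ρ : Op ι}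
    (hρ : ρ.PosSemidef) : ∀ a ∈ S.privCount sk e ρ, a.2.PosSemidef := by
  induction r with
  | zero => simpa [PrivateCoinScheme.privCount] using hρ
  | succ r ih =>
    intro a ha
    rw [privCount_succ, List.mem_flatMap] at ha
    obtain ⟨b, hb, ha⟩ := ha
    have hb' := ih _ b hb
    simp only [PrivateCoinScheme.verifyDestroy, List.map_cons, List.map_nil, List.mem_cons,
      List.not_mem_nil, or_false] at ha
    rcases ha with rfl | rfl
    · exact replace_liftOp_mul_posSemidef _ _ (S.verify_nonneg lam sk) hb'
    · exact replace_liftOp_mul_posSemidef _ _ (S.verify_le_one lam sk) hb'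

theorem sum_finset_fin_succ {r : ℕ} {M : Type} [AddCommMonoid M] (f : Finset (Fin (r + 1)) → M) :
    ∑ T, f T = ∑ T : Finset (Fin r), (f (insert (Fin.last r) (T.map Fin.castSuccEmb)) +
      f (T.map Fin.castSuccEmb)) := by
  have hl : Fin.last r ∉ (Finset.univ : Finset (Fin r)).map Fin.castSuccEmb := by simp
  have hu : (Finset.univ : Finset (Fin (r + 1))) =
      insert (Fin.last r) (Finset.univ.map Fin.castSuccEmb) := by
    ext i
    refine Fin.lastCases ?_ (fun i => ?_) i <;> simp
  rw [← Finset.powerset_univ, hu, Finset.sum_powerset_insert hl]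
  have h : ∀ g : Finset (Fin (r + 1)) → M,
      ∑ T ∈ ((Finset.univ : Finset (Fin r)).map Fin.castSuccEmb).powerset, g T =
        ∑ T : Finset (Fin r), g (T.map Fin.castSuccEmb) := by
    intro g
    symm
    refine Finset.sum_bij (fun T _ => T.map Fin.castSuccEmb) ?_ ?_ ?_ ?_
    · intro T _
      rw [Finset.mem_powerset]
      exact Finset.map_subset_map.mpr (Finset.subset_univ _)
    · intro T _ T' _ h
      exact Finset.map_injective _ h
    · intro T hT
      rw [Finset.mem_powerset, Finset.subset_map_iff] at hT
      obtain ⟨u, -, rfl⟩ := hT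
      exact ⟨u, Finset.mem_univ _, rfl⟩
    · intro T _
      rfl
  rw [h, h, Finset.sum_add_distrib, add_comm]

/-- The spectator `X` is needed by the induction: the test of the last coin is absorbed into it
before the preceding coins are treated. -/
theorem ev_privCount {r : ℕ} (e : Fin r × S.Qub lam ↪ ι) (ρ : Op ι) (f : ℕ → ℝ) (X : Op ι)
    (hX : ∀ A, Commute X (liftOp e A)) :
    ((S.privCount sk e ρ).map fun a => f a.1 * ev X a.2).sum =
      ev (X * liftOp e (sector (Fin r) (S.verify lam sk) f)) ρ := by
  induction r generalizing f X with
  | zero =>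
    have : sector (Fin 0) (S.verify lam sk) f = f 0 • 1 := by
      rw [sector, Fintype.sum_subsingleton _ ∅]
      simp only [Finset.card_empty]
      congr 1
    simp [PrivateCoinScheme.privCount, this, liftOp_smul, liftOp_one, ev_smul_left]
  | succ r ih =>
    set E := S.verify lam sk
    have hinit : ∀ A, Commute X (liftOp (initCoins e) A) := fun A => by
      rw [initCoins, liftOp_trans]
      exact hX _
    have hlast : ∀ A, Commute X (liftOp (coinAt e (Fin.last r)) A) := fun A => by
      rw [coinAt_eq, liftOp_trans]
      exact hX _
    have hdisj : ∀ A B, Commute (liftOp (coinAt e (Fin.last r)) A) (liftOp (initCoins e) B) :=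
      fun A B => liftOp_commute _ _ (fun a b => (initCoins_ne e b a).symm) A B
    rw [privCount_succ, sum_map_flatMap]
    have step : ∀ b : ℕ × Op ι, (((S.verifyDestroy sk (coinAt e (Fin.last r)) b.2).map fun a =>
        (b.1 + if a.1 then 1 else 0, a.2)).map fun a => f a.1 * ev X a.2).sum =
          f (b.1 + 1) * ev (X * liftOp (coinAt e (Fin.last r)) E) b.2 +
            f b.1 * ev (X * liftOp (coinAt e (Fin.last r)) (1 - E)) b.2 := by
      intro b
      have hz : ∑ x, ‖(zeroKet : Vec (S.Qub lam)) x‖ ^ 2 = 1 := ket_normalised _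
      simp only [PrivateCoinScheme.verifyDestroy, List.map_cons, List.map_nil, List.sum_cons,
        List.sum_nil, ev_replace _ hz hlast, ev_mul_left]
      simp [E]
    simp only [step]
    rw [List.sum_map_add]
    rw [ih (initCoins e) (fun t => f (t + 1)) _ fun A => (hinit A).mul_left (hdisj _ A),
      ih (initCoins e) f _ fun A => (hinit A).mul_left (hdisj _ A), ← ev_add_left]
    congr 1
    rw [Matrix.mul_assoc, Matrix.mul_assoc, ← mul_add]
    congr 1
    rw [show sector (Fin (r + 1)) E f = _ from sum_finset_fin_succ _, liftOp_sum]
    simp only [sector, liftOp_sum, liftOp_smul, liftOp_add, Finset.mul_sum]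
    rw [← Finset.sum_add_distrib]
    refine Finset.sum_congr rfl fun T _ => ?_
    have hl : Fin.last r ∉ T.map Fin.castSuccEmb := by simp
    rw [Finset.card_insert_of_notMem hl, Finset.card_map, Matrix.mul_smul, Matrix.mul_smul]
    have hp1 : liftOp e (patternEffect E (insert (Fin.last r) (T.map Fin.castSuccEmb))) =
        liftOp (coinAt e (Fin.last r)) E * liftOp (initCoins e) (patternEffect E T) := by
      unfold patternEffect
      rw [liftOp_tensorOp_succ]
      congr 3
      · simp
      · funext j
        simp [(Fin.castSucc_lt_last j).ne]
    have hp2 : liftOp e (patternEffect E (T.map Fin.castSuccEmb)) =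
        liftOp (coinAt e (Fin.last r)) (1 - E) * liftOp (initCoins e) (patternEffect E T) := by
      unfold patternEffect
      rw [liftOp_tensorOp_succ]
      congr 3
      · simp
      · funext j
        simp
    rw [hp1, hp2]

theorem trace_privCount {r : ℕ} (e : Fin r × S.Qub lam ↪ ι) (ρ : Op ι) (f : ℕ → ℝ) :
    ((S.privCount sk e ρ).map fun a => f a.1 * a.2.trace.re).sum =
      ev (liftOp e (sector (Fin r) (S.verify lam sk) f)) ρ := by
  have := ev_privCount S sk e ρ f 1 fun A => Commute.one_left _
  simpa only [ev_one, Matrix.one_mul] using this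

end PrivateCount

/-! ### Minting a public coin by minting private coins -/

section Mint

variable {ι : Type} [Fintype ι] [DecidableEq ι] {W : Type} [Fintype W] [DecidableEq W]

/-- The Kraus operators of the replacement are product operators, so they factor into one for the
last register and one for the others. -/
theorem replace_tensorVec_succ {k : ℕ} (e : Fin (k + 1) × W ↪ ι) (ψ : Vec W) (ρ : Op ι) :
    replace e (tensorVec (Fin (k + 1)) ψ) ρ =
      replace (coinAt e (Fin.last k)) ψ (replace (initCoins e) (tensorVec (Fin k) ψ) ρ) := by
  have hv : ∀ (n : ℕ) (z : Fin n × W → Bool), vecMulVec (tensorVec (Fin n) ψ) (ket z) =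
      tensorOp fun j => vecMulVec ψ (ket fun q => z (j, q)) := by
    intro n z
    ext x y
    simp only [vecMulVec_apply, tensorVec, tensorOp, Finset.prod_mul_distrib]
    congr 1
    simp only [ket, Pi.single_apply]
    rw [Finset.prod_ite_zero]
    simp only [Finset.mem_univ, forall_const, Finset.prod_const_one]
    refine if_congr ?_ rfl rfl
    constructor
    · rintro rfl j
      rfl
    · intro h
      funext p
      exact congrFun (h p.1) p.2
  let E : (Fin (k + 1) × W → Bool) ≃ (W → Bool) × (Fin k × W → Bool) :=
    { toFun := fun z => (fun q => z (Fin.last k, q), fun p => z (p.1.castSucc, p.2))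
      invFun := fun p x => Fin.lastCases (motive := fun _ => Bool) (p.1 x.2)
        (fun i => p.2 (i, x.2)) x.1
      left_inv := fun z => by
        funext x
        obtain ⟨i, q⟩ := x
        refine Fin.lastCases ?_ (fun i => ?_) i <;> simp
      right_inv := fun p => by
        refine Prod.ext ?_ ?_
        · funext q
          simp
        · funext x
          simp }
  unfold replace sandwich
  simp only [Finset.mul_sum, Finset.sum_mul]
  rw [← Fintype.sum_prod_type']
  refine Fintype.sum_equiv E _ _ fun z => ?_
  rw [hv, liftOp_tensorOp_succ, hv, conjTranspose_mul]
  simp only [Matrix.mul_assoc]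
  rfl

/-- This makes the reduction exact: private coins minted one after the other leave the same state as
one public coin. -/
theorem foldl_replace {k : ℕ} (e : Fin k × W ↪ ι) (ψ : Vec W) (ρ : Op ι) :
    (List.finRange k).foldl (fun σ i => replace (coinAt e i) ψ σ) ρ =
      replace e (tensorVec (Fin k) ψ) ρ := by
  induction k with
  | zero =>
    have h1 : ∀ z : Fin 0 × W → Bool, vecMulVec (tensorVec (Fin 0) ψ) (ket z) = 1 := by
      intro z
      ext x y
      have hx : x = z := Subsingleton.elim _ _
      have hy : y = z := Subsingleton.elim _ _
      subst hx hy
      simp [vecMulVec_apply, tensorVec, ket]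
    simp [replace, sandwich, h1, liftOp_one]
  | succ k ih =>
    rw [replace_tensorVec_succ, List.finRange_succ_last, List.foldl_append, List.foldl_map, ← ih]
    rfl

end Mint

/-! ### Public counting -/

theorem foldl_finRange_induction {β : Type} {m : ℕ} (step : List β → Fin m → List β)
    (L : List β) (P : ℕ → List β → Prop) (h0 : P 0 L)
    (hs : ∀ (i : Fin m) (L : List β), P i L → P (i + 1) (step L i)) :
    P m ((List.finRange m).foldl step L) := by
  induction m with
  | zero => simpa using h0
  | succ m ih =>
    rw [List.finRange_succ_last, List.foldl_append, List.foldl_map]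
    exact hs (Fin.last m) _ (ih (fun L i => step L i.castSucc) fun i L h => hs i.castSucc L h)

section WalletCount

variable {ι : Type} [Fintype ι] [DecidableEq ι] (P : PublicCoinScheme) {lam m : ℕ}

/-- An observable that commutes with both Kraus operators of a verification passes through it,
because their effects sum to the identity. -/
theorem ev_walletCount (e : Fin (m + 1) × P.Qub lam ↪ ι) (ρ : Op ι) (X : Op ι)
    (hA : ∀ n h, Commute X (liftOp (firstCoins e n h) (P.accept lam n)))
    (hR : ∀ n h, Commute X (liftOp (firstCoins e n h) (P.reject lam n))) :
    ((P.walletCount e ρ).map fun a => ev X a.2).sum = ev X ρ := by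
  unfold PublicCoinScheme.walletCount
  refine foldl_finRange_induction _ _
    (fun _ (L : List (ℕ × Op ι)) => (L.map fun a => ev X a.2).sum = ev X ρ)
    (by simp) ?_
  intro i L hL
  rw [sum_map_flatMap, ← hL]
  congr 1
  refine List.map_congr_left fun b _ => ?_
  simp only [List.map_cons, List.map_nil, List.sum_cons, List.sum_nil, add_zero, sandwich, ev_conj]
  rw [Matrix.mul_assoc, (hA _ _).eq, Matrix.mul_assoc, (hR _ _).eq, ← ev_add_left,
    ← Matrix.mul_assoc, ← Matrix.mul_assoc, ← add_mul, ← liftOp_conjTranspose,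
    ← liftOp_conjTranspose, ← liftOp_mul, ← liftOp_mul, ← liftOp_add, P.complete_measurement,
    liftOp_one, Matrix.one_mul]

theorem walletCount_posSemidef (e : Fin (m + 1) × P.Qub lam ↪ ι) {ρ : Op ι} (hρ : ρ.PosSemidef) :
    ∀ a ∈ P.walletCount e ρ, a.2.PosSemidef := by
  unfold PublicCoinScheme.walletCount
  refine foldl_finRange_induction _ _
    (fun _ (L : List (ℕ × Op ι)) => ∀ a ∈ L, a.2.PosSemidef) (by simpa using hρ) ?_
  intro i L hL a ha
  rw [List.mem_flatMap] at ha
  obtain ⟨b, hb, ha⟩ := ha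
  simp only [List.mem_cons, List.not_mem_nil, or_false] at ha
  rcases ha with rfl | rfl <;> exact (hL b hb).mul_mul_conjTranspose_same _

/-- After `i` rounds the count equals `i` only if nothing was rejected; `C i` accumulates the
accepting operators of that branch. An arbitrary `φ` gives access to its final state without
locating it in the list. -/
theorem walletCount_accepted (e : Fin (m + 1) × P.Qub lam ↪ ι) (ρ : Op ι) (C : ℕ → Op ι)
    (h0 : sandwich (C 0) ρ = ρ)
    (hC : ∀ i h, liftOp (firstCoins e (i + 2) h) (P.accept lam (i + 2)) * C i = C (i + 1)) :
    (∀ a ∈ P.walletCount e ρ, a.1 ≤ m) ∧ ∀ φ : Op ι → ℝ,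
      ((P.walletCount e ρ).map fun a => if a.1 = m then φ a.2 else 0).sum =
        φ (sandwich (C m) ρ) := by
  unfold PublicCoinScheme.walletCount
  refine foldl_finRange_induction _ _
    (fun i (L : List (ℕ × Op ι)) => (∀ a ∈ L, a.1 ≤ i) ∧ ∀ φ : Op ι → ℝ,
    (L.map fun a => if a.1 = i then φ a.2 else 0).sum = φ (sandwich (C i) ρ)) (by simp [h0]) ?_
  intro i L hL
  constructor
  · intro a ha
    rw [List.mem_flatMap] at ha
    obtain ⟨b, hb, ha⟩ := ha
    have := hL.1 b hb
    simp only [List.mem_cons, List.not_mem_nil, or_false] at ha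
    rcases ha with rfl | rfl <;> simp only <;> omega
  · intro φ
    rw [sum_map_flatMap]
    have h2 := hL.2 fun σ => φ (sandwich
      (liftOp (firstCoins e (i.1 + 2) (by omega)) (P.accept lam (i.1 + 2))) σ)
    have h3 : ∀ A B σ : Op ι, sandwich A (sandwich B σ) = sandwich (A * B) σ := by
      intro A B σ
      simp only [sandwich, conjTranspose_mul, Matrix.mul_assoc]
    rw [h3, hC] at h2
    rw [← h2]
    congr 1
    refine List.map_congr_left fun b hb => ?_
    have := hL.1 b hb
    have hne : b.1 ≠ i.1 + 1 := by omega
    simp [hne]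

end WalletCount

/-! ### Public counting in the construction -/

section Construction

variable {ι : Type} [Fintype ι] [DecidableEq ι] {Q : Type} [Fintype Q] [DecidableEq Q] {k : ℕ}

/-- The private coins in the public coins `e`. -/
def privateRegs {r : ℕ} (e : Fin r × (Fin k × Q) ↪ ι) : (Fin r × Fin k) × Q ↪ ι :=
  (Equiv.prodAssoc _ _ _).toEmbedding.trans e

theorem walletProj_eq (n : ℕ) : walletProj n k Q =
    liftOp (Equiv.prodAssoc (Fin n) (Fin k) Q).toEmbedding (symProj (Fin n × Fin k) Q) := by
  rw [liftOp_equiv]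
  rfl

/-- The private coins in the first public coins. -/
def firstRegs {r : ℕ} (n : ℕ) (h : n ≤ r) : Fin n × Fin k ↪ Fin r × Fin k :=
  (Fin.castLEEmb h).prodMap (Function.Embedding.refl _)

theorem liftOp_firstCoins_walletProj {r : ℕ} (e : Fin r × (Fin k × Q) ↪ ι) (n : ℕ) (h : n ≤ r) :
    liftOp (firstCoins e n h) (walletProj n k Q) =
      liftOp (privateRegs e) (liftOp (regMap Q (firstRegs n h)) (symProj (Fin n × Fin k) Q)) := by
  rw [walletProj_eq, ← liftOp_trans, ← liftOp_trans]
  rfl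

/-- Being symmetric in more registers is the stronger condition, so the larger projection absorbs
the smaller one. -/
theorem liftOp_firstRegs_mul {r n : ℕ} (h : n + 1 ≤ r) :
    liftOp (regMap Q (firstRegs (k := k) (n + 1) h)) (symProj (Fin (n + 1) × Fin k) Q) *
      liftOp (regMap Q (firstRegs (k := k) n (by omega))) (symProj (Fin n × Fin k) Q) =
    liftOp (regMap Q (firstRegs (k := k) (n + 1) h)) (symProj (Fin (n + 1) × Fin k) Q) := by
  have : regMap Q (firstRegs (k := k) n (by omega : n ≤ r)) =
      (regMap Q (firstRegs n (Nat.le_succ n))).trans (regMap Q (firstRegs (n + 1) h)) := by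
    ext p <;> rfl
  rw [this, liftOp_trans, ← liftOp_mul, symProj_mul_liftOp_symProj]

theorem liftOp_firstRegs_self {r : ℕ} :
    liftOp (regMap Q (firstRegs (k := k) r le_rfl)) (symProj (Fin r × Fin k) Q) =
      symProj (Fin r × Fin k) Q := by
  have : regMap Q (firstRegs (k := k) r le_rfl) = (Equiv.refl _).toEmbedding := by
    ext p <;> rfl
  rw [this, liftOp_equiv]
  rfl

/-- The private coins in the fresh coin of a wallet. -/
def freshRegs (m k : ℕ) : Finset (Fin (m + 1) × Fin k) :=
  Finset.univ.map ⟨fun l => (0, l), fun _ _ h => (Prod.mk.inj h).2⟩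

/-- The private coins in the submitted coins of a wallet. -/
def submittedRegs (m k : ℕ) : Fin m × Fin k ↪ Fin (m + 1) × Fin k :=
  (Fin.succEmb m).prodMap (Function.Embedding.refl _)

theorem card_freshRegs (m k : ℕ) : (freshRegs m k).card = k := by simp [freshRegs]

theorem mem_freshRegs {m k : ℕ} (v : Fin (m + 1) × Fin k) : v ∈ freshRegs m k ↔ v.1 = 0 := by
  simp only [freshRegs, Finset.mem_map, Finset.mem_univ, true_and]
  constructor
  · rintro ⟨l, rfl⟩
    rfl
  · intro h
    exact ⟨v.2, Prod.ext h.symm rfl⟩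

theorem mem_range_submittedRegs {m k : ℕ} (v : Fin (m + 1) × Fin k) :
    v ∈ Set.range (submittedRegs m k) ↔ v ∉ freshRegs m k := by
  rw [mem_freshRegs]
  constructor
  · rintro ⟨w, rfl⟩
    exact Fin.succ_ne_zero _
  · intro h
    exact ⟨(v.1.pred h, v.2), Prod.ext (by simp [submittedRegs]) rfl⟩

theorem tensorOp_mulVec_tensorVec {V : Type} [Fintype V] [DecidableEq V] {A : Op Q} {ψ : Vec Q}
    (h : A *ᵥ ψ = ψ) : tensorOp (fun _ : V => A) *ᵥ tensorVec V ψ = tensorVec V ψ := by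
  ext x
  simp only [mulVec, dotProduct, tensorOp, tensorVec, ← Finset.prod_mul_distrib]
  rw [sum_prod_curry (fun j z => A (fun q => x (j, q)) z * ψ z)]
  refine Finset.prod_congr rfl fun j _ => ?_
  exact congrFun h _

theorem pure_mulVec {ψ : Vec Q} (h : ∑ x, ‖ψ x‖ ^ 2 = 1) : pure ψ *ᵥ ψ = ψ := by
  rw [pure, vecMulVec_mulVec, dotProduct_of_normalised h]
  simp

theorem pure_mul_self {ψ : Vec Q} (h : ∑ x, ‖ψ x‖ ^ 2 = 1) : pure ψ * pure ψ = pure ψ := by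
  conv_lhs => enter [2]; rw [pure]
  rw [mul_vecMulVec, pure_mulVec h]
  rfl

theorem pure_conjTranspose (ψ : Vec Q) : (pure ψ)ᴴ = pure ψ := by
  rw [pure, conjTranspose_vecMulVec, star_star]

theorem allOn_freshRegs_mul_adjoin {m : ℕ} (e : Fin m × (Fin k × Q) ↪ ι) (ρ : Op ι) {ψ : Vec Q}
    (h : ∑ x, ‖ψ x‖ ^ 2 = 1) :
    liftOp (privateRegs (walletCoins e)) (allOn (pure ψ) (freshRegs m k)) *
      adjoin ρ (tensorVec (Fin k) ψ) = adjoin ρ (tensorVec (Fin k) ψ) := by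
  rw [freshRegs, ← liftOp_regMap_allOn, ← liftOp_trans]
  have : (regMap Q ⟨fun l : Fin k => ((0 : Fin (m + 1)), l), fun _ _ h => (Prod.mk.inj h).2⟩).trans
      (privateRegs (walletCoins e)) = Function.Embedding.inr := by
    ext p; rfl
  rw [this, liftOp_inr_mul_adjoin]
  have h2 : allOn (pure ψ) (Finset.univ : Finset (Fin k)) = tensorOp fun _ => pure ψ := by
    simp [allOn]
  rw [h2]
  exact tensorOp_mulVec_tensorVec (pure_mulVec h)

theorem liftOp_submittedRegs {m : ℕ} (e : Fin m × (Fin k × Q) ↪ ι) (A : Op ((Fin m × Fin k) × Q)) :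
    liftOp (privateRegs (walletCoins e)) (liftOp (regMap Q (submittedRegs m k)) A) =
      liftOp (Function.Embedding.inl : ι ↪ ι ⊕ (Fin k × Q)) (liftOp (privateRegs e) A) := by
  rw [← liftOp_trans, ← liftOp_trans]
  congr 1

/-- The private coins of the fresh coin are identical, so the initial wallet is already symmetric.
This is where the chain of nested projections starts. -/
theorem symProj_one_mul_allOn (m : ℕ) (ψ : Vec Q) :
    liftOp (regMap Q (firstRegs (r := m + 1) 1 (by omega))) (symProj (Fin 1 × Fin k) Q) *
      allOn (pure ψ) (freshRegs m k) = allOn (pure ψ) (freshRegs m k) := by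
  rw [liftOp_regMap_symProj, Matrix.smul_mul, Finset.sum_mul]
  rw [Finset.sum_congr rfl (g := fun _ => allOn (pure ψ) (freshRegs m k))]
  · rw [Finset.sum_const, Finset.card_univ, Fintype.card_perm, ← Nat.cast_smul_eq_nsmul ℂ,
      smul_smul, inv_mul_cancel₀, one_smul]
    exact_mod_cast Nat.factorial_ne_zero _
  · intro π _
    refine regPerm_mul_allOn_of_fixes ψ _ _ fun v hv => ?_
    refine Equiv.Perm.viaEmbedding_apply_of_notMem _ _ _ ?_
    rintro ⟨w, rfl⟩
    apply hv
    rw [mem_freshRegs]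
    have : w.1 = 0 := Subsingleton.elim _ _
    simp [firstRegs, this]

variable (S : PrivateCoinScheme) (c : ℝ) {lam : ℕ} (sk : S.Key lam) {m : ℕ}
  (e : Fin m × (Fin (kappa c lam) × S.Qub lam) ↪ ι)

/-- The projection on the symmetric subspace of the wallet after `m` accepted coins. -/
def walletSym (e : Fin m × (Fin k × Q) ↪ ι) : Op (ι ⊕ (Fin k × Q)) :=
  liftOp (privateRegs (walletCoins e)) (symProj (Fin (m + 1) × Fin k) Q)

theorem ev_pubCount (ρ : Op ι) (X : Op (ι ⊕ (Fin (kappa c lam) × S.Qub lam)))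
    (hX : ∀ n h, Commute X (liftOp (firstCoins (walletCoins e) n h)
      (walletProj n (kappa c lam) (S.Qub lam)))) :
    (((PkQC S c).pubCount sk e ρ).map fun a => ev X a.2).sum =
      ev X (adjoin ρ (tensorVec (Fin (kappa c lam)) (S.coin lam sk))) := by
  refine ev_walletCount (PkQC S c) _ _ X hX fun n h => ?_
  change Commute X (liftOp (firstCoins (walletCoins e) n h)
    (1 - walletProj n (kappa c lam) (S.Qub lam)))
  rw [liftOp_sub, liftOp_one]
  exact (Commute.one_right _).sub_right (hX n h)

/-- Whatever the outcomes, public verification does not change the distribution of the number of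
good registers, since this number is permutation invariant. -/
theorem ev_sector_pubCount (ρ : Op ι) (E : Op (S.Qub lam)) (f : ℕ → ℝ) :
    (((PkQC S c).pubCount sk e ρ).map fun a => ev (liftOp (privateRegs (walletCoins e))
      (sector _ E f)) a.2).sum =
      ev (liftOp (privateRegs (walletCoins e)) (sector _ E f))
        (adjoin ρ (tensorVec (Fin (kappa c lam)) (S.coin lam sk))) := by
  refine ev_pubCount S c sk e ρ _ fun n h => ?_
  rw [liftOp_firstCoins_walletProj]
  refine liftOp_commute_of_commute _ (liftOp_symProj_commute _ fun π => ?_).symm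
  exact regPerm_commute_sector π f

theorem pubCount_posSemidef {ρ : Op ι} (hρ : ρ.PosSemidef) :
    ∀ a ∈ (PkQC S c).pubCount sk e ρ, a.2.PosSemidef :=
  walletCount_posSemidef (PkQC S c) _ (adjoin_posSemidef hρ _)

/-- The accepting projections are nested, so their product collapses to the last one. -/
theorem pubCount_accepted {ρ : Op ι} (hρ : ρ.PosSemidef) :
    (∀ a ∈ (PkQC S c).pubCount sk e ρ, a.1 ≤ m) ∧
      ∀ φ : Op (ι ⊕ (Fin (kappa c lam) × S.Qub lam)) → ℝ,
        (((PkQC S c).pubCount sk e ρ).map fun a => if a.1 = m then φ a.2 else 0).sum =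
          φ (sandwich (walletSym e)
            (adjoin ρ (tensorVec (Fin (kappa c lam)) (S.coin lam sk)))) := by
  set ψ := S.coin lam sk
  have hψ := S.coin_normalised lam sk
  set ρ₀ := adjoin ρ (tensorVec (Fin (kappa c lam)) ψ)
  have hρ₀ : ρ₀.PosSemidef := adjoin_posSemidef hρ _
  -- After `i` accepted coins the wallet has `i + 1` coins. The value 0 is a default for indices
  -- beyond `m`, which never matter.
  let C : ℕ → Op (ι ⊕ (Fin (kappa c lam) × S.Qub lam)) := fun i =>
    if h : i + 1 ≤ m + 1 then
      liftOp (firstCoins (walletCoins e) (i + 1) h) (walletProj (i + 1) (kappa c lam) (S.Qub lam))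
    else 0
  have h0 : C 0 * ρ₀ = ρ₀ := by
    have hB : liftOp (privateRegs (walletCoins e)) (allOn (pure ψ) (freshRegs m _)) * ρ₀ = ρ₀ :=
      allOn_freshRegs_mul_adjoin e ρ hψ
    have hC0 : C 0 * liftOp (privateRegs (walletCoins e)) (allOn (pure ψ) (freshRegs m _)) =
        liftOp (privateRegs (walletCoins e)) (allOn (pure ψ) (freshRegs m _)) := by
      simp only [C]
      rw [dif_pos (by omega), liftOp_firstCoins_walletProj, ← liftOp_mul, symProj_one_mul_allOn]
    rw [← hB, ← Matrix.mul_assoc, hC0]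
  have hCH : (C 0)ᴴ = C 0 := by
    simp only [C]
    rw [dif_pos (by omega), ← liftOp_conjTranspose, walletProj_isHermitian]
  have h0' : sandwich (C 0) ρ₀ = ρ₀ := by
    rw [sandwich, h0, hCH]
    exact mul_eq_self_comm hCH hρ₀ h0
  have hm : C m = walletSym e := by
    simp only [C, walletSym]
    rw [dif_pos le_rfl, liftOp_firstCoins_walletProj, liftOp_firstRegs_self]
  rw [← hm]
  refine walletCount_accepted (PkQC S c) _ _ C h0' fun i h => ?_
  simp only [C]
  rw [dif_pos (by omega), dif_pos h]
  change liftOp (firstCoins (walletCoins e) (i + 2) h) (walletProj (i + 2) _ _) * _ = _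
  rw [liftOp_firstCoins_walletProj, liftOp_firstCoins_walletProj, ← liftOp_mul,
    liftOp_firstRegs_mul]

end Construction

/-! ### The distribution of the number of good private coins in a wallet -/

section Weights

variable {ι : Type} [Fintype ι] [DecidableEq ι] {Q : Type} [Fintype Q] [DecidableEq Q] {k m : ℕ}

/-- The probability that exactly `t` private coins of the wallet are good before the public
verification. -/
def weight (e : Fin m × (Fin k × Q) ↪ ι) (ψ : Vec Q) (ρ : Op ι) (t : ℕ) : ℝ :=
  ev (liftOp (privateRegs (walletCoins e)) (level _ (pure ψ) t)) (adjoin ρ (tensorVec (Fin k) ψ))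

/-- The probability that all submitted coins are accepted, and exactly `t` private coins of the
wallet are good. -/
def symWeight (e : Fin m × (Fin k × Q) ↪ ι) (ψ : Vec Q) (ρ : Op ι) (t : ℕ) : ℝ :=
  ev (walletSym e * liftOp (privateRegs (walletCoins e)) (level _ (pure ψ) t))
    (adjoin ρ (tensorVec (Fin k) ψ))

theorem level_conjTranspose {V : Type} [Fintype V] [DecidableEq V] {E : Op Q} (hH : Eᴴ = E)
    (t : ℕ) : (level V E t)ᴴ = level V E t := sector_conjTranspose hH _

theorem level_posSemidef {V : Type} [Fintype V] [DecidableEq V] {E : Op Q} (hE : E * E = E)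
    (hH : Eᴴ = E) (t : ℕ) : (level V E t).PosSemidef := by
  have := posSemidef_conjTranspose_mul_self (level V E t)
  rwa [level_conjTranspose hH, level_mul_self hE] at this

theorem walletSym_conjTranspose (e : Fin m × (Fin k × Q) ↪ ι) : (walletSym e)ᴴ = walletSym e := by
  rw [walletSym, ← liftOp_conjTranspose, symProj_isHermitian]

theorem walletSym_mul_self (e : Fin m × (Fin k × Q) ↪ ι) :
    walletSym e * walletSym e = walletSym e := by
  rw [walletSym, ← liftOp_mul, symProj_mul_self]

theorem card_regs (m k : ℕ) : Fintype.card (Fin (m + 1) × Fin k) = (m + 1) * k := by simp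

variable (e : Fin m × (Fin k × Q) ↪ ι) {ψ : Vec Q} {ρ : Op ι}

theorem weight_nonneg (hψ : ∑ x, ‖ψ x‖ ^ 2 = 1) (hρ : ρ.PosSemidef) (t : ℕ) :
    0 ≤ weight e ψ ρ t :=
  ev_nonneg (liftOp_posSemidef _ (level_posSemidef (pure_mul_self hψ) (pure_conjTranspose ψ) t))
    (adjoin_posSemidef hρ _)

/-- The fresh coin alone contributes `k` good registers: a pattern not containing all of them is
annihilated by the test of the fresh coin. -/
theorem weight_eq_zero (hψ : ∑ x, ‖ψ x‖ ^ 2 = 1) {t : ℕ} (ht : t < k) : weight e ψ ρ t = 0 := by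
  have hE := pure_mul_self hψ
  have h : level (Fin (m + 1) × Fin k) (pure ψ) t * allOn (pure ψ) (freshRegs m k) = 0 := by
    rw [level, sector, Finset.sum_mul]
    refine Finset.sum_eq_zero fun T _ => ?_
    rw [Matrix.smul_mul, patternEffect_mul_allOn hE]
    split_ifs with hT
    · have := Finset.card_le_card hT
      rw [card_freshRegs] at this
      rw [Pi.single_eq_of_ne (by omega), zero_smul]
    · rw [smul_zero]
  unfold weight
  rw [← allOn_freshRegs_mul_adjoin e ρ hψ, ← ev_mul_left, ← liftOp_mul, h, liftOp_zero,
    ev_zero_left]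

theorem ev_sector_adjoin (f : ℕ → ℝ) :
    ev (liftOp (privateRegs (walletCoins e)) (sector _ (pure ψ) f))
        (adjoin ρ (tensorVec (Fin k) ψ)) =
      ∑ t ∈ Finset.range ((m + 1) * k + 1), f t * weight e ψ ρ t := by
  rw [sector_eq_sum_level, liftOp_sum, ev_sum_left, card_regs]
  simp only [liftOp_smul, ev_smul_left, weight]

theorem sum_weight (hψ : ∑ x, ‖ψ x‖ ^ 2 = 1) :
    ∑ t ∈ Finset.range ((m + 1) * k + 1), weight e ψ ρ t = ρ.trace.re := by
  have := ev_sector_adjoin e (ψ := ψ) (ρ := ρ) fun _ => 1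
  rw [sector_one, liftOp_one, ev_one, trace_adjoin _ (tensorVec_normalised hψ)] at this
  simpa using this.symm

theorem walletSym_commute_sector (f : ℕ → ℝ) :
    Commute (walletSym e) (liftOp (privateRegs (walletCoins e)) (sector _ (pure ψ) f)) :=
  liftOp_commute_of_commute _ (symProj_commute_sector f)

theorem ev_walletSym_mul_sector (f : ℕ → ℝ) :
    ev (walletSym e * liftOp (privateRegs (walletCoins e)) (sector _ (pure ψ) f))
        (adjoin ρ (tensorVec (Fin k) ψ)) =
      ∑ t ∈ Finset.range ((m + 1) * k + 1), f t * symWeight e ψ ρ t := by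
  rw [sector_eq_sum_level, liftOp_sum, Finset.mul_sum, ev_sum_left, card_regs]
  simp only [liftOp_smul, Matrix.mul_smul, ev_smul_left, symWeight]

theorem ev_sandwich_walletSym (X : Op (ι ⊕ (Fin k × Q))) (σ : Op (ι ⊕ (Fin k × Q))) :
    ev X (sandwich (walletSym e) σ) = ev (walletSym e * X * walletSym e) σ := by
  rw [sandwich, ev_conj, walletSym_conjTranspose]

theorem trace_sandwich_walletSym :
    (sandwich (walletSym e) (adjoin ρ (tensorVec (Fin k) ψ))).trace.re =
      ∑ t ∈ Finset.range ((m + 1) * k + 1), symWeight e ψ ρ t := by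
  have h := ev_walletSym_mul_sector e (ψ := ψ) (ρ := ρ) fun _ => 1
  rw [sector_one, liftOp_one, Matrix.mul_one] at h
  rw [← ev_one, ev_sandwich_walletSym, Matrix.mul_one, walletSym_mul_self, h]
  simp

/-- The two projections commute, so their product can be written as a sandwich of the level
projector. -/
theorem symWeight_nonneg (hψ : ∑ x, ‖ψ x‖ ^ 2 = 1) (hρ : ρ.PosSemidef) (t : ℕ) :
    0 ≤ symWeight e ψ ρ t := by
  have hc := walletSym_commute_sector e (ψ := ψ) (Pi.single t 1)
  change 0 ≤ ev (walletSym e * liftOp _ (sector _ (pure ψ) (Pi.single t 1))) _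
  rw [← walletSym_mul_self, Matrix.mul_assoc, hc.eq, ← Matrix.mul_assoc, ← ev_sandwich_walletSym]
  refine ev_nonneg (liftOp_posSemidef _
    (level_posSemidef (pure_mul_self hψ) (pure_conjTranspose ψ) t)) ?_
  exact (adjoin_posSemidef hρ _).mul_mul_conjTranspose_same _

/-- The fraction of the `s`-element sets of registers that consist of good ones, when `t` of `K`
registers are good. -/
def goodFraction (K t s : ℕ) : ℝ := (t.choose s : ℝ) / K.choose s

/-- The fresh coin puts the state in the range of `B`, and by symmetry the compression of `B` to the
symmetric subspace is a scalar on each level: the chance that a random set of `k` registers is all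
good. Then `ev_compress_le` applies. -/
theorem symWeight_le (hψ : ∑ x, ‖ψ x‖ ^ 2 = 1) (hρ : ρ.PosSemidef) (t : ℕ) :
    symWeight e ψ ρ t ≤ goodFraction ((m + 1) * k) t k * weight e ψ ρ t := by
  have hE := pure_mul_self hψ
  have hH := pure_conjTranspose ψ
  refine ev_compress_le (B := liftOp (privateRegs (walletCoins e))
    (allOn (pure ψ) (freshRegs m k))) (by unfold goodFraction; positivity)
    (walletSym_conjTranspose e) ?_ ?_ ?_ ?_ ?_ ?_ ?_
    (adjoin_posSemidef hρ _) (allOn_freshRegs_mul_adjoin e ρ hψ)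
  · rw [← liftOp_mul, allOn_mul_allOn hE, Finset.union_self]
  · rw [← liftOp_conjTranspose, allOn_conjTranspose hH]
  · rw [← liftOp_mul, level_mul_self hE]
  · rw [← liftOp_conjTranspose, level_conjTranspose hH]
  · exact liftOp_commute_of_commute _ (sector_commute_allOn hE _ _)
  · exact (walletSym_commute_sector e _).symm
  · rw [walletSym, ← liftOp_mul, ← liftOp_mul, ← liftOp_mul, ← liftOp_mul, ← liftOp_smul]
    congr 1
    rw [level, symProj_allOn_symProj_sector hE, card_freshRegs, card_regs, ← Matrix.mul_smul,
      ← sector_smul]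
    congr 2
    funext s
    by_cases h : s = t
    · subst h; simp [goodFraction]
    · simp [h]

/-- Registers of an accepted wallet are exchangeable, so `T` behaves like a uniformly random set of
its size. -/
theorem ev_allOn_sandwich_walletSym (hψ : ∑ x, ‖ψ x‖ ^ 2 = 1) (T : Finset (Fin (m + 1) × Fin k)) :
    ev (liftOp (privateRegs (walletCoins e)) (allOn (pure ψ) T))
        (sandwich (walletSym e) (adjoin ρ (tensorVec (Fin k) ψ))) =
      ∑ t ∈ Finset.range ((m + 1) * k + 1),
        goodFraction ((m + 1) * k) t T.card * symWeight e ψ ρ t := by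
  rw [ev_sandwich_walletSym, ← ev_walletSym_mul_sector]
  congr 1
  rw [walletSym, ← liftOp_mul, ← liftOp_mul, ← liftOp_mul]
  congr 1
  have := symProj_allOn_symProj_sector (pure_mul_self hψ) T fun _ => 1
  rw [sector_one, Matrix.mul_one, card_regs] at this
  rw [this]
  simp [goodFraction]

theorem ev_sector_sandwich_walletSym (f : ℕ → ℝ) :
    ev (liftOp (privateRegs (walletCoins e)) (sector _ (pure ψ) f))
        (sandwich (walletSym e) (adjoin ρ (tensorVec (Fin k) ψ))) =
      ∑ t ∈ Finset.range ((m + 1) * k + 1), f t * symWeight e ψ ρ t := by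
  rw [ev_sandwich_walletSym, Matrix.mul_assoc, ← (walletSym_commute_sector e f).eq,
    ← Matrix.mul_assoc, walletSym_mul_self, ev_walletSym_mul_sector]

/-- Permutations of the private coins do not change the state of an accepted wallet. -/
theorem regPerm_mul_sandwich_walletSym (π : Equiv.Perm (Fin (m + 1) × Fin k))
    (σ : Op (ι ⊕ (Fin k × Q))) :
    liftOp (privateRegs (walletCoins e)) (regPerm Q π) * sandwich (walletSym e) σ =
      sandwich (walletSym e) σ := by
  rw [sandwich, ← Matrix.mul_assoc, ← Matrix.mul_assoc, walletSym, ← liftOp_mul,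
    regPerm_mul_symProj]

end Weights

/-! ### Counting a group of coins taken out of a symmetric state -/

section Group

variable {ι : Type} [Fintype ι] [DecidableEq ι] {Q : Type} [Fintype Q] [DecidableEq Q] {k n : ℕ}

theorem exists_eq_viaEmbedding {V V' : Type} (f : V' ↪ V) (τ : Equiv.Perm V)
    (h : ∀ v, v ∉ Set.range f → τ v = v) : ∃ τ' : Equiv.Perm V', τ'.viaEmbedding f = τ := by
  have hr : ∀ v, v ∈ Set.range f ↔ τ v ∈ Set.range f := by
    intro v
    constructor
    · intro hv
      by_contra hn
      have := τ.injective (h _ hn)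
      rw [this] at hn
      exact hn hv
    · intro hv
      by_contra hn
      rw [h v hn] at hv
      exact hn hv
  let F := Equiv.ofInjective f f.injective
  let τ' : Equiv.Perm V' := F.trans ((τ.subtypePerm fun v => (hr v).symm).trans F.symm)
  refine ⟨τ', ?_⟩
  ext v
  by_cases hv : v ∈ Set.range f
  · obtain ⟨i, rfl⟩ := hv
    rw [Equiv.Perm.viaEmbedding_apply]
    simp only [τ', Equiv.trans_apply, F]
    rw [Equiv.apply_ofInjective_symm f.injective]
    rfl
  · rw [Equiv.Perm.viaEmbedding_apply_of_notMem _ _ _ hv, h v hv]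

theorem exists_map_eq {V V' : Type} (f : V' ↪ V) (T : Finset V)
    (h : ∀ v ∈ T, v ∈ Set.range f) : ∃ T' : Finset V', T'.map f = T := by
  refine ⟨T.preimage f f.injective.injOn, ?_⟩
  ext v
  simp only [Finset.mem_map, Finset.mem_preimage]
  constructor
  · rintro ⟨w, hw, rfl⟩
    exact hw
  · intro hv
    obtain ⟨w, rfl⟩ := h v hv
    exact ⟨w, hv, rfl⟩

/-- The registers outside the fresh coin that the permutation `π` exchanges with the fresh coin. -/
def exchanged {n k : ℕ} (π : Equiv.Perm (Fin (n + 1) × Fin k)) : Finset (Fin (n + 1) × Fin k) :=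
  (freshRegs n k).map π.toEmbedding \ freshRegs n k

/-- The fresh coin is in the state `ψ`, so `π` may be sandwiched between its projectors. By
`exists_allOn_regPerm_allOn` this leaves a permutation of the submitted registers, invisible in the
symmetric `σ`, and a test of the exchanged registers. -/
theorem ev_regPerm_adjoin (e : Fin n × (Fin k × Q) ↪ ι) {ψ : Vec Q}
    (hψ : ∑ x, ‖ψ x‖ ^ 2 = 1) {σ : Op ι} (hσ : σ.PosSemidef)
    (hsym : ∀ τ : Equiv.Perm (Fin n × Fin k), liftOp (privateRegs e) (regPerm Q τ) * σ = σ)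
    (π : Equiv.Perm (Fin (n + 1) × Fin k)) :
    ∃ T : Finset (Fin n × Fin k), T.card = (exchanged π).card ∧
      ev (liftOp (privateRegs (walletCoins e)) (regPerm Q π)) (adjoin σ (tensorVec (Fin k) ψ)) =
        ev (liftOp (privateRegs e) (allOn (pure ψ) T)) σ := by
  have hE := pure_mul_self hψ
  have hH := pure_conjTranspose ψ
  set F := freshRegs n k
  set σ' := adjoin σ (tensorVec (Fin k) ψ)
  have hσ' : σ'.PosSemidef := adjoin_posSemidef hσ _
  set ε := privateRegs (walletCoins e)
  have hB : liftOp ε (allOn (pure ψ) F) * σ' = σ' := allOn_freshRegs_mul_adjoin e σ hψ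
  have hB' : σ' * liftOp ε (allOn (pure ψ) F) = σ' :=
    mul_eq_self_comm (by rw [← liftOp_conjTranspose, allOn_conjTranspose hH]) hσ' hB
  obtain ⟨T, hT⟩ := exists_map_eq (submittedRegs n k) (exchanged π) (by
    intro v hv
    rw [mem_range_submittedRegs]
    exact (Finset.mem_sdiff.mp hv).2)
  refine ⟨T, by rw [← hT, Finset.card_map], ?_⟩
  obtain ⟨τ, hτF, hτ⟩ := exists_allOn_regPerm_allOn ψ hE F π
  obtain ⟨τ', rfl⟩ := exists_eq_viaEmbedding (submittedRegs n k) τ (by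
    intro v hv
    rw [mem_range_submittedRegs, not_not] at hv
    exact hτF v hv)
  have hfix : ∀ υ : Equiv.Perm (Fin n × Fin k),
      liftOp ε (regPerm Q (υ.viaEmbedding (submittedRegs n k))) * σ' = σ' := by
    intro υ
    rw [← liftOp_regMap_regPerm, liftOp_submittedRegs, liftOp_inl_mul_adjoin, hsym]
  have hfix' : σ' * liftOp ε (regPerm Q (τ'.viaEmbedding (submittedRegs n k))) = σ' := by
    have h1 := congrArg conjTranspose (hfix τ'⁻¹)
    rw [conjTranspose_mul, ← liftOp_conjTranspose, regPerm_conjTranspose, hσ'.1.eq] at h1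
    have h2 : (τ'⁻¹.viaEmbedding (submittedRegs n k))⁻¹ = τ'.viaEmbedding (submittedRegs n k) := by
      rw [← Equiv.Perm.viaEmbeddingHom_apply, ← map_inv, inv_inv,
        Equiv.Perm.viaEmbeddingHom_apply]
    rwa [h2] at h1
  calc ev (liftOp ε (regPerm Q π)) σ'
      = ev (liftOp ε (allOn (pure ψ) F * regPerm Q π * allOn (pure ψ) F)) σ' := by
        rw [liftOp_mul, ev_mul_left, hB, liftOp_mul, ← ev_mul_right, hB']
    _ = ev (liftOp ε (allOn (pure ψ) (F.map π.toEmbedding ∪ F))) σ' := by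
        rw [hτ, liftOp_mul, ← ev_mul_right, hfix']
    _ = ev (liftOp ε (allOn (pure ψ) (exchanged π))) σ' := by
        rw [← Finset.sdiff_union_self_eq_union, ← allOn_mul_allOn hE, liftOp_mul, ev_mul_left, hB]
        rfl
    _ = _ := by
        rw [← hT, ← liftOp_regMap_allOn, liftOp_submittedRegs,
          ev_inl_adjoin _ _ (tensorVec_normalised hψ)]

/-- The probability that a group of `n` coins is accepted, if it is taken out of a symmetric state
in which `t` of `K` private coins are good. -/
def groupFraction (K n k t : ℕ) : ℝ :=
  (((n + 1) * k).factorial : ℝ)⁻¹ * ∑ π : Equiv.Perm (Fin (n + 1) × Fin k),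
    goodFraction K t (exchanged π).card

theorem ev_walletSym_eq_sum (e : Fin n × (Fin k × Q) ↪ ι) (σ : Op (ι ⊕ (Fin k × Q))) :
    ev (walletSym e) σ = (((n + 1) * k).factorial : ℝ)⁻¹ *
      ∑ π, ev (liftOp (privateRegs (walletCoins e)) (regPerm Q π)) σ := by
  have h : symProj (Fin (n + 1) × Fin k) Q =
      (((n + 1) * k).factorial : ℝ)⁻¹ • ∑ π, regPerm Q π := by
    rw [symProj_eq, card_regs]
    ext x y
    simp
  rw [walletSym, h, liftOp_smul, liftOp_sum, ev_smul_left, ev_sum_left]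

end Group

/-! ### The expected losses in terms of the number of good private coins -/

section Refund

theorem sum_map_sub {β : Type} (L : List β) (f g : β → ℝ) :
    (L.map fun b => f b - g b).sum = (L.map f).sum - (L.map g).sum := by
  induction L with
  | nil => simp
  | cons b L ih =>
    simp only [List.map_cons, List.sum_cons, ih]
    ring

variable {ι : Type} [Fintype ι] [DecidableEq ι] {Q : Type} [Fintype Q] [DecidableEq Q] {k : ℕ}

/-- Only the mean of the bank's count is at stake, and `sector_id` makes it additive over coins and
over registers. The fractional effect of a whole coin need not be a projection. -/
theorem sector_fractionEffect {r : ℕ} (e : Fin r × (Fin k × Q) ↪ ι) (E : Op Q) :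
    liftOp e (sector (Fin r) (fractionEffect (Fin k) E) fun t => (t : ℝ)) =
      (k : ℝ)⁻¹ • liftOp (privateRegs e) (sector (Fin r × Fin k) E fun t => (t : ℝ)) := by
  have hf : fractionEffect (Fin k) E = (k : ℝ)⁻¹ • ∑ l : Fin k, allOn E {l} := by
    rw [← sector_id, ← sector_smul]
    unfold fractionEffect sector
    refine Finset.sum_congr rfl fun T _ => ?_
    rw [Fintype.card_fin, div_eq_inv_mul]
  rw [sector_id, sector_id, liftOp_sum, liftOp_sum, Fintype.sum_prod_type, Finset.smul_sum, hf]
  refine Finset.sum_congr rfl fun i _ => ?_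
  rw [← liftOp_regEmb, ← liftOp_trans, liftOp_smul, liftOp_sum]
  congr 1
  refine Finset.sum_congr rfl fun l _ => ?_
  rw [← liftOp_regEmb, ← liftOp_trans, ← liftOp_regEmb, ← liftOp_trans]
  rfl

variable (S : PrivateCoinScheme) (c : ℝ) {lam : ℕ} (sk : S.Key lam)

theorem refundExpectation_eq {r : ℕ} (e : Fin r × (Fin (kappa c lam) × S.Qub lam) ↪ ι)
    (σ : Op ι) (a : ℝ) :
    (PkQC S c).refundExpectation sk e σ (fun t => a - t) =
      a * σ.trace.re - (kappa c lam : ℝ)⁻¹ *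
        ev (liftOp (privateRegs e) (sector _ (S.verify lam sk) fun t => (t : ℝ))) σ := by
  have h1 : (PkQC S c).refundExpectation sk e σ (fun t => a - t) =
      ev (liftOp e (sector (Fin r) (fractionEffect (Fin (kappa c lam)) (S.verify lam sk))
        fun t => a - t)) σ := by
    refine Eq.trans (congrArg List.sum (List.map_congr_left fun b _ => mul_comm _ _))
      (trace_privCount (PkQC S c).toPrivateCoinScheme sk e σ fun t => a - t)
  have h2 : sector (Fin r) (fractionEffect (Fin (kappa c lam)) (S.verify lam sk))
      (fun t => a - t) = a • 1 - sector (Fin r) (fractionEffect (Fin (kappa c lam))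
        (S.verify lam sk)) fun t => (t : ℝ) := by
    rw [← sector_one (fractionEffect (Fin (kappa c lam)) (S.verify lam sk)), ← sector_smul]
    simp only [sector, sub_smul, mul_one, Finset.sum_sub_distrib]
  rw [h1, h2, liftOp_sub, liftOp_smul, liftOp_one, ev_sub_left, ev_smul_left, ev_one,
    sector_fractionEffect, ev_smul_left]

variable {m N : ℕ} {ρ : Op (Fin N)}

/-- The refund is affine in the number of good registers, so its total over all branches is already
determined before the count. -/
theorem sum_ev_pubCount_number (e : Fin m × (Fin (kappa c lam) × S.Qub lam) ↪ ι) {ρ : Op ι}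
    (hv : S.verify lam sk = pure (S.coin lam sk)) :
    (((PkQC S c).pubCount sk e ρ).map fun a => (PkQC S c).refundExpectation sk
      (walletCoins e) a.2 (fun t => 1 - t)).sum =
      ∑ t ∈ Finset.range ((m + 1) * kappa c lam + 1),
        (1 - t / kappa c lam) * weight e (S.coin lam sk) ρ t := by
  have h1 : ∀ a : Op (ι ⊕ (Fin (kappa c lam) × S.Qub lam)),
      (PkQC S c).refundExpectation sk (walletCoins e) a (fun t => 1 - t) =
      ev (liftOp (privateRegs (walletCoins e)) (sector _ (pure (S.coin lam sk))
        fun t => 1 - t / kappa c lam)) a := by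
    intro a
    refine (refundExpectation_eq S c sk (walletCoins e) a 1).trans ?_
    have h2 : sector (Fin (m + 1) × Fin (kappa c lam)) (pure (S.coin lam sk))
        (fun t => 1 - t / kappa c lam) = 1 - (kappa c lam : ℝ)⁻¹ •
          sector _ (pure (S.coin lam sk)) fun t => (t : ℝ) := by
      rw [← sector_one (pure (S.coin lam sk)), ← sector_smul]
      simp only [sector, sub_smul, Finset.sum_sub_distrib, div_eq_inv_mul]
    rw [h2, liftOp_sub, liftOp_one, liftOp_smul, ev_sub_left, ev_one, ev_smul_left, hv, one_mul]
  rw [← ev_sector_adjoin, ← ev_sector_pubCount S c sk e]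
  congr 1
  exact List.map_congr_left fun a _ => h1 a.2

/-- The loss is `1 - refund` in every branch, plus `m` in the branch in which everything was
accepted. -/
theorem privateLoss_eq (hv : S.verify lam sk = pure (S.coin lam sk))
    (s : Submission (Fin (kappa c lam) × S.Qub lam) N) (hρ : ρ.PosSemidef) :
    (PkQC S c).privateLoss sk s ρ =
      ∑ t ∈ Finset.range ((s.m + 1) * kappa c lam + 1),
        (s.m * symWeight s.coins (S.coin lam sk) ρ t +
          (1 - t / kappa c lam) * weight s.coins (S.coin lam sk) ρ t) := by
  rw [Finset.sum_add_distrib, ← Finset.mul_sum, ← trace_sandwich_walletSym,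
    ← sum_ev_pubCount_number S c sk _ hv]
  have h := (pubCount_accepted S c sk s.coins hρ).2 fun σ => s.m * σ.trace.re
  rw [← h, ← List.sum_map_add]
  refine congrArg List.sum (List.map_congr_left fun a _ => ?_)
  by_cases ha : a.1 = s.m
  · simp only [ha, if_true]
    have e1 := refundExpectation_eq S c sk (walletCoins s.coins) a.2 (s.m + 1)
    have e2 := refundExpectation_eq S c sk (walletCoins s.coins) a.2 1
    have e3 : ∀ x y : ℝ, (s.m + 1) * x - y = s.m * x + (1 * x - y) := fun x y => by ring
    exact e1.trans ((e3 _ _).trans (congrArg (_ + ·) e2.symm))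
  · simp only [ha, if_false, zero_add]

end Refund

/-! ### Paying out a wallet in groups -/

section GroupCount

variable {ι : Type} [Fintype ι] [DecidableEq ι] (S : PrivateCoinScheme) (c : ℝ) {lam : ℕ}
  (sk : S.Key lam)

theorem groupCoins_ne {r k : ℕ} {W : Type} (n : Fin k → ℕ) (h : ∑ i, n i = r)
    (e : Fin r × W ↪ ι) {i j : Fin k} (hij : i ≠ j) (a : Fin (n i) × W) (b : Fin (n j) × W) :
    groupCoins n h e i a ≠ groupCoins n h e j b := by
  intro H
  have h1 := Prod.mk.inj (e.injective H)
  have h2 := finSigmaFinEquiv.injective (Fin.cast_injective h h1.1)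
  exact hij (congrArg Sigma.fst h2)

/-- The probability that the coins `e` are all accepted. -/
def acceptProb {n : ℕ} (e : Fin n × (Fin (kappa c lam) × S.Qub lam) ↪ ι) (σ : Op ι) : ℝ :=
  ev (walletSym e) (adjoin σ (tensorVec (Fin (kappa c lam)) (S.coin lam sk)))

theorem acceptProb_eq {n : ℕ} (e : Fin n × (Fin (kappa c lam) × S.Qub lam) ↪ ι) {σ : Op ι}
    (hσ : σ.PosSemidef) : (((PkQC S c).pubCount sk e σ).map fun a =>
      if a.1 = n then a.2.trace.re else 0).sum = acceptProb S c sk e σ := by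
  have h := (pubCount_accepted S c sk e hσ).2 fun σ => σ.trace.re
  refine h.trans ?_
  rw [← ev_one, ev_sandwich_walletSym, Matrix.mul_one, walletSym_mul_self]
  rfl

/-- Contracting the fresh coin leaves an observable on the group alone, so operations on the other
groups cannot affect it. -/
theorem acceptProb_eq_ev_liftOp {n : ℕ} (e : Fin n × (Fin (kappa c lam) × S.Qub lam) ↪ ι) :
    ∃ Z, ∀ σ : Op ι, acceptProb S c sk e σ = ev (liftOp e Z) σ := by
  refine ⟨(adjoinMap (Fin n × (Fin (kappa c lam) × S.Qub lam))
    (tensorVec (Fin (kappa c lam)) (S.coin lam sk)))ᴴ *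
    walletSym (Function.Embedding.refl (Fin n × (Fin (kappa c lam) × S.Qub lam))) *
    adjoinMap (Fin n × (Fin (kappa c lam) × S.Qub lam))
      (tensorVec (Fin (kappa c lam)) (S.coin lam sk)), fun σ => ?_⟩
  rw [acceptProb, ev_adjoin]
  have : walletSym e = liftOp (e.sumMap (Function.Embedding.refl _))
      (walletSym (Function.Embedding.refl _)) := by
    unfold walletSym
    rw [← liftOp_trans]
    congr 1
    ext p
    obtain ⟨⟨i, l⟩, q⟩ := p
    refine Fin.cases ?_ (fun i => ?_) i <;> rfl
  rw [this, adjoinMap_conj_liftOp]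

/-- No signalling: a count, followed by discarding its fresh coin, is invisible to observables that
commute with all operators on the counted coins. -/
theorem sum_trace_discard_pubCount {n : ℕ} (e : Fin n × (Fin (kappa c lam) × S.Qub lam) ↪ ι)
    (σ X : Op ι)
    (hX : ∀ A, Commute (liftOp (Function.Embedding.inl : ι ↪ ι ⊕ (Fin (kappa c lam) × S.Qub lam)) X)
      (liftOp (walletCoins e) A)) :
    (((PkQC S c).pubCount sk e σ).map fun a => ev X (discard a.2)).sum = ev X σ := by
  have hn := tensorVec_normalised (V := Fin (kappa c lam)) (S.coin_normalised lam sk)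
  rw [← ev_inl_adjoin X σ hn, ← ev_pubCount S c sk e σ _ fun n h => ?_]
  · congr 1
    exact List.map_congr_left fun a _ => ev_discard X a.2
  · rw [firstCoins, liftOp_trans]
    exact hX _

/-- The payout is a sum over groups, so by linearity only the marginal acceptance probabilities
enter. The groups are disjoint, so each marginal can be evaluated in the original state although
earlier groups have been measured. -/
theorem groupCount_eq {r k : ℕ} (n : Fin k → ℕ) (h : ∑ i, n i = r)
    (e : Fin r × (Fin (kappa c lam) × S.Qub lam) ↪ ι) {σ : Op ι} (hσ : σ.PosSemidef) (a : ℝ) :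
    (((PkQC S c).groupCount sk n h e σ).map fun b => b.2.trace.re * (a - b.1)).sum =
      a * σ.trace.re - ∑ i, n i * acceptProb S c sk (groupCoins n h e i) σ := by
  -- The invariant: states stay positive, observables not touching the groups counted so far keep
  -- their expectation, and the expected payout is the sum over these groups.
  have key := foldl_finRange_induction
    (fun (L : List (ℕ × Op ι)) (i : Fin k) => L.flatMap fun b =>
      ((PkQC S c).pubCount sk (groupCoins n h e i) b.2).map fun a =>
        (b.1 + if a.1 = n i then n i else 0, discard a.2)) [(0, σ)]
    (fun i L => (∀ b ∈ L, b.2.PosSemidef) ∧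
      (∀ X : Op ι, (∀ l : Fin k, l.1 < i → ∀ A, Commute (liftOp (Function.Embedding.inl :
          ι ↪ ι ⊕ (Fin (kappa c lam) × S.Qub lam)) X)
        (liftOp (walletCoins (groupCoins n h e l)) A)) → (L.map fun b => ev X b.2).sum = ev X σ) ∧
      (L.map fun b => (b.1 : ℝ) * b.2.trace.re).sum =
        ∑ l ∈ Finset.univ.filter (fun l : Fin k => l.1 < i),
          n l * acceptProb S c sk (groupCoins n h e l) σ)
    (by simp [hσ]) ?_
  · obtain ⟨-, h2, h3⟩ := key
    have h4 := h2 1 fun l _ A => by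
      rw [liftOp_one]
      exact Commute.one_left _
    simp only [ev_one] at h4
    have h5 : Finset.univ.filter (fun l : Fin k => l.1 < k) = Finset.univ := by
      ext l
      simp
    rw [h5] at h3
    rw [← h3, ← h4, ← List.sum_map_mul_left, ← sum_map_sub]
    unfold PublicCoinScheme.groupCount
    congr 1
    refine List.map_congr_left fun b _ => ?_
    ring
  · rintro i L ⟨h1, h2, h3⟩
    refine ⟨?_, ?_, ?_⟩
    · intro b hb
      rw [List.mem_flatMap] at hb
      obtain ⟨b', hb', hb⟩ := hb
      obtain ⟨a, ha, rfl⟩ := List.mem_map.mp hb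
      exact discard_posSemidef (pubCount_posSemidef S c sk _ (h1 b' hb') a ha)
    · intro X hX
      rw [← h2 X fun l hl => hX l (by omega), sum_map_flatMap]
      congr 1
      refine List.map_congr_left fun b _ => ?_
      rw [List.map_map]
      exact sum_trace_discard_pubCount S c sk (groupCoins n h e i) b.2 X (hX i (by omega))
    · have h5 : Finset.univ.filter (fun l : Fin k => l.1 < i.1 + 1) =
          insert i (Finset.univ.filter fun l : Fin k => l.1 < i.1) := by
        ext l
        simp only [Finset.mem_filter, Finset.mem_univ, true_and, Finset.mem_insert, Fin.ext_iff]
        omega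
      obtain ⟨Z, hZ⟩ := acceptProb_eq_ev_liftOp S c sk (groupCoins n h e i)
      have h6 := h2 (liftOp (groupCoins n h e i) Z) fun l hl A => by
        rw [← liftOp_trans]
        refine liftOp_commute _ _ (fun p q => ?_) _ _
        have hne : i ≠ l := fun H => by
          rw [H] at hl
          exact lt_irrefl _ hl
        obtain ⟨j, w⟩ := q
        refine Fin.cases ?_ (fun j => ?_) j
        · exact Sum.inl_ne_inr
        · exact fun H => groupCoins_ne n h e hne p (j, w) (Sum.inl_injective H)
      simp only [← hZ] at h6
      rw [h5, Finset.sum_insert (by simp), ← h3, ← h6, ← List.sum_map_mul_left,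
        ← List.sum_map_add, sum_map_flatMap]
      congr 1
      refine List.map_congr_left fun b hb => ?_
      rw [List.map_map, ← acceptProb_eq S c sk (groupCoins n h e i) (h1 b hb)]
      have h7 := sum_trace_discard_pubCount S c sk (groupCoins n h e i) b.2 1 fun A => by
        rw [liftOp_one]
        exact Commute.one_left _
      simp only [ev_one] at h7
      rw [← h7, ← List.sum_map_mul_left, ← List.sum_map_mul_left, ← List.sum_map_add]
      congr 1
      refine List.map_congr_left fun a _ => ?_
      have h8 := trace_discard a.2
      simp only [Function.comp]
      by_cases ha : a.1 = n i
      · simp only [ha, if_true]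
        push_cast
        rw [h8]
        ring
      · simp only [ha, if_false]
        simp

end GroupCount

/-! ### The public loss in terms of the number of good private coins -/

section PublicLoss

variable {ι : Type} [Fintype ι] [DecidableEq ι] (S : PrivateCoinScheme) (c : ℝ) {lam : ℕ}
  (sk : S.Key lam)

/-- A group inherits permutation invariance from the accepted wallet. Writing its symmetric
projection as an average over permutations, each term becomes a test of the exchanged registers,
which are a random set of the wallet. -/
theorem acceptProb_sandwich {m k : ℕ} (n : Fin k → ℕ) (h : ∑ i, n i = m + 1)
    (e : Fin m × (Fin (kappa c lam) × S.Qub lam) ↪ ι) {ρ : Op ι} (hρ : ρ.PosSemidef) (i : Fin k) :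
    acceptProb S c sk (groupCoins n h (walletCoins e) i) (sandwich (walletSym e)
        (adjoin ρ (tensorVec (Fin (kappa c lam)) (S.coin lam sk)))) =
      ∑ t ∈ Finset.range ((m + 1) * kappa c lam + 1),
        groupFraction ((m + 1) * kappa c lam) (n i) (kappa c lam) t *
          symWeight e (S.coin lam sk) ρ t := by
  have hψ := S.coin_normalised lam sk
  set σ := sandwich (walletSym e)
    (adjoin ρ (tensorVec (Fin (kappa c lam)) (S.coin lam sk))) with hσ
  have hσp : σ.PosSemidef := (adjoin_posSemidef hρ _).mul_mul_conjTranspose_same _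
  let g : Fin (n i) ↪ Fin (m + 1) :=
    ⟨fun j => Fin.cast h (finSigmaFinEquiv ⟨i, j⟩), fun a b hab => by
      have h2 := finSigmaFinEquiv.injective (Fin.cast_injective h hab)
      simpa using h2⟩
  have hg : privateRegs (groupCoins n h (walletCoins e) i) =
      (regMap (S.Qub lam) (g.prodMap (Function.Embedding.refl (Fin (kappa c lam))))).trans
        (privateRegs (walletCoins e)) := by
    ext p; rfl
  have hsym : ∀ τ, liftOp (privateRegs (groupCoins n h (walletCoins e) i))
      (regPerm (S.Qub lam) τ) * σ = σ := by
    intro τ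
    rw [hg, liftOp_trans, liftOp_regMap_regPerm, hσ, regPerm_mul_sandwich_walletSym]
  rw [acceptProb, ev_walletSym_eq_sum]
  have hπ : ∀ π : Equiv.Perm (Fin (n i + 1) × Fin (kappa c lam)),
      ev (liftOp (privateRegs (walletCoins (groupCoins n h (walletCoins e) i)))
        (regPerm (S.Qub lam) π)) (adjoin σ (tensorVec (Fin (kappa c lam)) (S.coin lam sk))) =
      ∑ t ∈ Finset.range ((m + 1) * kappa c lam + 1),
        goodFraction ((m + 1) * kappa c lam) t (exchanged π).card *
          symWeight e (S.coin lam sk) ρ t := by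
    intro π
    obtain ⟨T, hT, he⟩ := ev_regPerm_adjoin (groupCoins n h (walletCoins e) i) hψ hσp hsym π
    rw [he, hg, liftOp_trans, liftOp_regMap_allOn, hσ, ev_allOn_sandwich_walletSym e hψ,
      Finset.card_map, hT]
  rw [Finset.sum_congr rfl fun π _ => hπ π, Finset.sum_comm, Finset.mul_sum]
  refine Finset.sum_congr rfl fun t _ => ?_
  rw [groupFraction, ← Finset.sum_mul, mul_assoc]

/-- Charge `1 - refund` in every branch, and in the all-accepted branch correct it by the difference
to the loss of the groups. The first part is again insensitive to the count. -/
theorem publicLoss_eq {N : ℕ} {ρ : Op (Fin N)} (hv : S.verify lam sk = pure (S.coin lam sk))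
    {k : ℕ} (n : Fin k → ℕ) (s : Submission (Fin (kappa c lam) × S.Qub lam) N)
    (h : ∑ i, n i = s.m + 1) (hρ : ρ.PosSemidef) :
    (PkQC S c).publicLoss sk n s ρ =
      ∑ t ∈ Finset.range ((s.m + 1) * kappa c lam + 1),
        ((∑ i, n i * (1 - groupFraction ((s.m + 1) * kappa c lam) (n i) (kappa c lam) t) +
            (t / kappa c lam - 1)) * symWeight s.coins (S.coin lam sk) ρ t +
          (1 - t / kappa c lam) * weight s.coins (S.coin lam sk) ρ t) := by
  set σ := sandwich (walletSym s.coins)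
    (adjoin ρ (tensorVec (Fin (kappa c lam)) (S.coin lam sk))) with hσ
  have hσp : σ.PosSemidef := (adjoin_posSemidef hρ _).mul_mul_conjTranspose_same _
  have hm : ((s.m : ℝ) + 1) = ∑ i, (n i : ℝ) := by exact_mod_cast h.symm
  have h1 := (pubCount_accepted S c sk s.coins hρ).2 fun σ =>
    (((PkQC S c).groupCount sk n h (walletCoins s.coins) σ).map fun b =>
      b.2.trace.re * ((s.m : ℝ) + 1 - b.1)).sum -
        (PkQC S c).refundExpectation sk (walletCoins s.coins) σ (fun t => 1 - t)
  have h2 := sum_ev_pubCount_number S c sk s.coins (ρ := ρ) hv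
  have h3 : (PkQC S c).publicLoss sk n s ρ =
      (((PkQC S c).groupCount sk n h (walletCoins s.coins) σ).map fun b =>
        b.2.trace.re * ((s.m : ℝ) + 1 - b.1)).sum -
        (PkQC S c).refundExpectation sk (walletCoins s.coins) σ (fun t => 1 - t) +
      ∑ t ∈ Finset.range ((s.m + 1) * kappa c lam + 1),
        (1 - t / kappa c lam) * weight s.coins (S.coin lam sk) ρ t := by
    rw [← h2]
    refine Eq.trans ?_ (congrArg (· + _) h1)
    rw [← List.sum_map_add]
    refine (dif_pos h).trans (congrArg List.sum (List.map_congr_left fun a _ => ?_))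
    by_cases ha : a.1 = s.m
    · simp only [ha, if_true]
      ring
    · simp only [ha, if_false]
      ring
  have h4 : (PkQC S c).refundExpectation sk (walletCoins s.coins) σ (fun t => 1 - t) =
      ∑ t ∈ Finset.range ((s.m + 1) * kappa c lam + 1),
        (1 - t / kappa c lam) * symWeight s.coins (S.coin lam sk) ρ t := by
    refine (refundExpectation_eq S c sk (walletCoins s.coins) σ 1).trans ?_
    rw [hv, hσ, ev_sector_sandwich_walletSym, trace_sandwich_walletSym, one_mul, Finset.mul_sum,
      ← Finset.sum_sub_distrib]
    refine Finset.sum_congr rfl fun t _ => ?_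
    ring
  have h5 := groupCount_eq S c sk n h (walletCoins s.coins) hσp ((s.m : ℝ) + 1)
  have h6 := fun i => acceptProb_sandwich S c sk n h s.coins hρ i
  rw [h3, h4]
  refine (congrArg (fun z => z - _ + _) h5).trans ?_
  simp only [h6, hσ]
  rw [trace_sandwich_walletSym]
  simp only [Finset.mul_sum]
  rw [Finset.sum_comm, ← Finset.sum_sub_distrib, ← Finset.sum_sub_distrib,
    ← Finset.sum_add_distrib]
  refine Finset.sum_congr rfl fun t _ => ?_
  rw [hm]
  simp only [mul_sub, Finset.sum_sub_distrib, mul_one]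
  simp only [add_mul, sub_mul, Finset.sum_mul, mul_assoc]
  ring

end PublicLoss

/-! ### Estimates -/

section Estimates

theorem goodFraction_nonneg (K t s : ℕ) : 0 ≤ goodFraction K t s := by
  unfold goodFraction
  positivity

theorem goodFraction_zero (K t : ℕ) : goodFraction K t 0 = 1 := by simp [goodFraction]

/-- Registers are drawn one after the other without replacement. The truncated subtraction gives 0
once the good ones are exhausted, so no lower bound on `t` is needed. -/
theorem goodFraction_succ {K t s : ℕ} (hs : s < K) :
    goodFraction K t (s + 1) = goodFraction K t s * (((t - s : ℕ) : ℝ) / ((K : ℝ) - s)) := by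
  have h1 : (t.choose (s + 1) : ℝ) * (s + 1) = t.choose s * ((t - s : ℕ) : ℝ) := by
    exact_mod_cast Nat.choose_succ_right_eq t s
  have h2 : (K.choose (s + 1) : ℝ) * (s + 1) = K.choose s * ((K : ℝ) - s) := by
    rw [← Nat.cast_sub hs.le]
    exact_mod_cast Nat.choose_succ_right_eq K s
  have p1 : (0 : ℝ) < K.choose (s + 1) := by exact_mod_cast Nat.choose_pos hs
  have p2 : (0 : ℝ) < K.choose s := by exact_mod_cast Nat.choose_pos hs.le
  have p3 : (0 : ℝ) < (K : ℝ) - s := by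
    have : (s : ℝ) < K := by exact_mod_cast hs
    linarith
  have p4 : (0 : ℝ) < (s : ℝ) + 1 := by positivity
  unfold goodFraction
  rw [div_mul_div_comm, div_eq_div_iff p1.ne' (by positivity), ← h2, ← mul_assoc, ← h1]
  ring

theorem goodFraction_factor {K t s : ℕ} (ht : t ≤ K) (hs : s < K) :
    ((t - s : ℕ) : ℝ) / ((K : ℝ) - s) ≤ t / K := by
  have hs' : (s : ℝ) < K := by exact_mod_cast hs
  have ht' : (t : ℝ) ≤ K := by exact_mod_cast ht
  have hK : (0 : ℝ) < K := lt_of_le_of_lt (Nat.cast_nonneg s) hs'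
  rw [div_le_div_iff₀ (by linarith) hK]
  rcases le_total s t with h | h
  · rw [Nat.cast_sub h]
    nlinarith [Nat.cast_nonneg (α := ℝ) s]
  · rw [Nat.sub_eq_zero_of_le h]
    have : (0 : ℝ) ≤ (t : ℝ) * (K - s) := mul_nonneg (Nat.cast_nonneg t) (by linarith)
    simpa using this

theorem goodFraction_le_pow {K t s : ℕ} (ht : t ≤ K) (hs : s ≤ K) :
    goodFraction K t s ≤ ((t : ℝ) / K) ^ s := by
  induction s with
  | zero => simp [goodFraction]
  | succ s ih =>
    rw [goodFraction_succ (by omega), pow_succ]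
    have hs' : (s : ℝ) ≤ K := by exact_mod_cast (by omega : s ≤ K)
    exact mul_le_mul (ih (by omega)) (goodFraction_factor ht (by omega))
      (div_nonneg (Nat.cast_nonneg _) (by linarith)) (by positivity)

theorem goodFraction_anti {K t s r : ℕ} (ht : t ≤ K) (hsr : s ≤ r) (hr : r ≤ K) :
    goodFraction K t r ≤ goodFraction K t s := by
  induction r, hsr using Nat.le_induction with
  | base => exact le_rfl
  | succ r _ ih =>
    refine le_trans ?_ (ih (by omega))
    rw [goodFraction_succ (by omega)]
    refine mul_le_of_le_one_right (goodFraction_nonneg _ _ _) ?_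
    refine (goodFraction_factor ht (by omega)).trans ?_
    exact div_le_one_of_le₀ (by exact_mod_cast ht) (Nat.cast_nonneg K)

theorem goodFraction_le_one {K t s : ℕ} (ht : t ≤ K) (hs : s ≤ K) : goodFraction K t s ≤ 1 := by
  rw [← goodFraction_zero K t]
  exact goodFraction_anti ht (Nat.zero_le s) hs

theorem goodFraction_self {K s : ℕ} (hs : s ≤ K) : goodFraction K K s = 1 := by
  have : (K.choose s : ℝ) ≠ 0 := by exact_mod_cast (Nat.choose_pos hs).ne'
  exact div_self this

/-- With one bad register, a random set of size `s` misses it with probability `1 - s / K`. -/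
theorem goodFraction_pred {K s : ℕ} (hK : 0 < K) (hs : s ≤ K) :
    goodFraction K (K - 1) s = 1 - (s : ℝ) / K := by
  obtain ⟨L, rfl⟩ : ∃ L, K = L + 1 := ⟨K - 1, by omega⟩
  have h := Nat.choose_mul_succ_eq L s
  have h' : (L.choose s : ℝ) * ((L + 1 : ℕ) : ℝ) = (L + 1).choose s * (((L + 1 : ℕ) : ℝ) - s) := by
    rw [← Nat.cast_sub hs]
    exact_mod_cast h
  have p1 : ((L + 1).choose s : ℝ) ≠ 0 := by exact_mod_cast (Nat.choose_pos hs).ne'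
  have p2 : ((L + 1 : ℕ) : ℝ) ≠ 0 := by positivity
  rw [goodFraction, Nat.add_sub_cancel, one_sub_div p2, div_eq_div_iff p1 p2, h']
  ring

theorem card_exchanged_le {n k : ℕ} (π : Equiv.Perm (Fin (n + 1) × Fin k)) :
    (exchanged π).card ≤ k := by
  refine (Finset.card_le_card Finset.sdiff_subset).trans ?_
  rw [Finset.card_map, card_freshRegs]

theorem average_perm (n k : ℕ) (f : Equiv.Perm (Fin (n + 1) × Fin k) → ℝ) (b : ℝ)
    (h : ∀ π, b ≤ f π) : b ≤ (((n + 1) * k).factorial : ℝ)⁻¹ * ∑ π, f π := by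
  have hN : (0 : ℝ) < ((n + 1) * k).factorial := by exact_mod_cast Nat.factorial_pos _
  rw [inv_mul_eq_div, le_div_iff₀ hN]
  calc b * ((n + 1) * k).factorial = ∑ _π : Equiv.Perm (Fin (n + 1) × Fin k), b := by
        rw [Finset.sum_const, Finset.card_univ, Fintype.card_perm, card_regs, nsmul_eq_mul]
        ring
    _ ≤ _ := Finset.sum_le_sum fun π _ => h π

/-- At most `k` registers are exchanged with the fresh coin, and smaller sets are more likely to be
all good. -/
theorem goodFraction_le_groupFraction {K n k t : ℕ} (ht : t ≤ K) (hk : k ≤ K) :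
    goodFraction K t k ≤ groupFraction K n k t :=
  average_perm n k _ _ fun π => goodFraction_anti ht (card_exchanged_le π) hk

theorem groupFraction_self {K n k : ℕ} (hk : k ≤ K) : 1 ≤ groupFraction K n k K :=
  average_perm n k _ _ fun π => by rw [goodFraction_self ((card_exchanged_le π).trans hk)]

theorem groupFraction_le_one {K n k t : ℕ} (ht : t ≤ K) (hk : k ≤ K) :
    groupFraction K n k t ≤ 1 := by
  have h := average_perm n k (fun π => -goodFraction K t (exchanged π).card) (-1) fun π =>
    neg_le_neg (goodFraction_le_one ht ((card_exchanged_le π).trans hk))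
  rw [Finset.sum_neg_distrib, mul_neg] at h
  unfold groupFraction
  linarith

/-- With one bad register the good fraction is affine in the number of exchanged registers, so only
the mean of that number matters; `sum_perm_card_sdiff` gives it as `k * n / (n + 1)`. -/
theorem groupFraction_pred {K n k : ℕ} (hk : k ≤ K) (hk0 : 0 < k) :
    groupFraction K n k (K - 1) = 1 - (k * n : ℝ) / ((n + 1) * K) := by
  have hN : (((n + 1) * k).factorial : ℝ) ≠ 0 := by exact_mod_cast Nat.factorial_ne_zero _
  have h1 := sum_perm_card_sdiff (freshRegs n k)
  rw [card_freshRegs, card_regs] at h1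
  have h2 : (∑ π : Equiv.Perm (Fin (n + 1) × Fin k), ((exchanged π).card : ℝ)) * ((n + 1) * k) =
      ((n + 1) * k).factorial * (k * (n * k)) := by
    have h3 : (n + 1) * k - k = n * k := by rw [Nat.succ_mul, Nat.add_sub_cancel]
    rw [h3] at h1
    exact_mod_cast h1
  have hk' : (k : ℝ) ≠ 0 := by exact_mod_cast hk0.ne'
  have hK : (K : ℝ) ≠ 0 := by exact_mod_cast (by omega : K ≠ 0)
  have hn : (n : ℝ) + 1 ≠ 0 := by positivity
  have h4 : ∑ π : Equiv.Perm (Fin (n + 1) × Fin k), ((exchanged π).card : ℝ) =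
      ((n + 1) * k).factorial * (k * n / (n + 1)) := by
    have h5 : ((n : ℝ) + 1) * k ≠ 0 := mul_ne_zero hn hk'
    rw [← mul_left_inj' h5, h2]
    field_simp
  unfold groupFraction
  have h6 : ∀ π : Equiv.Perm (Fin (n + 1) × Fin k), goodFraction K (K - 1) (exchanged π).card =
      1 - ((exchanged π).card : ℝ) / K := fun π =>
    goodFraction_pred (by omega) ((card_exchanged_le π).trans hk)
  simp only [h6]
  rw [Finset.sum_sub_distrib, ← Finset.sum_div, h4, Finset.sum_const, Finset.card_univ,
    Fintype.card_perm, card_regs, nsmul_eq_mul, mul_one]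
  field_simp

/-- Bounds in the fraction of good registers thereby reduce to the smallest and largest admissible
fraction. -/
theorem convexOn_wallet (k : ℕ) (a b d : ℝ) (ha : 0 ≤ a) :
    ConvexOn ℝ (Set.Ici 0) fun x : ℝ => a * x ^ k - (b * x + d) := by
  have h1 : ConvexOn ℝ (Set.Ici (0 : ℝ)) fun x : ℝ => a * x ^ k := (convexOn_pow k).smul ha
  have h2 : ConcaveOn ℝ (Set.Ici (0 : ℝ)) fun x : ℝ => b * x + d := by
    refine ⟨convex_Ici 0, fun x _ y _ u v _ _ huv => le_of_eq ?_⟩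
    simp only [smul_eq_mul]
    linear_combination d * huv
  exact h1.sub h2

/-- The value at the left endpoint, where there are only as many good registers as the fresh coin
supplies. The worst case is `m = 1`. -/
theorem pow_inv_succ_le {m k : ℕ} (hm : 1 ≤ m) (hk : 1 ≤ k) :
    ((m : ℝ) + 1) * (1 / ((m : ℝ) + 1)) ^ k ≤ 2 * (1 / 2) ^ k := by
  obtain ⟨j, rfl⟩ : ∃ j, k = j + 1 := ⟨k - 1, by omega⟩
  have hm' : (1 : ℝ) ≤ m := by exact_mod_cast hm
  have e1 : ((m : ℝ) + 1) * (1 / ((m : ℝ) + 1)) ^ (j + 1) = (1 / ((m : ℝ) + 1)) ^ j := by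
    rw [pow_succ]
    field_simp
  have e2 : (2 : ℝ) * (1 / 2) ^ (j + 1) = (1 / 2) ^ j := by
    rw [pow_succ]
    ring
  rw [e1, e2]
  exact pow_le_pow_left₀ (by positivity) (one_div_le_one_div_of_le two_pos (by linarith)) j

/-- The utility of submitting `m` coins with `t - k` good private coins. -/
theorem mul_goodFraction_sub_le {m k t : ℕ} (hk : 1 ≤ k) (hkt : k ≤ t) (ht : t ≤ (m + 1) * k) :
    m * goodFraction ((m + 1) * k) t k - ((t : ℝ) / k - 1) ≤ 2 * (1 / 2) ^ k := by
  have hk' : (0 : ℝ) < k := by exact_mod_cast hk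
  have hkt' : (k : ℝ) ≤ t := by exact_mod_cast hkt
  have ht' : (t : ℝ) ≤ (m + 1) * k := by exact_mod_cast ht
  have hm1 : (0 : ℝ) < (m : ℝ) + 1 := by positivity
  rcases Nat.eq_zero_or_pos m with rfl | hm
  · have : 1 ≤ (t : ℝ) / k := by rwa [le_div_iff₀ hk', one_mul]
    have h2 : (0 : ℝ) ≤ 2 * (1 / 2) ^ k := by positivity
    simp only [Nat.cast_zero, zero_mul]
    linarith
  have hK : k ≤ (m + 1) * k := hkt.trans ht
  have h1 := goodFraction_le_pow ht hK
  set x : ℝ := (t : ℝ) / ((m + 1) * k : ℕ) with hx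
  have hx' : x = t / ((m + 1) * k) := by rw [hx]; push_cast; rfl
  have hxt : (t : ℝ) / k = (m + 1) * x := by
    rw [hx']
    field_simp
  have hx0 : 1 / ((m : ℝ) + 1) ≤ x := by
    rw [hx', div_le_div_iff₀ hm1 (by positivity)]
    nlinarith
  have hx1 : x ≤ 1 := by
    rw [hx', div_le_one (by positivity)]
    exact ht'
  have h0 : 0 ≤ 1 / ((m : ℝ) + 1) := by positivity
  -- The left endpoint corresponds to `t = k` and the right one to a wallet without bad registers,
  -- where the expression vanishes.
  have hc := (convexOn_wallet k m (m + 1) (-1) (Nat.cast_nonneg m)).le_max_of_mem_Icc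
    (x := 1 / ((m : ℝ) + 1)) (y := 1) h0 (by simp) ⟨hx0, hx1⟩
  have e1 : (m : ℝ) * (1 / ((m : ℝ) + 1)) ^ k - ((m + 1) * (1 / ((m : ℝ) + 1)) + -1) ≤
      2 * (1 / 2) ^ k := by
    rw [mul_one_div_cancel hm1.ne']
    have := pow_inv_succ_le hm hk
    have h3 : 0 ≤ (1 / ((m : ℝ) + 1)) ^ k := by positivity
    linarith
  have e2 : (m : ℝ) * 1 ^ k - ((m + 1) * 1 + -1) ≤ 2 * (1 / 2) ^ k := by
    have : (0 : ℝ) ≤ 2 * (1 / 2) ^ k := by positivity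
    rw [one_pow]
    linarith
  have h4 := hc.trans (max_le e1 e2)
  have h5 : (m : ℝ) * goodFraction ((m + 1) * k) t k ≤ m * x ^ k :=
    mul_le_mul_of_nonneg_left h1 (Nat.cast_nonneg m)
  rw [hxt]
  linarith

/-- The endpoint estimate when two private coins are bad. -/
theorem two_bad_le {m k : ℕ} (hm : 1 ≤ m) (hk : 18 ≤ k) :
    ((m : ℝ) + 1) * (1 - 2 / ((m + 1) * k)) ^ k -
      (((m : ℝ) + 1) * (1 - 2 / ((m + 1) * k)) + -1) ≤ 0 := by
  have hk' : (18 : ℝ) ≤ k := by exact_mod_cast hk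
  have hm' : (1 : ℝ) ≤ m := by exact_mod_cast hm
  set M : ℝ := (m : ℝ)
  set y : ℝ := 1 / ((M + 1) * k) with hy
  have hy0 : 0 < y := by positivity
  have hy1 : y ≤ 1 := by
    rw [hy, div_le_one (by positivity)]
    nlinarith
  have h2y : 2 / ((M + 1) * k) = 2 * y := by rw [hy]; ring
  have hyk : k * y = 1 / (M + 1) := by
    rw [hy]
    field_simp
  have h2y1 : 0 ≤ 1 - 2 * y := by
    have : y ≤ 1 / 2 := by
      rw [hy]
      exact one_div_le_one_div_of_le two_pos (by nlinarith)
    linarith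
  have hb : 1 + k * y ≤ (1 + y) ^ k := one_add_mul_le_pow (by linarith) k
  -- Together with Bernoulli's inequality for `1 + y` this yields an upper bound on the power of `1
  -- - y`, without exponentials.
  have hprod : (1 - y) ^ k * (1 + y) ^ k ≤ 1 := by
    rw [← mul_pow]
    exact pow_le_one₀ (by nlinarith) (by nlinarith)
  have hp0 : 0 ≤ (1 - y) ^ k := pow_nonneg (by linarith) k
  have h1 : (1 - y) ^ k ≤ (M + 1) / (M + 2) := by
    rw [le_div_iff₀ (by linarith)]
    rw [hyk] at hb
    have h3 : (1 - y) ^ k * (1 + 1 / (M + 1)) ≤ 1 :=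
      (mul_le_mul_of_nonneg_left hb hp0).trans hprod
    have h4 : (1 : ℝ) + 1 / (M + 1) = (M + 2) / (M + 1) := by
      field_simp
      ring
    rw [h4, ← mul_div_assoc, div_le_one (by linarith)] at h3
    exact h3
  have h2 : (1 - 2 * y) ^ k ≤ ((M + 1) / (M + 2)) ^ 2 := by
    calc (1 - 2 * y) ^ k ≤ ((1 - y) ^ 2) ^ k := pow_le_pow_left₀ h2y1 (by nlinarith) k
      _ = ((1 - y) ^ k) ^ 2 := by rw [← pow_mul, ← pow_mul, mul_comm]
      _ ≤ _ := pow_le_pow_left₀ hp0 h1 2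
  rw [h2y]
  -- The origin of the threshold 18: the estimate after this one is an equality at `M = 1`, so it
  -- leaves room for exactly `2 / k ≤ 1 / 9`.
  have h5 : (M + 1) * (2 * y) ≤ 1 / 9 := by
    have : (M + 1) * (2 * y) = 2 / k := by
      rw [hy]
      field_simp
    rw [this, div_le_div_iff₀ (by linarith) (by norm_num)]
    linarith
  have h6 : (M + 1) * ((M + 1) / (M + 2)) ^ 2 ≤ M - 1 / 9 := by
    rw [div_pow, ← mul_div_assoc, div_le_iff₀ (by positivity)]
    nlinarith [mul_nonneg (sub_nonneg.mpr hm') (sub_nonneg.mpr hm'), sq_nonneg M]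
  have h7 : (M + 1) * (1 - 2 * y) ^ k ≤ (M + 1) * ((M + 1) / (M + 2)) ^ 2 :=
    mul_le_mul_of_nonneg_left h2 (by linarith)
  linarith

/-- The loss in the public sabotage game when `t` private coins of the wallet are good. -/
theorem public_loss_le {m k t l : ℕ} (hk : 18 ≤ k) (hkt : k ≤ t) (ht : t ≤ (m + 1) * k)
    (n : Fin l → ℕ) (hn : ∑ i, n i = m + 1) :
    goodFraction ((m + 1) * k) t k *
        (∑ i, n i * (1 - groupFraction ((m + 1) * k) (n i) k t) + ((t : ℝ) / k - 1)) -
      ((t : ℝ) / k - 1) ≤ 2 * (1 / 2) ^ k := by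
  have hk' : (18 : ℝ) ≤ k := by exact_mod_cast hk
  have hk0 : (0 : ℝ) < k := by linarith
  have hkt' : (k : ℝ) ≤ t := by exact_mod_cast hkt
  have ht' : (t : ℝ) ≤ (m + 1) * k := by exact_mod_cast ht
  have hm1 : (0 : ℝ) < (m : ℝ) + 1 := by positivity
  have hK : k ≤ (m + 1) * k := hkt.trans ht
  have hδ : (0 : ℝ) ≤ 2 * (1 / 2) ^ k := by positivity
  have hn' : ∑ i, (n i : ℝ) = m + 1 := by exact_mod_cast hn
  set g := goodFraction ((m + 1) * k) t k with hg
  have hg0 : 0 ≤ g := goodFraction_nonneg _ _ _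
  have hg1 : g ≤ 1 := goodFraction_le_one ht hK
  -- Without bad registers every group passes and the remaining terms cancel.
  rcases ht.eq_or_lt with h | h
  · have hL : ∑ i, (n i : ℝ) * (1 - groupFraction ((m + 1) * k) (n i) k t) ≤ 0 := by
      refine Finset.sum_nonpos fun i _ => ?_
      have := groupFraction_self (n := n i) hK
      rw [h]
      exact mul_nonpos_of_nonneg_of_nonpos (Nat.cast_nonneg _) (by linarith)
    have hg' : g = 1 := by rw [hg, h, goodFraction_self hK]
    rw [hg']
    linarith
  have hm : 1 ≤ m := by
    by_contra h0
    have : m = 0 := by omega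
    subst this
    omega
  have hm' : (1 : ℝ) ≤ m := by exact_mod_cast hm
  -- With a single bad register the bound used below for the groups would leave a loss of `1 / ((m +
  -- 1) * k)`, which is only polynomially small. The exact group probability is used instead,
  -- together with `n i ≤ m + 1`.
  by_cases h1 : t = (m + 1) * k - 1
  · have hKpos : 0 < (m + 1) * k := by omega
    have hcast : (((m + 1) * k : ℕ) : ℝ) = (m + 1) * k := by push_cast; ring
    have hg' : g = m / (m + 1) := by
      rw [hg, h1, goodFraction_pred hKpos hK, hcast]
      field_simp
      ring
    have ht1 : (t : ℝ) / k - 1 = m - 1 / k := by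
      rw [h1, Nat.cast_sub (by omega), hcast, Nat.cast_one]
      field_simp
      ring
    have hL : ∑ i, (n i : ℝ) * (1 - groupFraction ((m + 1) * k) (n i) k t) ≤
        ((m : ℝ) + 1) / (m + 2) := by
      calc _ ≤ ∑ i, (n i : ℝ) * (1 / (m + 2)) := by
            refine Finset.sum_le_sum fun i _ => ?_
            refine mul_le_mul_of_nonneg_left ?_ (Nat.cast_nonneg _)
            rw [h1, groupFraction_pred hK (by omega), hcast, sub_sub_cancel]
            have hni : (n i : ℝ) ≤ m + 1 := by
              rw [← hn']
              exact Finset.single_le_sum (f := fun i => (n i : ℝ))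
                (fun j _ => Nat.cast_nonneg _) (Finset.mem_univ i)
            have hni0 : (0 : ℝ) ≤ n i := Nat.cast_nonneg _
            have e : (k * n i : ℝ) / ((n i + 1) * ((m + 1) * k)) =
                n i / ((n i + 1) * (m + 1)) := by
              field_simp
            rw [e, div_le_div_iff₀ (by positivity) (by positivity)]
            nlinarith
        _ = _ := by rw [← Finset.sum_mul, hn']; ring
    rw [ht1, hg']
    have hk1 : (1 : ℝ) / k ≤ 1 / 18 := one_div_le_one_div_of_le (by norm_num) hk'
    have e1 : (m : ℝ) / (m + 1) * (((m : ℝ) + 1) / (m + 2)) = m / (m + 2) := by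
      field_simp
    have e2 : (m : ℝ) / (m + 1) = 1 - 1 / (m + 1) := by
      field_simp
      ring
    have h3 := mul_le_mul_of_nonneg_left hL (show (0 : ℝ) ≤ (m : ℝ) / (m + 1) by positivity)
    rw [e1] at h3
    have h4 : (m : ℝ) / (m + 2) ≤ 1 / (m + 1) * (m - 1 / k) := by
      rw [one_div_mul_eq_div, div_le_div_iff₀ (by positivity) hm1]
      nlinarith
    have h5 : (m : ℝ) / (m + 1) * (m - 1 / k) = (m - 1 / k) - 1 / (m + 1) * (m - 1 / k) := by
      rw [e2]
      ring
    rw [mul_add, h5]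
    linarith
  · have ht2 : t + 2 ≤ (m + 1) * k := by omega
    have ht2' : (t : ℝ) + 2 ≤ (m + 1) * k := by exact_mod_cast ht2
    have hL : ∑ i, (n i : ℝ) * (1 - groupFraction ((m + 1) * k) (n i) k t) ≤
        (m + 1) * (1 - g) := by
      rw [← hn', Finset.sum_mul]
      refine Finset.sum_le_sum fun i _ => mul_le_mul_of_nonneg_left ?_ (Nat.cast_nonneg _)
      have := goodFraction_le_groupFraction (n := n i) ht hK
      linarith
    have hp := goodFraction_le_pow ht hK
    set x : ℝ := (t : ℝ) / ((m + 1) * k : ℕ) with hx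
    have hx' : x = t / ((m + 1) * k) := by rw [hx]; push_cast; rfl
    have hxt : (t : ℝ) / k = (m + 1) * x := by
      rw [hx']
      field_simp
    have hx0 : 1 / ((m : ℝ) + 1) ≤ x := by
      rw [hx', div_le_div_iff₀ hm1 (by positivity)]
      nlinarith
    have hx1 : x ≤ 1 - 2 / ((m + 1) * k) := by
      rw [hx', one_sub_div (by positivity)]
      exact div_le_div_of_nonneg_right (by linarith) (by positivity)
    have h0 : 0 ≤ 1 / ((m : ℝ) + 1) := by positivity
    -- The coefficient `m + 1` makes the value at the fraction 1 equal to 1, hence the interval has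
    -- to stop at two bad registers.
    have hc := (convexOn_wallet k ((m : ℝ) + 1) (m + 1) (-1) (by positivity)).le_max_of_mem_Icc
      (x := 1 / ((m : ℝ) + 1)) (y := 1 - 2 / ((m + 1) * k)) h0
      (h0.trans (hx0.trans hx1)) ⟨hx0, hx1⟩
    have e1 : ((m : ℝ) + 1) * (1 / ((m : ℝ) + 1)) ^ k - ((m + 1) * (1 / ((m : ℝ) + 1)) + -1) ≤
        2 * (1 / 2) ^ k := by
      rw [mul_one_div_cancel hm1.ne']
      have := pow_inv_succ_le hm (by omega : 1 ≤ k)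
      linarith
    have h4 := hc.trans (max_le e1 ((two_bad_le hm hk).trans hδ))
    have h5 : ((m : ℝ) + 1) * g ≤ (m + 1) * x ^ k := mul_le_mul_of_nonneg_left hp (by positivity)
    rw [hxt]
    have h6 : (m + 1) * g - ((m + 1) * x - 1) ≤ 2 * (1 / 2) ^ k := by linarith
    -- Once the groups are bounded by `hL`, the loss factors as `(1 - g) * ((m + 1) * g - (t / k -
    -- 1))`.
    have h7 := mul_le_mul_of_nonneg_left hL hg0
    have h8 := mul_le_mul_of_nonneg_left h6 (sub_nonneg.mpr hg1)
    have h9 : (1 - g) * (2 * (1 / 2) ^ k) ≤ 2 * (1 / 2) ^ k :=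
      mul_le_of_le_one_left hδ (by linarith)
    nlinarith

end Estimates

/-! ### The losses of the bank -/

section LossBounds

variable {ι : Type} [Fintype ι] [DecidableEq ι] {Q : Type} [Fintype Q] [DecidableEq Q]

theorem symWeight_eq_zero {k m : ℕ} (e : Fin m × (Fin k × Q) ↪ ι) {ψ : Vec Q} {ρ : Op ι}
    (hψ : ∑ x, ‖ψ x‖ ^ 2 = 1) (hρ : ρ.PosSemidef) {t : ℕ} (ht : t < k) :
    symWeight e ψ ρ t = 0 := by
  refine le_antisymm ((symWeight_le e hψ hρ t).trans ?_) (symWeight_nonneg e hψ hρ t)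
  rw [weight_eq_zero e hψ ht, mul_zero]

/-- A bound on each sector is a bound on the sum. -/
theorem sum_symWeight_weight_le {k m : ℕ} (e : Fin m × (Fin k × Q) ↪ ι) {ψ : Vec Q} {ρ : Op ι}
    (hψ : ∑ x, ‖ψ x‖ ^ 2 = 1) (hρ : ρ.PosSemidef) (a b : ℕ → ℝ) {d : ℝ}
    (ha : ∀ t, k ≤ t → t ≤ (m + 1) * k → 0 ≤ a t)
    (h : ∀ t, k ≤ t → t ≤ (m + 1) * k → a t * goodFraction ((m + 1) * k) t k + b t ≤ d) :
    ∑ t ∈ Finset.range ((m + 1) * k + 1), (a t * symWeight e ψ ρ t + b t * weight e ψ ρ t) ≤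
      d * ρ.trace.re := by
  rw [← sum_weight e hψ, Finset.mul_sum]
  refine Finset.sum_le_sum fun t ht => ?_
  have ht' : t ≤ (m + 1) * k := Nat.lt_succ_iff.mp (Finset.mem_range.mp ht)
  rcases lt_or_ge t k with hk | hk
  · rw [weight_eq_zero e hψ hk, symWeight_eq_zero e hψ hρ hk]
    simp
  · have h1 := mul_le_mul_of_nonneg_left (symWeight_le e hψ hρ t) (ha t hk ht')
    have h2 := mul_le_mul_of_nonneg_right (h t hk ht') (weight_nonneg e hψ hρ t)
    linarith

variable (S : PrivateCoinScheme) (c : ℝ) {lam N : ℕ} (sk : S.Key lam) {ρ : Op (Fin N)}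

theorem privateLoss_le (hv : S.verify lam sk = pure (S.coin lam sk)) (hk : 1 ≤ kappa c lam)
    (s : Submission (Fin (kappa c lam) × S.Qub lam) N) (hρ : ρ.PosSemidef) :
    (PkQC S c).privateLoss sk s ρ ≤ 2 * (1 / 2) ^ kappa c lam * ρ.trace.re := by
  rw [privateLoss_eq S c sk hv s hρ]
  refine sum_symWeight_weight_le s.coins (S.coin_normalised lam sk) hρ (fun _ => s.m)
    (fun t => 1 - t / kappa c lam) (fun _ _ _ => Nat.cast_nonneg _) fun t h1 h2 => ?_
  have := mul_goodFraction_sub_le hk h1 h2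
  linarith

theorem publicLoss_le (hv : S.verify lam sk = pure (S.coin lam sk)) (hk : 18 ≤ kappa c lam)
    {k : ℕ} (n : Fin k → ℕ) (s : Submission (Fin (kappa c lam) × S.Qub lam) N)
    (hρ : ρ.PosSemidef) :
    (PkQC S c).publicLoss sk n s ρ ≤ 2 * (1 / 2) ^ kappa c lam * ρ.trace.re := by
  by_cases h : ∑ i, n i = s.m + 1
  · rw [publicLoss_eq S c sk hv n s h hρ]
    refine sum_symWeight_weight_le s.coins (S.coin_normalised lam sk) hρ
      (fun t => ∑ i, n i * (1 - groupFraction ((s.m + 1) * kappa c lam) (n i) (kappa c lam) t) +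
        ((t : ℝ) / kappa c lam - 1))
      (fun t => 1 - t / kappa c lam) (fun t h1 h2 => ?_) fun t h1 h2 => ?_
    · refine add_nonneg (Finset.sum_nonneg fun i _ => mul_nonneg (Nat.cast_nonneg _) ?_) ?_
      · exact sub_nonneg.mpr (groupFraction_le_one h2 (h1.trans h2))
      · rw [sub_nonneg, one_le_div (by exact_mod_cast (by omega : 0 < kappa c lam))]
        exact_mod_cast h1
    · have := public_loss_le hk h1 h2 n h
      linarith
  -- If the group sizes do not match the submission, the loss is 0 by definition.
  · refine (dif_neg h).trans_le ?_
    have := PosSemidef_trace_re_nonneg hρ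
    positivity

end LossBounds

/-! ### The gain of a forger from a single count -/

section Excess

variable {V V' Q : Type} [Fintype V] [DecidableEq V] [Fintype V'] [DecidableEq V']
  [Fintype Q] [DecidableEq Q]

/-- Once the registers in `F` are known to be good, the total number of good ones is the size of `F`
plus the number among the remaining registers. With `F` empty this is mere renumbering. -/
theorem sector_mul_allOn_of_compl {E : Op Q} (hE : E * E = E) (f : V' ↪ V) (F : Finset V)
    (hF : ∀ v, v ∈ Set.range f ↔ v ∉ F) (g : ℕ → ℝ) :
    sector V E g * allOn E F =
      liftOp (regMap Q f) (sector V' E fun j => g (F.card + j)) * allOn E F := by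
  have hmem : ∀ a, f a ∉ F := fun a => (hF _).mp ⟨a, rfl⟩
  have h1 : ∀ T : Finset V', liftOp (regMap Q f) (patternEffect E T) * allOn E F =
      patternEffect E (F ∪ T.map f) := by
    intro T
    have := liftOp_regMap_tensorOp f
      (fun v => if v ∈ F then 1 else if v ∈ T.map f then E else 1 - E) fun j hj => by
        rw [hF, not_not] at hj
        simp [hj]
    have h2 : patternEffect E T = tensorOp fun j =>
        (fun v => if v ∈ F then 1 else if v ∈ T.map f then E else 1 - E) (f j) := by
      unfold patternEffect
      congr 1
      funext j
      simp [hmem j]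
    rw [h2, this, allOn, tensorOp_mul, patternEffect]
    congr 1
    funext v
    by_cases hv : v ∈ F <;> simp [hv]
  rw [sector, sector, liftOp_sum, Finset.sum_mul, Finset.sum_mul]
  simp only [liftOp_smul, Matrix.smul_mul, h1, patternEffect_mul_allOn hE, smul_ite, smul_zero]
  rw [← Finset.sum_filter]
  symm
  -- The patterns that contain `F` are determined by their part outside `F`.
  refine Finset.sum_nbij (fun T => F ∪ T.map f) ?_ ?_ ?_ ?_
  · intro T _
    simp
  · intro T _ T' _ h
    ext a
    have := congrArg (f a ∈ ·) h
    simpa [hmem a] using this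
  · intro T hT
    have hT' : F ⊆ T := by simpa using hT
    refine ⟨Finset.univ.filter fun a => f a ∈ T, by simp, ?_⟩
    ext v
    simp only [Finset.mem_union, Finset.mem_map, Finset.mem_filter, Finset.mem_univ, true_and]
    constructor
    · rintro (h | ⟨a, ha, rfl⟩)
      · exact hT' h
      · exact ha
    · intro h
      by_cases hv : v ∈ F
      · exact Or.inl hv
      · obtain ⟨a, rfl⟩ := (hF v).mpr hv
        exact Or.inr ⟨a, h, rfl⟩
  · intro T _
    rw [Finset.card_union_of_disjoint, Finset.card_map]
    rw [Finset.disjoint_left]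
    rintro v hv hv'
    obtain ⟨a, -, rfl⟩ := Finset.mem_map.mp hv'
    exact hmem a hv

theorem ev_sector_le {ι : Type} [Fintype ι] [DecidableEq ι] (e : V × Q ↪ ι) {ψ : Vec Q}
    (hψ : ∑ x, ‖ψ x‖ ^ 2 = 1) {ρ : Op ι} (hρ : ρ.PosSemidef) {f g : ℕ → ℝ}
    (h : ∀ t ≤ Fintype.card V, f t ≤ g t) :
    ev (liftOp e (sector V (pure ψ) f)) ρ ≤ ev (liftOp e (sector V (pure ψ) g)) ρ := by
  simp only [sector_eq_sum_level, liftOp_sum, ev_sum_left, liftOp_smul, ev_smul_left]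
  refine Finset.sum_le_sum fun t ht => mul_le_mul_of_nonneg_right
    (h t (Nat.lt_succ_iff.mp (Finset.mem_range.mp ht))) (ev_nonneg (liftOp_posSemidef _
      (level_posSemidef (pure_mul_self hψ) (pure_conjTranspose ψ) t)) hρ)

variable {ι : Type} [Fintype ι] [DecidableEq ι] {k m : ℕ}

theorem sum_mul_weight (e : Fin m × (Fin k × Q) ↪ ι) {ψ : Vec Q} (hψ : ∑ x, ‖ψ x‖ ^ 2 = 1)
    (ρ : Op ι) (f : ℕ → ℝ) :
    ∑ t ∈ Finset.range ((m + 1) * k + 1), f t * weight e ψ ρ t =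
      ev (liftOp (privateRegs e) (sector _ (pure ψ) fun j => f (k + j))) ρ := by
  rw [← ev_sector_adjoin, ← allOn_freshRegs_mul_adjoin e ρ hψ, ← ev_mul_left, ← liftOp_mul,
    sector_mul_allOn_of_compl (pure_mul_self hψ) (submittedRegs m k) _ mem_range_submittedRegs,
    liftOp_mul, ev_mul_left, allOn_freshRegs_mul_adjoin e ρ hψ, liftOp_submittedRegs,
    card_freshRegs, ev_inl_adjoin _ _ (tensorVec_normalised hψ)]

/-- The probability that more than `x` of the private coins in the coins `e` are good. -/
def excess (e : Fin m × (Fin k × Q) ↪ ι) (ψ : Vec Q) (x : ℕ) (ρ : Op ι) : ℝ :=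
  ev (liftOp (privateRegs e) (sector _ (pure ψ) fun j => if x < j then 1 else 0)) ρ

variable (S : PrivateCoinScheme) (c : ℝ) {lam : ℕ} (sk : S.Key lam) {r : ℕ}
  (e : Fin r × (Fin (kappa c lam) × S.Qub lam) ↪ ι) {ρ : Op ι}

/-- If `j` registers are good, the mean gain `j / κ - n` is nonpositive unless `j > κ * n`, and
never exceeds `r`. -/
theorem refund_gain_le (hv : S.verify lam sk = pure (S.coin lam sk)) (hk : 1 ≤ kappa c lam)
    (hρ : ρ.PosSemidef) (n : ℕ) :
    (PkQC S c).refundExpectation sk e ρ (fun a => (a : ℝ) - n) ≤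
      r * excess e (S.coin lam sk) (kappa c lam * n) ρ := by
  have hk' : (0 : ℝ) < kappa c lam := by exact_mod_cast hk
  have h1 : (PkQC S c).refundExpectation sk e ρ (fun a => (a : ℝ) - n) =
      -(PkQC S c).refundExpectation sk e ρ (fun a => (n : ℝ) - a) := by
    unfold PublicCoinScheme.refundExpectation
    rw [eq_neg_iff_add_eq_zero, ← List.sum_map_add]
    refine List.sum_eq_zero fun x hx => ?_
    obtain ⟨a, -, rfl⟩ := List.mem_map.mp hx
    ring
  rw [h1]
  refine (neg_le.mp ?_)
  refine le_of_le_of_eq ?_ (refundExpectation_eq S c sk e ρ n).symm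
  have h2 : ((kappa c lam : ℝ))⁻¹ * ev (liftOp (privateRegs e)
      (sector (Fin r × Fin (kappa c lam)) (pure (S.coin lam sk)) fun t => (t : ℝ))) ρ ≤
      n * ρ.trace.re + r * excess e (S.coin lam sk) (kappa c lam * n) ρ := by
    have h3 := ev_sector_le (V := Fin r × Fin (kappa c lam)) (privateRegs e)
      (S.coin_normalised lam sk) hρ
      (f := fun t => ((kappa c lam : ℝ))⁻¹ * t)
      (g := fun t => n * 1 + r * if kappa c lam * n < t then 1 else 0) fun t ht => by
        rw [Fintype.card_prod, Fintype.card_fin, Fintype.card_fin] at ht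
        rw [inv_mul_le_iff₀ hk']
        split_ifs with h
        · have : (t : ℝ) ≤ r * kappa c lam := by exact_mod_cast ht
          have : (0 : ℝ) ≤ kappa c lam * n := by positivity
          linarith
        · have : (t : ℝ) ≤ kappa c lam * n := by exact_mod_cast not_lt.mp h
          linarith
    have h4 : sector (Fin r × Fin (kappa c lam)) (pure (S.coin lam sk))
        (fun t => n * 1 + r * if kappa c lam * n < t then 1 else 0) =
        (n : ℝ) • 1 + (r : ℝ) • sector (Fin r × Fin (kappa c lam)) (pure (S.coin lam sk))
          (fun t => if kappa c lam * n < t then 1 else 0) := by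
      rw [← sector_one (V := Fin r × Fin (kappa c lam)) (pure (S.coin lam sk)), ← sector_smul,
        ← sector_smul]
      simp only [sector, add_smul, Finset.sum_add_distrib]
    rw [h4, sector_smul, liftOp_add, liftOp_smul, liftOp_smul, liftOp_smul, liftOp_one, ev_add_left,
      ev_smul_left, ev_smul_left, ev_smul_left, ev_one] at h3
    exact h3
  rw [hv]
  linarith

/-- The estimate behind private sabotage bounds the expected all-or-nothing reward by the expected
number of good submitted registers divided by `κ`, up to `2 * (1 / 2) ^ κ`. From there the argument
is that of `refund_gain_le`. -/
theorem pubCount_gain_le (hk : 1 ≤ kappa c lam)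
    (hρ : ρ.PosSemidef) (n : ℕ) :
    (((PkQC S c).pubCount sk e ρ).map fun a =>
      a.2.trace.re * (if a.1 < r then -(n : ℝ) else a.1 - n)).sum ≤
      r * excess e (S.coin lam sk) (kappa c lam * n) ρ +
        2 * (1 / 2) ^ kappa c lam * ρ.trace.re := by
  have hk' : (0 : ℝ) < kappa c lam := by exact_mod_cast hk
  have hψ := S.coin_normalised lam sk
  obtain ⟨hle, hacc⟩ := pubCount_accepted S c sk e hρ
  have h1 := hacc fun σ => r * σ.trace.re
  have h2 : (((PkQC S c).pubCount sk e ρ).map fun a => a.2.trace.re).sum = ρ.trace.re := by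
    refine Eq.trans (congrArg List.sum (List.map_congr_left fun a _ => (ev_one a.2).symm))
      ((ev_pubCount S c sk e ρ 1 fun _ _ => Commute.one_left _).trans ?_)
    rw [ev_one, trace_adjoin _ (tensorVec_normalised hψ)]
  -- The count never exceeds `r`, so the reward is all or nothing: `r` at the value `r`, and zero
  -- below.
  have key : ∀ (p : ℕ) (x : ℝ), p ≤ r →
      x * (if p < r then -(n : ℝ) else p - n) = (if p = r then r * x else 0) - n * x := by
    intro p x hp
    rcases hp.eq_or_lt with h | h
    · simp only [h, lt_irrefl, if_false, if_true]
      ring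
    · rw [if_pos h, if_neg h.ne]
      ring
  have h3 : (((PkQC S c).pubCount sk e ρ).map fun a =>
      a.2.trace.re * (if a.1 < r then -(n : ℝ) else a.1 - n)).sum =
      r * ∑ t ∈ Finset.range ((r + 1) * kappa c lam + 1), symWeight e (S.coin lam sk) ρ t -
        n * ρ.trace.re := by
    rw [← trace_sandwich_walletSym, ← h1, ← h2, ← List.sum_map_mul_left, ← sum_map_sub]
    exact congrArg List.sum (List.map_congr_left fun a ha => key a.1 _ (hle a ha))
  rw [h3]
  have h4 := sum_symWeight_weight_le e hψ hρ (fun _ => (r : ℝ))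
    (fun t => -((t : ℝ) / kappa c lam - 1))
    (fun _ _ _ => Nat.cast_nonneg _) (d := 2 * (1 / 2) ^ kappa c lam) fun t h1 h2 => by
      have := mul_goodFraction_sub_le hk h1 h2
      linarith
  rw [Finset.sum_add_distrib, ← Finset.mul_sum, sum_mul_weight e hψ] at h4
  have h5 := ev_sector_le (V := Fin r × Fin (kappa c lam)) (privateRegs e) hψ hρ
    (f := fun j => -(n : ℝ) * 1 + -r * if kappa c lam * n < j then 1 else 0)
    (g := fun j => -(((kappa c lam + j : ℕ) : ℝ) / kappa c lam - 1)) fun t ht => by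
      rw [Fintype.card_prod, Fintype.card_fin, Fintype.card_fin] at ht
      have e1 : ((kappa c lam + t : ℕ) : ℝ) / kappa c lam - 1 = t / kappa c lam := by
        push_cast
        field_simp
        ring
      rw [e1, le_neg, div_le_iff₀ hk']
      split_ifs with h
      · have : (t : ℝ) ≤ r * kappa c lam := by exact_mod_cast ht
        have : (0 : ℝ) ≤ kappa c lam * n := by positivity
        linarith
      · have : (t : ℝ) ≤ kappa c lam * n := by exact_mod_cast not_lt.mp h
        linarith
  have h6 : sector (Fin r × Fin (kappa c lam)) (pure (S.coin lam sk))
      (fun j => -(n : ℝ) * 1 + -r * if kappa c lam * n < j then 1 else 0) =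
      (-(n : ℝ)) • 1 + (-(r : ℝ)) • sector (Fin r × Fin (kappa c lam)) (pure (S.coin lam sk))
        (fun t => if kappa c lam * n < t then 1 else 0) := by
    rw [← sector_one (V := Fin r × Fin (kappa c lam)) (pure (S.coin lam sk)), ← sector_smul,
      ← sector_smul]
    simp only [sector, add_smul, Finset.sum_add_distrib]
  rw [h6, liftOp_add, liftOp_smul, liftOp_smul, liftOp_one, ev_add_left, ev_smul_left,
    ev_smul_left, ev_one] at h5
  change _ + -(r : ℝ) * excess e (S.coin lam sk) (kappa c lam * n) ρ ≤ _ at h5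
  linarith

end Excess

/-! ### Executions of oracle programs -/

section Gates

theorem hadamardOp_conjTranspose_mul : hadamardOpᴴ * hadamardOp = 1 := by
  obtain ⟨a, ha⟩ : ∃ a : ℂ, a = (Real.sqrt 2 : ℂ)⁻¹ := ⟨_, rfl⟩
  have h1 : star a = a := by rw [ha, ← Complex.ofReal_inv, Complex.star_def, Complex.conj_ofReal]
  have h2 : a * a = 1 / 2 := by
    rw [ha, ← mul_inv, ← Complex.ofReal_mul, Real.mul_self_sqrt (by norm_num)]
    norm_num
  ext x y
  rw [mul_apply, Fintype.sum_equiv (Equiv.funUnique (Fin 1) Bool) _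
    (fun b => hadamardOpᴴ x (fun _ => b) * hadamardOp (fun _ => b) y) fun z => by
      rw [show z = fun _ => Equiv.funUnique (Fin 1) Bool z from
        funext fun i => congrArg z (Subsingleton.elim _ _)]
      rfl]
  have hxy : x = y ↔ x 0 = y 0 :=
    ⟨fun h => by rw [h], fun h => funext fun i => by rw [Subsingleton.elim i 0, h]⟩
  rw [one_apply, Fintype.sum_bool]
  simp only [conjTranspose_apply, hadamardOp, hxy, div_eq_mul_inv, ← ha, star_mul', h1]
  cases x 0 <;> cases y 0 <;> simp [h2] <;> norm_num

theorem tOp_conjTranspose_mul : tOpᴴ * tOp = 1 := by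
  rw [tOp, diagonal_conjTranspose, diagonal_mul_diagonal, ← diagonal_one]
  congr 1
  funext x
  simp only [Pi.star_apply]
  split_ifs
  · rw [Complex.star_def, ← Complex.exp_conj, ← Complex.exp_add, map_div₀, map_mul,
      Complex.conj_I, Complex.conj_ofReal, map_ofNat]
    ring_nf
    exact Complex.exp_zero
  · simp

theorem cnotOp_conjTranspose_mul : cnotOpᴴ * cnotOp = 1 := by
  ext x y
  rw [mul_apply, Fintype.sum_equiv (finTwoArrowEquiv Bool) _
    (fun b => cnotOpᴴ x ![b.1, b.2] * cnotOp ![b.1, b.2] y) fun z => by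
      rw [show z = ![z 0, z 1] from funext fun i => by fin_cases i <;> rfl]
      rfl]
  have hxy : x = y ↔ x 0 = y 0 ∧ x 1 = y 1 :=
    ⟨fun h => by rw [h]; exact ⟨rfl, rfl⟩, fun h => funext fun i => by
      fin_cases i
      · exact h.1
      · exact h.2⟩
  rw [one_apply, Fintype.sum_prod_type, Fintype.sum_bool, Fintype.sum_bool, Fintype.sum_bool]
  simp only [conjTranspose_apply, cnotOp, hxy]
  cases x 0 <;> cases x 1 <;> cases y 0 <;> cases y 1 <;> simp

theorem Gate.op_conjTranspose_mul {N : ℕ} (g : Gate N) : g.opᴴ * g.op = 1 := by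
  cases g with
  | hadamard e =>
    rw [op, ← liftOp_conjTranspose, ← liftOp_mul, hadamardOp_conjTranspose_mul, liftOp_one]
  | tgate e => rw [op, ← liftOp_conjTranspose, ← liftOp_mul, tOp_conjTranspose_mul, liftOp_one]
  | cnot e => rw [op, ← liftOp_conjTranspose, ← liftOp_mul, cnotOp_conjTranspose_mul, liftOp_one]
  | arbitrary U => exact U.2.1

theorem sandwich_posSemidef {n : Type} [Fintype n] [DecidableEq n] (K : Op n) {ρ : Op n}
    (hρ : ρ.PosSemidef) : (sandwich K ρ).PosSemidef := hρ.mul_mul_conjTranspose_same K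

theorem Gate.trace_sandwich {N : ℕ} (g : Gate N) (ρ : Op (Fin N)) :
    (sandwich g.op ρ).trace.re = ρ.trace.re := by
  rw [← ev_one, sandwich, ev_conj, Matrix.mul_one, g.op_conjTranspose_mul, ev_one]

theorem trace_sandwich_measure {N : ℕ} (i : Fin N) (ρ : Op (Fin N)) :
    (sandwich (measure i false) ρ).trace.re + (sandwich (measure i true) ρ).trace.re =
      ρ.trace.re := by
  have h : ∀ b, (measure i b)ᴴ * measure i b = measure i b := by
    intro b
    rw [measure, diagonal_conjTranspose, diagonal_mul_diagonal]
    congr 1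
    funext x
    simp only [Pi.star_apply]
    split_ifs <;> simp
  have h1 : measure i false + measure i true = 1 := by
    rw [measure, measure, diagonal_add, ← diagonal_one]
    congr 1
    funext x
    cases x i <;> simp
  rw [← ev_one, sandwich, ev_conj, Matrix.mul_one, h, ← ev_one (sandwich _ _), sandwich, ev_conj,
    Matrix.mul_one, h, ← ev_add_left, h1, ev_one]

end Gates

/-! ### Programs as transformers of continuations -/

section Values

variable {N : ℕ} {Q Q' T T' : Type}

/-- The sum of the continuation `k` over the branches of a list of commands. -/
def blockValue (O : Oracle N Q T) (cmds : List (Cmd N Q)) (k : Branch N T → ℝ)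
    (b : Branch N T) : ℝ := ((execBlock O cmds b).map k).sum

/-- The sum of the continuation `k` over the branches of a program. -/
def progValue (O : Oracle N Q T) (p : Prog N Q) (k : Branch N T → ℝ) (b : Branch N T) : ℝ :=
  ((p.foldl (fun L block => L.flatMap (execGuarded O block)) [b]).map k).sum

variable (O : Oracle N Q T) (k : Branch N T → ℝ) (b : Branch N T)

theorem blockValue_nil : blockValue O [] k b = k b := by simp [blockValue, execBlock]

theorem blockValue_cons (cmd : Cmd N Q) (cmds : List (Cmd N Q)) :
    blockValue O (cmd :: cmds) k b =
      if b.halted then blockValue O cmds k b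
      else ((cmd.exec O b).map (blockValue O cmds k)).sum := by
  unfold blockValue execBlock
  rw [List.foldl_cons, foldl_flatMap, sum_map_flatMap, List.flatMap_singleton]
  split_ifs <;> simp

theorem blockValue_halted (cmds : List (Cmd N Q)) (h : b.halted = true) :
    blockValue O cmds k b = k b := by
  induction cmds with
  | nil => exact blockValue_nil O k b
  | cons cmd cmds ih => rw [blockValue_cons, if_pos h, ih]

theorem blockValue_append (cmds cmds' : List (Cmd N Q)) :
    blockValue O (cmds ++ cmds') k = blockValue O cmds (blockValue O cmds' k) := by
  induction cmds with
  | nil =>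
    funext b
    rw [List.nil_append, blockValue_nil]
  | cons cmd cmds ih =>
    funext b
    rw [List.cons_append, blockValue_cons, blockValue_cons, ih]

theorem blockValue_singleton (cmd : Cmd N Q) (h : b.halted = false) :
    blockValue O [cmd] k b = ((cmd.exec O b).map k).sum := by
  rw [blockValue_cons, if_neg (by simp [h])]
  exact congrArg List.sum (List.map_congr_left fun a _ => blockValue_nil O k a)

theorem progValue_nil (p : Branch N T → ℝ) : progValue O [] p b = p b := by simp [progValue]

theorem progValue_cons (block : Option (Fin N) × List (Cmd N Q)) (p : Prog N Q) :
    progValue O (block :: p) k b = ((execGuarded O block b).map (progValue O p k)).sum := by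
  unfold progValue
  rw [List.foldl_cons, foldl_flatMap, sum_map_flatMap, List.flatMap_singleton]

/-- The branch after the result `r` of a measurement of qubit `i`. -/
def Branch.measured (b : Branch N T) (i : Fin N) (r : Bool) : Branch N T :=
  { b with state := sandwich (measure i r) b.state }

theorem progValue_cons_some (i : Fin N) (cmds : List (Cmd N Q)) (p : Prog N Q) :
    progValue O ((some i, cmds) :: p) k b =
      if b.halted then progValue O p k b
      else progValue O p k (b.measured i false) +
        blockValue O cmds (progValue O p k) (b.measured i true) := by
  rw [progValue_cons, execGuarded]
  split_ifs
  · simp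
  · rfl

theorem progValue_cons_none (cmds : List (Cmd N Q)) (p : Prog N Q) :
    progValue O ((none, cmds) :: p) k b = blockValue O cmds (progValue O p k) b := by
  rw [progValue_cons, execGuarded]
  split_ifs with h
  · rw [blockValue_halted _ _ _ _ h]
    simp
  · rfl

/-- Replace each command by a list of commands. -/
def translate (f : Cmd N Q → List (Cmd N Q')) (p : Prog N Q) : Prog N Q' :=
  p.map fun block => (block.1, block.2.flatMap f)

/-- A relation between continuations that commands and measurements preserve is preserved by
programs. -/
theorem progValue_translate (O' : Oracle N Q' T') (f : Cmd N Q → List (Cmd N Q'))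
    (P : (Branch N T → ℝ) → (Branch N T' → ℝ) → Prop) (p : Prog N Q)
    (hcmd : ∀ block ∈ p, ∀ cmd ∈ block.2, ∀ k k', P k k' →
      P (blockValue O [cmd] k) (blockValue O' (f cmd) k'))
    (hmeasure : ∀ (i : Fin N) k₀ k₀' k₁ k₁', P k₀ k₀' → P k₁ k₁' →
      P (fun b => if b.halted then k₀ b else k₀ (b.measured i false) + k₁ (b.measured i true))
        (fun b => if b.halted then k₀' b else k₀' (b.measured i false) + k₁' (b.measured i true)))
    {k : Branch N T → ℝ} {k' : Branch N T' → ℝ} (hk : P k k') :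
    P (progValue O p k) (progValue O' (translate f p) k') := by
  induction p with
  | nil =>
    have h1 : progValue O [] k = k := funext fun b => progValue_nil O b k
    have h2 : progValue O' (translate f []) k' = k' := funext fun b => progValue_nil O' b k'
    rwa [h1, h2]
  | cons block p ih =>
    have ih' := ih fun b hb => hcmd b (List.mem_cons_of_mem _ hb)
    obtain ⟨o, cmds⟩ := block
    have hc := hcmd (o, cmds) List.mem_cons_self
    clear hcmd ih
    have h1 : P (blockValue O cmds (progValue O p k))
        (blockValue O' (cmds.flatMap f) (progValue O' (translate f p) k')) := by
      induction cmds with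
      | nil =>
        have h1 := funext fun b => blockValue_nil O (progValue O p k) b
        have h2 := funext fun b => blockValue_nil O' (progValue O' (translate f p) k') b
        rw [h1, List.flatMap_nil, h2]
        exact ih'
      | cons cmd cmds ih =>
        have h1 := blockValue_append O (progValue O p k) [cmd] cmds
        rw [List.singleton_append] at h1
        rw [h1, List.flatMap_cons, blockValue_append]
        exact hc cmd List.mem_cons_self _ _ (ih fun c hc' => hc c (List.mem_cons_of_mem _ hc'))
    cases o with
    | none =>
      have e1 := funext fun b => progValue_cons_none O k b cmds p
      have e2 := funext fun b => progValue_cons_none O' k' b (cmds.flatMap f) (translate f p)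
      rw [e1]
      change P _ (progValue O' ((none, cmds.flatMap f) :: translate f p) k')
      rw [e2]
      exact h1
    | some i =>
      have e1 := funext fun b => progValue_cons_some O k b i cmds p
      have e2 := funext fun b => progValue_cons_some O' k' b i (cmds.flatMap f) (translate f p)
      rw [e1]
      change P _ (progValue O' ((some i, cmds.flatMap f) :: translate f p) k')
      rw [e2]
      exact hmeasure i _ _ _ _ ih' h1

/-- The diagonal case of `progValue_translate`: commands are translated to themselves and the second
continuation plays no role. -/
theorem progValue_induction (P : (Branch N T → ℝ) → Prop) (p : Prog N Q)
    (hcmd : ∀ cmd k, P k → P (blockValue O [cmd] k))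
    (hmeasure : ∀ (i : Fin N) k₀ k₁, P k₀ → P k₁ →
      P (fun b => if b.halted then k₀ b else k₀ (b.measured i false) + k₁ (b.measured i true)))
    {k : Branch N T → ℝ} (hk : P k) : P (progValue O p k) :=
  progValue_translate O O (fun cmd => [cmd]) (fun k _ => P k) p
    (fun _ _ cmd _ k _ h => hcmd cmd k h) (fun i k₀ _ k₁ _ => hmeasure i k₀ k₁) (k' := k) hk

/-- The oracle maps states to ensembles of states with the same total trace. -/
def Oracle.TracePreserving (O : Oracle N Q T) : Prop :=
  ∀ q l ρ, ρ.PosSemidef → (∀ b ∈ O q l ρ, b.state.PosSemidef) ∧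
    ((O q l ρ).map fun b => b.state.trace.re).sum = ρ.trace.re

variable {O}

theorem Oracle.TracePreserving.exec (hO : O.TracePreserving) {b : Branch N T}
    (hb : b.state.PosSemidef) (cmd : Cmd N Q) :
    (∀ a ∈ cmd.exec O b, a.state.PosSemidef) ∧
      ((cmd.exec O b).map fun a => a.state.trace.re).sum = b.state.trace.re := by
  cases cmd with
  | gate g =>
    simp only [Cmd.exec, List.mem_singleton, forall_eq, List.map_cons, List.map_nil,
      List.sum_cons, List.sum_nil, add_zero]
    exact ⟨sandwich_posSemidef _ hb, g.trace_sandwich _⟩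
  | query q => exact hO q b.log b.state hb
  | halt =>
    simp only [Cmd.exec, List.mem_singleton, forall_eq, List.map_cons, List.map_nil,
      List.sum_cons, List.sum_nil, add_zero]
    exact ⟨hb, trivial⟩

/-- An upper bound in terms of the trace is preserved by programs. -/
theorem Oracle.TracePreserving.progValue_le (hO : O.TracePreserving) (p : Prog N Q) {d : ℝ}
    {k : Branch N T → ℝ} (hk : ∀ b, b.state.PosSemidef → k b ≤ d * b.state.trace.re) :
    ∀ b, b.state.PosSemidef → progValue O p k b ≤ d * b.state.trace.re := by
  refine progValue_induction O (fun k => ∀ b, b.state.PosSemidef → k b ≤ d * b.state.trace.re) p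
    (fun cmd k hk b hb => ?_) (fun i k₀ k₁ h₀ h₁ b hb => ?_) hk
  · by_cases h : b.halted = true
    · rw [blockValue_halted _ _ _ _ h]
      exact hk b hb
    · obtain ⟨h1, h2⟩ := hO.exec hb cmd
      rw [blockValue_singleton _ _ _ _ (by simpa using h), ← h2, ← List.sum_map_mul_left]
      exact List.sum_le_sum fun a ha => hk a (h1 a ha)
  · dsimp only
    split_ifs
    · exact h₀ b hb
    · rw [← trace_sandwich_measure i b.state, mul_add]
      exact add_le_add (h₀ _ (sandwich_posSemidef _ hb)) (h₁ _ (sandwich_posSemidef _ hb))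

theorem Oracle.TracePreserving.execGuarded_posSemidef (hO : O.TracePreserving)
    (block : Option (Fin N) × List (Cmd N Q)) {b : Branch N T} (hb : b.state.PosSemidef) :
    ∀ a ∈ execGuarded O block b, a.state.PosSemidef := by
  have key : ∀ (cmds : List (Cmd N Q)) (b : Branch N T), b.state.PosSemidef →
      ∀ a ∈ execBlock O cmds b, a.state.PosSemidef := by
    intro cmds
    induction cmds with
    | nil =>
      intro b hb a ha
      rw [execBlock, List.foldl_nil, List.mem_singleton] at ha
      rwa [ha]
    | cons cmd cmds ih =>
      intro b hb a ha
      rw [execBlock, List.foldl_cons, foldl_flatMap, List.flatMap_singleton,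
        List.mem_flatMap] at ha
      obtain ⟨a', ha', ha⟩ := ha
      refine ih a' ?_ a ha
      split_ifs at ha'
      · rw [List.mem_singleton.mp ha']
        exact hb
      · exact (hO.exec hb cmd).1 a' ha'
  unfold execGuarded
  split_ifs
  · intro a ha
    rwa [List.mem_singleton.mp ha]
  · obtain ⟨o, cmds⟩ := block
    cases o with
    | none => exact key cmds b hb
    | some i =>
      intro a ha
      rcases List.mem_cons.mp ha with rfl | ha
      · exact sandwich_posSemidef _ hb
      · exact key cmds _ (sandwich_posSemidef _ hb) a ha

theorem pure_zeroKet_posSemidef {α : Type} [Fintype α] [DecidableEq α] :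
    (pure (zeroKet : Vec α)).PosSemidef := posSemidef_vecMulVec_self_star _

theorem trace_pure_zeroKet {α : Type} [Fintype α] [DecidableEq α] :
    (pure (zeroKet : Vec α)).trace.re = 1 := by
  rw [pure, trace_vecMulVec, dotProduct_comm, zeroKet, dotProduct_of_normalised (ket_normalised _)]
  rfl

theorem Oracle.TracePreserving.prog_exec_posSemidef (hO : O.TracePreserving) (p : Prog N Q)
    (l : T) : ∀ a ∈ p.exec O l, a.state.PosSemidef := by
  have key : ∀ (p : Prog N Q) (b : Branch N T), b.state.PosSemidef →
      ∀ a ∈ p.foldl (fun L block => L.flatMap (execGuarded O block)) [b],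
        a.state.PosSemidef := by
    intro p
    induction p with
    | nil =>
      intro b hb a ha
      rw [List.foldl_nil, List.mem_singleton] at ha
      rwa [ha]
    | cons block p ih =>
      intro b hb a ha
      rw [List.foldl_cons, foldl_flatMap, List.flatMap_singleton, List.mem_flatMap] at ha
      obtain ⟨a', ha', ha⟩ := ha
      exact ih a' (hO.execGuarded_posSemidef block hb a' ha') a ha
  exact key p _ pure_zeroKet_posSemidef

end Values

/-! ### The oracles preserve the trace -/

section OracleTrace

theorem PrivateCoinScheme.forgeOracle_tracePreserving (S : PrivateCoinScheme) {lam : ℕ}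
    (sk : S.Key lam) (N : ℕ) : (S.forgeOracle sk N).TracePreserving := by
  intro q l ρ hρ
  cases q with
  | mint e =>
    simp only [forgeOracle, List.mem_singleton, forall_eq, List.map_cons, List.map_nil,
      List.sum_cons, List.sum_nil, add_zero]
    exact ⟨replace_posSemidef e _ hρ, trace_replace e (S.coin_normalised lam sk) ρ⟩
  | count r coins b out =>
    constructor
    · intro a ha
      obtain ⟨a', ha', rfl⟩ := List.mem_map.mp ha
      exact writeUnary_posSemidef _ _ (privCount_posSemidef S sk coins hρ a' ha')
    · simp only [forgeOracle, List.map_map, Function.comp_def, trace_writeUnary]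
      have := trace_privCount S sk coins ρ fun _ => 1
      rw [sector_one, liftOp_one, ev_one] at this
      simpa only [one_mul] using this

theorem PublicCoinScheme.forgeOracle_tracePreserving (P : PublicCoinScheme) {lam : ℕ}
    (sk : P.Key lam) (N : ℕ) : (P.forgeOracle sk N).TracePreserving := by
  intro q l ρ hρ
  cases q with
  | priv q => exact P.toPrivateCoinScheme.forgeOracle_tracePreserving sk N q l ρ hρ
  | count r coins b out =>
    constructor
    · intro a ha
      obtain ⟨a', ha', rfl⟩ := List.mem_map.mp ha
      exact writeUnary_posSemidef _ _ (replace_posSemidef _ _ (discard_posSemidef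
        (walletCount_posSemidef P _ (adjoin_posSemidef hρ _) a' ha')))
    · simp only [forgeOracle, List.map_map, Function.comp_def, trace_writeUnary,
        trace_replace coins (ket_normalised _), zeroKet, trace_discard]
      have := ev_walletCount P (walletCoins coins) (adjoin ρ (P.coin lam sk)) 1
        (fun _ _ => Commute.one_left _) fun _ _ => Commute.one_left _
      simp only [ev_one] at this
      rw [trace_adjoin _ (P.coin_normalised lam sk)] at this
      exact this

theorem PublicCoinScheme.sabotageOracle_tracePreserving (P : PublicCoinScheme) {lam : ℕ}
    (sk : P.Key lam) (N : ℕ) : (P.sabotageOracle sk N).TracePreserving := by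
  intro q l ρ hρ
  cases q with
  | mint e =>
    simp only [sabotageOracle, List.mem_singleton, forall_eq, List.map_cons, List.map_nil,
      List.sum_cons, List.sum_nil, add_zero]
    exact ⟨replace_posSemidef e _ hρ, trace_replace e (P.coin_normalised lam sk) ρ⟩
  | verify e out =>
    have h1 := replace_liftOp_mul_posSemidef e zeroKet (P.verify_nonneg lam sk) hρ
    have h2 := replace_liftOp_mul_posSemidef e zeroKet (P.verify_le_one lam sk) hρ
    simp only [sabotageOracle, PrivateCoinScheme.verifyDestroy, List.map_cons, List.map_nil,
      List.sum_cons, List.sum_nil, add_zero, if_true, Bool.false_eq_true, if_false,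
      List.mem_cons, List.not_mem_nil, or_false, forall_eq_or_imp, forall_eq, trace_writeUnary]
    refine ⟨⟨writeUnary_posSemidef _ _ (replace_posSemidef _ _ h1),
      writeUnary_posSemidef _ _ h2⟩, ?_⟩
    rw [trace_replace e (P.coin_normalised lam sk), zeroKet, trace_replace e (ket_normalised _),
      trace_replace e (ket_normalised _)]
    change ev _ ρ + ev _ ρ = _
    rw [← ev_add_left, ← liftOp_add, add_sub_cancel, liftOp_one, ev_one]
  | submit s =>
    simp only [sabotageOracle, List.mem_singleton, forall_eq, List.map_cons, List.map_nil,
      List.sum_cons, List.sum_nil, add_zero]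
    exact ⟨hρ, trivial⟩

end OracleTrace

/-! ### Averages over the keys -/

section KeyAverage

variable (S : PrivateCoinScheme) {lam : ℕ}

theorem PrivateCoinScheme.keyAverage_le {f h : S.Key lam → ℝ} {C d : ℝ} (hC : 0 ≤ C) (hd : 0 ≤ d)
    (h0 : ∀ sk, 0 ≤ h sk) (h1 : ∀ sk, h sk ≤ 1)
    (hf : ∀ sk ∈ (S.keyGen lam).support, f sk ≤ C * h sk + d) :
    S.keyAverage lam f ≤ C * S.keyAverage lam h + d := by
  have hs : Summable fun sk => (S.keyGen lam sk).toReal :=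
    ENNReal.summable_toReal (S.keyGen lam).tsum_coe_ne_top
  have hs1 : ∑' sk, (S.keyGen lam sk).toReal = 1 := by
    rw [← ENNReal.tsum_toReal_eq fun sk => (S.keyGen lam).apply_ne_top sk,
      (S.keyGen lam).tsum_coe, ENNReal.toReal_one]
  have hh : Summable fun sk => (S.keyGen lam sk).toReal * h sk :=
    Summable.of_nonneg_of_le (fun sk => mul_nonneg ENNReal.toReal_nonneg (h0 sk))
      (fun sk => mul_le_of_le_one_right ENNReal.toReal_nonneg (h1 sk)) hs
  have hh0 : 0 ≤ S.keyAverage lam h :=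
    tsum_nonneg fun sk => mul_nonneg ENNReal.toReal_nonneg (h0 sk)
  by_cases hfs : Summable fun sk => (S.keyGen lam sk).toReal * f sk
  · unfold keyAverage
    rw [← tsum_mul_left, ← mul_one d, ← hs1, ← tsum_mul_left,
      ← (hh.mul_left C).tsum_add (hs.mul_left d)]
    refine hfs.tsum_le_tsum (fun sk => ?_) ((hh.mul_left C).add (hs.mul_left d))
    by_cases hsk : sk ∈ (S.keyGen lam).support
    · calc _ ≤ (S.keyGen lam sk).toReal * (C * h sk + d) :=
            mul_le_mul_of_nonneg_left (hf sk hsk) ENNReal.toReal_nonneg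
        _ = _ := by ring
    · rw [PMF.mem_support_iff, not_not] at hsk
      simp [hsk]
  -- A divergent sum has the value 0 by convention, and the right-hand side is nonnegative.
  · unfold keyAverage
    rw [tsum_eq_zero_of_not_summable hfs]
    exact add_nonneg (mul_nonneg hC hh0) hd

theorem PrivateCoinScheme.eq_zero_of_keyAverage_eq_zero {f : S.Key lam → ℝ} (h0 : ∀ sk, 0 ≤ f sk)
    (h1 : ∀ sk, f sk ≤ 1) (hf : S.keyAverage lam f = 0) :
    ∀ sk ∈ (S.keyGen lam).support, f sk = 0 := by
  have hs : Summable fun sk => (S.keyGen lam sk).toReal * f sk :=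
    Summable.of_nonneg_of_le (fun sk => mul_nonneg ENNReal.toReal_nonneg (h0 sk))
      (fun sk => mul_le_of_le_one_right ENNReal.toReal_nonneg (h1 sk))
      (ENNReal.summable_toReal (S.keyGen lam).tsum_coe_ne_top)
  intro sk hsk
  have h := (hs.hasSum_iff.mpr hf)
  rw [hasSum_zero_iff_of_nonneg fun sk => mul_nonneg ENNReal.toReal_nonneg (h0 sk)] at h
  have h2 : (S.keyGen lam sk).toReal ≠ 0 :=
    ENNReal.toReal_ne_zero.mpr ⟨hsk, (S.keyGen lam).apply_ne_top sk⟩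
  exact (mul_eq_zero.mp (congrFun h sk)).resolve_left h2

/-- Equality in Cauchy–Schwarz: completeness says that the overlap `a` of the coin with `ψ` has
modulus one, so the coin is `a • ψ`, and the phase drops out of the projector. -/
theorem PrivateCoinScheme.verify_eq_pure_coin (hcomplete : S.Complete)
    (hrank : S.RankOneProjective) {sk : S.Key lam} (hsk : sk ∈ (S.keyGen lam).support) :
    S.verify lam sk = pure (S.coin lam sk) := by
  obtain ⟨ψ, hψ, hv⟩ := hrank lam sk hsk
  have h := hcomplete lam sk hsk
  have hφ := dotProduct_of_normalised (S.coin_normalised lam sk)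
  have hψ' := dotProduct_of_normalised hψ
  set φ := S.coin lam sk
  set a := star ψ ⬝ᵥ φ with ha
  have hva : pure ψ *ᵥ φ = a • ψ := by
    rw [pure, vecMulVec_mulVec, ← ha]
    simp
  have hstar : star φ ⬝ᵥ ψ = star a := by
    rw [ha, star_dotProduct]
  rw [hv, hva, dotProduct_smul, hstar, smul_eq_mul] at h
  have hz : φ - a • ψ = 0 := by
    rw [← dotProduct_star_self_eq_zero, star_sub, star_smul, sub_dotProduct,
      dotProduct_sub, dotProduct_sub, smul_dotProduct, smul_dotProduct, dotProduct_smul,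
      dotProduct_smul, hφ, hψ', hstar, ← ha]
    simp only [smul_eq_mul]
    linear_combination -(h)
  rw [hv, sub_eq_zero.mp hz, pure, pure, star_smul, smul_vecMulVec, vecMulVec_smul, smul_smul, h,
    one_smul]

end KeyAverage

/-! ### Negligible functions -/

section Negligible

open Filter Asymptotics

/-- Decay is an asymptotic property, so the bounding function may be changed at the finitely many
exceptional parameters. -/
theorem AtMostNegligible.of_eventually {f ε : ℕ → ℝ}
    (hε : SuperpolynomialDecay atTop (fun lam : ℕ => (lam : ℝ)) ε)
    (h : ∀ᶠ lam in atTop, f lam ≤ ε lam) :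
    AtMostNegligible f := by
  classical
  refine ⟨fun lam => if f lam ≤ ε lam then ε lam else f lam, ?_, fun lam => ?_⟩
  · refine hε.congr' ?_
    filter_upwards [h] with lam hlam
    rw [if_pos hlam]
  · dsimp only
    split_ifs with hlam
    · exact hlam
    · exact le_rfl

theorem tendsto_kappa {c : ℝ} (hc : 1 < c) : Tendsto (kappa c) atTop atTop := by
  have h1 : Tendsto (fun lam : ℕ => Real.logb 2 lam) atTop atTop :=
    (Real.tendsto_logb_atTop one_lt_two).comp tendsto_natCast_atTop_atTop
  exact tendsto_nat_ceil_atTop.comp ((tendsto_rpow_atTop (by linarith)).comp h1)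

/-- The only place where `c > 1` is decisive: the extra factor `(log λ) ^ (c - 1)` exceeds any
constant. -/
theorem eventually_mul_logb_le_kappa {c : ℝ} (hc : 1 < c) (n : ℕ) :
    ∀ᶠ lam : ℕ in atTop, n * Real.logb 2 lam ≤ kappa c lam := by
  have h1 : Tendsto (fun lam : ℕ => Real.logb 2 lam) atTop atTop :=
    (Real.tendsto_logb_atTop one_lt_two).comp tendsto_natCast_atTop_atTop
  have h2 : Tendsto (fun lam : ℕ => Real.logb 2 lam ^ (c - 1)) atTop atTop :=
    (tendsto_rpow_atTop (by linarith)).comp h1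
  filter_upwards [h1.eventually_gt_atTop 0, h2.eventually_ge_atTop (n : ℝ)] with lam h3 h4
  refine le_trans ?_ (Nat.le_ceil _)
  calc n * Real.logb 2 lam ≤ Real.logb 2 lam ^ (c - 1) * Real.logb 2 lam :=
        mul_le_mul_of_nonneg_right h4 h3.le
    _ = Real.logb 2 lam ^ c := by
        rw [← Real.rpow_add_one h3.ne']
        congr 1
        ring

theorem superpolynomialDecay_two_pow_kappa {c : ℝ} (hc : 1 < c) :
    SuperpolynomialDecay atTop (fun lam : ℕ => (lam : ℝ)) fun lam => 2 * (1 / 2) ^ kappa c lam := by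
  intro n
  have h0 : Tendsto (fun lam : ℕ => 2 * ((lam : ℝ))⁻¹) atTop (nhds 0) := by
    simpa using (tendsto_inv_atTop_nhds_zero_nat (𝕜 := ℝ)).const_mul 2
  refine squeeze_zero' (Eventually.of_forall fun lam => by positivity) ?_ h0
  filter_upwards [eventually_mul_logb_le_kappa hc (n + 1), eventually_gt_atTop 0] with lam h hlam
  have hlam' : (0 : ℝ) < lam := by exact_mod_cast hlam
  -- One power more than required, so that the product is not just bounded but tends to zero.
  have h1 : (lam : ℝ) ^ (n + 1) ≤ 2 ^ kappa c lam := by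
    rw [← Real.rpow_natCast 2, ← Real.logb_le_iff_le_rpow one_lt_two (by positivity),
      Real.logb_pow]
    exact_mod_cast h
  have h2 : (lam : ℝ) ^ n * (1 / 2) ^ kappa c lam ≤ (lam : ℝ)⁻¹ := by
    rw [one_div, inv_pow, ← div_eq_mul_inv, div_le_iff₀ (by positivity), ← div_eq_inv_mul,
      le_div_iff₀ hlam']
    simpa [pow_succ] using h1
  linarith

/-- Needed for the polynomial cost of the reduction. Powers of the logarithm are `o(λ)`, and the
constant absorbs the finitely many small parameters. -/
theorem exists_kappa_le (c : ℝ) : ∃ K : ℕ, ∀ lam, kappa c lam ≤ lam + K := by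
  have h1 : (fun x : ℝ => Real.log x ^ c) =o[atTop] fun x => x := by
    simpa using isLittleO_log_rpow_rpow_atTop c one_pos
  have h2 : ∀ᶠ lam : ℕ in atTop, kappa c lam ≤ lam := by
    have h3 := (h1.comp_tendsto (tendsto_natCast_atTop_atTop (R := ℝ))).bound
      (c := Real.log 2 ^ c) (Real.rpow_pos_of_pos (Real.log_pos one_lt_two) c)
    filter_upwards [h3, eventually_ge_atTop 1] with lam h4 h5
    have h6 : 0 ≤ Real.log lam := Real.log_natCast_nonneg lam
    rw [Function.comp, Function.comp, Real.norm_of_nonneg (Real.rpow_nonneg h6 c),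
      Real.norm_of_nonneg (Nat.cast_nonneg lam)] at h4
    refine Nat.ceil_le.mpr ?_
    rw [Real.logb, Real.div_rpow h6 (Real.log_nonneg one_le_two), div_le_iff₀'
      (Real.rpow_pos_of_pos (Real.log_pos one_lt_two) c)]
    exact h4
  obtain ⟨M, hM⟩ := eventually_atTop.mp h2
  refine ⟨∑ lam ∈ Finset.range M, kappa c lam, fun lam => ?_⟩
  rcases le_or_gt M lam with h | h
  · exact (hM lam h).trans (Nat.le_add_right _ _)
  · exact (Finset.single_le_sum (f := kappa c) (fun _ _ => Nat.zero_le _)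
      (Finset.mem_range.mpr h)).trans (Nat.le_add_left _ _)

end Negligible

/-! ### Security against sabotage -/

section Sabotage

variable (S : PrivateCoinScheme) {c : ℝ}

/-- The loss is bounded for each submitted state in proportion to its trace, and the attack
preserves the total trace, so the same bound holds for the whole game. The threshold 18 is
eventually passed. -/
theorem sabotageExpectation_atMostNegligible (hcomplete : S.Complete) (hrank : S.RankOneProjective)
    (hc : 1 < c) (A : (PkQC S c).Saboteur)
    (v : ∀ lam, S.Key lam → Submission (Fin (kappa c lam) × S.Qub lam) (A.qubits lam) →
      Op (Fin (A.qubits lam)) → ℝ)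
    (hloss : ∀ lam sk s ρ, 18 ≤ kappa c lam → S.verify lam sk = pure (S.coin lam sk) →
      ρ.PosSemidef → v lam sk s ρ ≤ 2 * (1 / 2) ^ kappa c lam * ρ.trace.re) :
    AtMostNegligible fun lam => (PkQC S c).sabotageExpectation A lam (v lam) := by
  refine .of_eventually (superpolynomialDecay_two_pow_kappa hc) ?_
  filter_upwards [(tendsto_kappa hc).eventually_ge_atTop 18] with lam hlam
  have h := S.keyAverage_le (lam := lam) (C := 0) (h := fun _ => 0) (d := 2 * (1 / 2) ^ kappa c lam)
    (f := fun sk => total (Prog.exec ((PkQC S c).sabotageOracle sk (A.qubits lam))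
      (Submission.empty _ _) (A.prog lam)) (v lam sk))
    le_rfl (by positivity) (fun _ => le_rfl) (fun _ => zero_le_one) fun sk hsk => by
      have := ((PkQC S c).sabotageOracle_tracePreserving sk (A.qubits lam)).progValue_le
        (A.prog lam) (k := fun b => v lam sk b.log b.state) (d := 2 * (1 / 2) ^ kappa c lam)
        (fun b hb => hloss lam sk b.log b.state hlam (S.verify_eq_pure_coin hcomplete hrank hsk) hb)
        ⟨false, Submission.empty _ _, pure zeroKet⟩ pure_zeroKet_posSemidef
      rw [trace_pure_zeroKet, mul_one] at this
      rw [zero_mul, zero_add]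
      exact this
  rw [zero_mul, zero_add] at h
  exact h

theorem secureAgainstPrivateSabotage (hcomplete : S.Complete) (hrank : S.RankOneProjective)
    (hc : 1 < c) (M : Model) : (PkQC S c).SecureAgainstPrivateSabotage M := fun A _ =>
  sabotageExpectation_atMostNegligible S hcomplete hrank hc A
    (fun _ sk s ρ => (PkQC S c).privateLoss sk s ρ) fun _ sk s _ hk hv hρ =>
      privateLoss_le S c sk hv (by omega) s hρ

theorem secureAgainstPublicSabotage (hcomplete : S.Complete) (hrank : S.RankOneProjective)
    (hc : 1 < c) (M : Model) : (PkQC S c).SecureAgainstPublicSabotage M := fun _ _ n _ A _ _ =>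
  sabotageExpectation_atMostNegligible S hcomplete hrank hc A
    (fun lam sk s ρ => (PkQC S c).publicLoss sk (n lam) s ρ) fun lam sk s _ hk hv hρ =>
      publicLoss_le S c sk hv hk (n lam) s hρ

end Sabotage

/-! ### The reduction to the unforgeability of the private scheme -/

section Reduction

/-- The private coins in the coins `e`, numbered consecutively. -/
def flattenCoins {ι Q : Type} {r k : ℕ} (e : Fin r × (Fin k × Q) ↪ ι) : Fin (r * k) × Q ↪ ι :=
  (regMap Q (finProdFinEquiv (m := r) (n := k)).symm.toEmbedding).trans (privateRegs e)

theorem liftOp_flattenCoins_sector {ι Q : Type} [Fintype ι] [DecidableEq ι] [Fintype Q]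
    [DecidableEq Q] {r k : ℕ} (e : Fin r × (Fin k × Q) ↪ ι) {E : Op Q} (hE : E * E = E)
    (f : ℕ → ℝ) :
    liftOp (flattenCoins e) (sector _ E f) = liftOp (privateRegs e) (sector _ E f) := by
  have h := sector_mul_allOn_of_compl hE (finProdFinEquiv (m := r) (n := k)).symm.toEmbedding ∅
    (fun v => by simp) f
  rw [allOn_empty, Matrix.mul_one, Matrix.mul_one, Finset.card_empty] at h
  simp only [zero_add] at h
  rw [h, flattenCoins, liftOp_trans]

theorem excess_nonneg {ι Q : Type} [Fintype ι] [DecidableEq ι] [Fintype Q] [DecidableEq Q]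
    {r k : ℕ} (e : Fin r × (Fin k × Q) ↪ ι) {ψ : Vec Q} (hψ : ∑ x, ‖ψ x‖ ^ 2 = 1) (x : ℕ)
    {ρ : Op ι} (hρ : ρ.PosSemidef) : 0 ≤ excess e ψ x ρ := by
  have h := ev_sector_le (privateRegs e) hψ hρ (f := fun t => 0 * 1)
    (g := fun j => if x < j then 1 else 0) fun t _ => by split_ifs <;> simp
  rw [sector_smul, zero_smul, liftOp_zero, ev_zero_left] at h
  exact h

/-- Mint each private coin of a public coin, and stop after the first count. -/
def reduceCmd {N k : ℕ} {Q : Type} :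
    Cmd N (PubForgeQuery (Fin k × Q) N) → List (Cmd N (PrivForgeQuery Q N))
  | .gate g => [.gate g]
  | .halt => [.halt]
  | .query (.priv (.mint e)) => (List.finRange k).map fun i => .query (.mint (coinAt e i))
  | .query (.priv (.count r e _ _)) =>
      [.query (.count (r * k) (flattenCoins e) 0 .ofIsEmpty), .halt]
  | .query (.count r e _ _) =>
      [.query (.count (r * k) (flattenCoins e) 0 .ofIsEmpty), .halt]

variable (S : PrivateCoinScheme) (c : ℝ)

/-- The forger of the private scheme obtained from a forger of the public scheme. -/
def reduction (A : (PkQC S c).Forger) : S.Forger where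
  qubits := A.qubits
  prog lam := translate (reduceCmd (k := kappa c lam) (Q := S.Qub lam)) (A.prog lam)

/-- The number of coins submitted by a command. -/
def Cmd.countSize {N : ℕ} {W : Type} : Cmd N (PubForgeQuery W N) → ℕ
  | .query (.priv (.count r _ _ _)) => r
  | .query (.count r _ _ _) => r
  | _ => 0

/-- The all-or-nothing utility if there was at most one count, and a lower bound otherwise. -/
def ForgeLog.capped (l : ForgeLog) : ℝ := if l.queries ≤ 1 then l.allOrNothing else -l.n

/-- Relates the continuations of a forger of the public scheme to those of its reduction. -/
structure Simulation {N : ℕ} (κ : ℕ) (C d : ℝ) (k k' : Branch N ForgeLog → ℝ) : Prop where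
  counted : ∀ b, b.state.PosSemidef → 1 ≤ b.log.queries → k b ≤ b.state.trace.re * b.log.capped
  uncounted : ∀ h n ρ, ρ.PosSemidef →
    k ⟨h, ⟨n, 0, 0, false, 0⟩, ρ⟩ ≤ C * k' ⟨h, ⟨κ * n, 0, 0, false, 0⟩, ρ⟩ + d * ρ.trace.re
  halted : ∀ b, b.halted = true → k' b = b.state.trace.re * ind (fun l => 0 < l.flexible) b.log

variable {S c} {lam N : ℕ} {sk : S.Key lam}

/-- The oracles for a forger of the public scheme. -/
def pubForgeOracle (S : PrivateCoinScheme) (c : ℝ) {lam : ℕ} (sk : S.Key lam) (N : ℕ) :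
    Oracle N (PubForgeQuery (Fin (kappa c lam) × S.Qub lam) N) ForgeLog :=
  (PkQC S c).forgeOracle sk N

theorem pubForgeOracle_tracePreserving (S : PrivateCoinScheme) (c : ℝ) {lam : ℕ} (sk : S.Key lam)
    (N : ℕ) : (pubForgeOracle S c sk N).TracePreserving :=
  (PkQC S c).forgeOracle_tracePreserving sk N

theorem blockValue_mints (k : Branch N ForgeLog → ℝ) {r : ℕ} (e : Fin r × S.Qub lam ↪ Fin N)
    (L : List (Fin r)) (l : ForgeLog) (ρ : Op (Fin N)) :
    blockValue (S.forgeOracle sk N) (L.map fun i => .query (.mint (coinAt e i))) k ⟨false, l, ρ⟩ =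
      k ⟨false, { l with n := l.n + L.length },
        L.foldl (fun σ i => replace (coinAt e i) (S.coin lam sk) σ) ρ⟩ := by
  induction L generalizing l ρ with
  | nil => exact blockValue_nil _ _ _
  | cons i L ih =>
    rw [List.map_cons, blockValue_cons, if_neg (by simp)]
    simp only [Cmd.exec, PrivateCoinScheme.forgeOracle, List.map_cons, List.map_nil,
      List.sum_cons, List.sum_nil, add_zero]
    rw [ih, List.foldl_cons, List.length_cons]
    simp only [add_assoc, add_comm 1]

theorem blockValue_count_halt (k : Branch N ForgeLog → ℝ) {r b : ℕ}
    (e : Fin r × S.Qub lam ↪ Fin N) (out : Fin b ↪ Fin N) (l : ForgeLog) (ρ : Op (Fin N)) :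
    blockValue (S.forgeOracle sk N) [.query (.count r e b out), .halt] k ⟨false, l, ρ⟩ =
      ((S.privCount sk e ρ).map fun a =>
        k ⟨true, { l with m' := l.m' + a.1, queries := l.queries + 1 },
          writeUnary out a.1 a.2⟩).sum := by
  rw [blockValue_cons, if_neg (by simp)]
  simp only [Cmd.exec, PrivateCoinScheme.forgeOracle, List.map_map]
  refine congrArg List.sum (List.map_congr_left fun a _ => ?_)
  rw [Function.comp, blockValue_singleton _ _ _ _ rfl]
  simp [Cmd.exec]

/-- The reduced forger wins exactly when the private count exceeds the number of coins minted. It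
halts at once, so it needs no room for the answer. -/
theorem blockValue_reduced_count (hv : S.verify lam sk = pure (S.coin lam sk))
    {k : Branch N ForgeLog → ℝ}
    (hk : ∀ b, b.halted = true → k b = b.state.trace.re * ind (fun l => 0 < l.flexible) b.log)
    {r : ℕ} (e : Fin r × (Fin (kappa c lam) × S.Qub lam) ↪ Fin N) (n : ℕ) (ρ : Op (Fin N)) :
    blockValue (S.forgeOracle sk N) [.query (.count _ (flattenCoins e) 0 .ofIsEmpty), .halt] k
      ⟨false, ⟨n, 0, 0, false, 0⟩, ρ⟩ = excess e (S.coin lam sk) n ρ := by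
  rw [blockValue_count_halt, excess, ← liftOp_flattenCoins_sector e
    (pure_mul_self (S.coin_normalised lam sk)), ← hv, ← trace_privCount]
  refine congrArg List.sum (List.map_congr_left fun a _ => ?_)
  rw [hk _ rfl, trace_writeUnary, mul_comm]
  congr 1
  simp [ind, ForgeLog.flexible]

theorem ForgeLog.neg_n_le_capped (l : ForgeLog) : -(l.n : ℝ) ≤ l.capped := by
  have h1 : (0 : ℝ) ≤ l.m := Nat.cast_nonneg _
  have h2 : (0 : ℝ) ≤ l.m' := Nat.cast_nonneg _
  unfold capped allOrNothing
  split_ifs <;> linarith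

/-- After the first count, minting only costs, and a further count drops the capped utility to its
least possible value `-n`. -/
theorem capped_exec_le (cmd : Cmd N (PubForgeQuery (Fin (kappa c lam) × S.Qub lam) N))
    (b : Branch N ForgeLog) (hb : 1 ≤ b.log.queries) :
    ∀ a ∈ cmd.exec (pubForgeOracle S c sk N) b,
      1 ≤ a.log.queries ∧ a.log.capped ≤ b.log.capped := by
  intro a ha
  match cmd with
  | .gate g =>
    rw [List.mem_singleton.mp ha]
    exact ⟨hb, le_rfl⟩
  | .halt =>
    rw [List.mem_singleton.mp ha]
    exact ⟨hb, le_rfl⟩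
  | .query (.priv (.mint e)) =>
    rw [List.mem_singleton.mp ha]
    refine ⟨hb, ?_⟩
    simp only [ForgeLog.capped, ForgeLog.allOrNothing, Nat.cast_add, Nat.cast_one]
    split_ifs <;> linarith
  | .query (.priv (.count r e _ out)) =>
    obtain ⟨a', -, rfl⟩ := List.mem_map.mp ha
    refine ⟨Nat.le_add_left _ _, le_trans (le_of_eq ?_) (ForgeLog.neg_n_le_capped _)⟩
    exact if_neg (by simp only; omega)
  | .query (.count r e _ out) =>
    obtain ⟨a', -, rfl⟩ := List.mem_map.mp ha
    refine ⟨Nat.le_add_left _ _, le_trans (le_of_eq ?_) (ForgeLog.neg_n_le_capped _)⟩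
    exact if_neg (by simp only; omega)

/-- Before the first count both executions carry the same state, and the private log has `κ` times
as many minted coins. At the first count the public side is bounded by its immediate capped utility,
the private side is settled by halting, and the single-count estimates compare them; afterwards
`counted` suffices. -/
theorem Simulation.exec (hv : S.verify lam sk = pure (S.coin lam sk)) (hκ : 1 ≤ kappa c lam)
    {C : ℝ} (cmd : Cmd N (PubForgeQuery (Fin (kappa c lam) × S.Qub lam) N))
    (hC : (cmd.countSize : ℝ) ≤ C) {k k' : Branch N ForgeLog → ℝ}
    (hk : Simulation (kappa c lam) C (2 * (1 / 2) ^ kappa c lam) k k') :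
    Simulation (kappa c lam) C (2 * (1 / 2) ^ kappa c lam)
      (blockValue (pubForgeOracle S c sk N) [cmd] k)
      (blockValue (S.forgeOracle sk N) (reduceCmd cmd) k') := by
  have hO := pubForgeOracle_tracePreserving S c sk N
  refine ⟨fun b hb hq => ?_, fun h n ρ hρ => ?_, fun b hb => ?_⟩
  · by_cases h : b.halted = true
    · rw [blockValue_halted _ _ _ _ h]
      exact hk.counted b hb hq
    · obtain ⟨h1, h2⟩ := hO.exec hb cmd
      rw [blockValue_singleton _ _ _ _ (by simpa using h), ← h2, ← List.sum_map_mul_right]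
      refine List.sum_le_sum fun a ha => ?_
      obtain ⟨h3, h4⟩ := capped_exec_le cmd b hq a ha
      exact (hk.counted a (h1 a ha) h3).trans
        (mul_le_mul_of_nonneg_left h4 (PosSemidef_trace_re_nonneg (h1 a ha)))
  · cases h with
    | true =>
      rw [blockValue_halted _ _ _ _ rfl, blockValue_halted _ _ _ _ rfl]
      exact hk.uncounted true n ρ hρ
    | false =>
      rw [blockValue_singleton _ _ _ _ rfl]
      have h3 := (hO.exec (b := ⟨false, ⟨n, 0, 0, false, 0⟩, ρ⟩) hρ cmd).1
      match cmd with
      | .gate g =>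
        rw [reduceCmd, blockValue_singleton _ _ _ _ rfl]
        simp only [Cmd.exec, List.map_cons, List.map_nil, List.sum_cons, List.sum_nil, add_zero]
        rw [← g.trace_sandwich ρ]
        exact hk.uncounted false n _ (sandwich_posSemidef _ hρ)
      | .halt =>
        rw [reduceCmd, blockValue_singleton _ _ _ _ rfl]
        simp only [Cmd.exec, List.map_cons, List.map_nil, List.sum_cons, List.sum_nil, add_zero]
        exact hk.uncounted true n _ hρ
      | .query (.priv (.mint e)) =>
        rw [reduceCmd, blockValue_mints, foldl_replace, List.length_finRange]
        -- One public coin raises the private tally from `κ * n` to `κ * (n + 1)`.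
        have h1 := hk.uncounted false (n + 1) _ (replace_posSemidef e
          (tensorVec (Fin (kappa c lam)) (S.coin lam sk)) hρ)
        rw [trace_replace e (tensorVec_normalised (S.coin_normalised lam sk)), mul_add_one] at h1
        refine le_of_eq_of_le ?_ h1
        exact add_zero _
      | .query (.priv (.count r e b out)) =>
        rw [reduceCmd, blockValue_reduced_count hv hk.halted]
        have h1 := refund_gain_le S c sk e hv hκ hρ n
        have h2 := mul_le_mul_of_nonneg_right hC
          (excess_nonneg e (S.coin_normalised lam sk) (kappa c lam * n) hρ)
        have h4 : (0 : ℝ) ≤ 2 * (1 / 2) ^ kappa c lam * ρ.trace.re :=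
          mul_nonneg (by positivity) (PosSemidef_trace_re_nonneg hρ)
        refine le_trans ?_ (h1.trans (h2.trans (le_add_of_nonneg_right h4)))
        refine (List.sum_le_sum fun a ha => hk.counted a (h3 a ha) ?_).trans_eq ?_
        · obtain ⟨a', -, rfl⟩ := List.mem_map.mp ha
          exact le_rfl
        · change ((List.map _ _).map _).sum = _
          rw [List.map_map]
          refine congrArg List.sum (List.map_congr_left fun a _ => ?_)
          rw [Function.comp, trace_writeUnary]
          congr 1
          simp [ForgeLog.capped, ForgeLog.allOrNothing]
      | .query (.count r e b out) =>
        rw [reduceCmd, blockValue_reduced_count hv hk.halted]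
        have h1 := pubCount_gain_le S c sk e hκ hρ n
        have h2 := mul_le_mul_of_nonneg_right hC
          (excess_nonneg e (S.coin_normalised lam sk) (kappa c lam * n) hρ)
        refine le_trans ?_ (h1.trans (add_le_add_left h2 _))
        refine (List.sum_le_sum fun a ha => hk.counted a (h3 a ha) ?_).trans_eq ?_
        · obtain ⟨a', -, rfl⟩ := List.mem_map.mp ha
          exact le_rfl
        · change ((List.map _ _).map _).sum = _
          rw [List.map_map]
          refine congrArg List.sum (List.map_congr_left fun a _ => ?_)
          rw [Function.comp, trace_writeUnary]
          refine congrArg₂ HMul.hMul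
            ((trace_replace e (ket_normalised _) _).trans (trace_discard _)) ?_
          simp [ForgeLog.capped, ForgeLog.allOrNothing]
  · rw [blockValue_halted _ _ _ _ hb]
    exact hk.halted b hb

theorem Simulation.measure {κ : ℕ} {C d : ℝ} (i : Fin N) {k₀ k₀' k₁ k₁' : Branch N ForgeLog → ℝ}
    (h₀ : Simulation κ C d k₀ k₀') (h₁ : Simulation κ C d k₁ k₁') :
    Simulation κ C d
      (fun b => if b.halted then k₀ b else k₀ (b.measured i false) + k₁ (b.measured i true))
      (fun b => if b.halted then k₀' b
        else k₀' (b.measured i false) + k₁' (b.measured i true)) := by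
  refine ⟨fun b hb hq => ?_, fun h n ρ hρ => ?_, fun b hb => ?_⟩
  · split_ifs
    · exact h₀.counted b hb hq
    · rw [← trace_sandwich_measure i b.state, add_mul]
      exact add_le_add (h₀.counted (b.measured i false) (sandwich_posSemidef _ hb) hq)
        (h₁.counted (b.measured i true) (sandwich_posSemidef _ hb) hq)
  · cases h with
    | true => exact h₀.uncounted true n ρ hρ
    | false =>
      have e0 := h₀.uncounted false n _ (sandwich_posSemidef (QCoin.measure i false) hρ)
      have e1 := h₁.uncounted false n _ (sandwich_posSemidef (QCoin.measure i true) hρ)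
      simp only [Bool.false_eq_true, if_false]
      rw [← trace_sandwich_measure i ρ]
      refine (add_le_add e0 e1).trans_eq ?_
      simp only [Branch.measured]
      ring
  · rw [if_pos hb]
    exact h₀.halted b hb

theorem ind_nonneg (E : ForgeLog → Prop) (l : ForgeLog) : 0 ≤ ind E l := by
  unfold ind
  split_ifs <;> simp

theorem ind_le_one (E : ForgeLog → Prop) (l : ForgeLog) : ind E l ≤ 1 := by
  unfold ind
  split_ifs <;> simp

/-- The expected capped utility of a forger is bounded in terms of the success probability of its
reduction. -/
theorem total_capped_le (hv : S.verify lam sk = pure (S.coin lam sk)) (hκ : 1 ≤ kappa c lam)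
    {C : ℝ} (hC0 : 0 ≤ C) (p : Prog N (PubForgeQuery (Fin (kappa c lam) × S.Qub lam) N))
    (hC : ∀ block ∈ p, ∀ cmd ∈ block.2, (cmd.countSize : ℝ) ≤ C) :
    total (Prog.exec (pubForgeOracle S c sk N) ForgeLog.start p)
        (fun l ρ => ρ.trace.re * l.capped) ≤
      C * total (Prog.exec (S.forgeOracle sk N) ForgeLog.start (translate reduceCmd p))
        (fun l ρ => ρ.trace.re * ind (fun l => 0 < l.flexible) l) +
      2 * (1 / 2) ^ kappa c lam := by
  have h := progValue_translate (pubForgeOracle S c sk N) (S.forgeOracle sk N) reduceCmd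
    (Simulation (kappa c lam) C (2 * (1 / 2) ^ kappa c lam)) p
    (fun block hb cmd hc k k' hk => hk.exec hv hκ cmd (hC block hb cmd hc))
    (fun i k₀ k₀' k₁ k₁' h₀ h₁ => h₀.measure i h₁)
    (k := fun b => b.state.trace.re * b.log.capped)
    (k' := fun b => b.state.trace.re * ind (fun l => 0 < l.flexible) b.log)
    ⟨fun _ _ _ => le_rfl, fun h n ρ hρ => ?_, fun _ _ => rfl⟩
  · have := h.uncounted false 0 (pure zeroKet) pure_zeroKet_posSemidef
    rw [trace_pure_zeroKet, mul_one, mul_zero] at this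
    exact this
  -- A forger that ends without counting has utility `-n`, at most zero.
  · have htr := PosSemidef_trace_re_nonneg hρ
    have h1 : (0 : ℝ) ≤ C * (ρ.trace.re * ind (fun l => 0 < l.flexible)
        ⟨kappa c lam * n, 0, 0, false, 0⟩) :=
      mul_nonneg hC0 (mul_nonneg htr (ind_nonneg _ _))
    have h2 : (0 : ℝ) ≤ 2 * (1 / 2) ^ kappa c lam * ρ.trace.re :=
      mul_nonneg (by positivity) htr
    refine le_trans ?_ (add_nonneg h1 h2)
    refine mul_nonpos_of_nonneg_of_nonpos htr ?_
    simp [ForgeLog.capped, ForgeLog.allOrNothing]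

/-- The total probability of an event is between zero and one. -/
theorem total_ind_mem_Icc {Q : Type} {O : Oracle N Q ForgeLog} (hO : O.TracePreserving)
    (p : Prog N Q) (E : ForgeLog → Prop) :
    total (p.exec O ForgeLog.start) (fun l ρ => ρ.trace.re * ind E l) ∈ Set.Icc (0 : ℝ) 1 := by
  constructor
  · refine List.sum_nonneg fun x hx => ?_
    obtain ⟨b, hb, rfl⟩ := List.mem_map.mp hx
    exact mul_nonneg (PosSemidef_trace_re_nonneg (hO.prog_exec_posSemidef p _ b hb))
      (ind_nonneg _ _)
  · have := hO.progValue_le p (k := fun b => b.state.trace.re * ind E b.log) (d := 1)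
      (fun b hb => by
        rw [one_mul]
        exact mul_le_of_le_one_right (PosSemidef_trace_re_nonneg hb) (ind_le_one _ _))
      ⟨false, ForgeLog.start, pure zeroKet⟩ pure_zeroKet_posSemidef
    rw [trace_pure_zeroKet, mul_one] at this
    exact this

/-- Branches with several counts have nonnegative weights summing to zero, so each has weight zero;
on all others the two utilities agree. -/
theorem total_allOrNothing_eq {Q : Type} {O : Oracle N Q ForgeLog} (hO : O.TracePreserving)
    (p : Prog N Q) (h : total (p.exec O ForgeLog.start)
      (fun l ρ => ρ.trace.re * ind (fun l => 1 < l.queries) l) = 0) :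
    total (p.exec O ForgeLog.start) (fun l ρ => ρ.trace.re * l.allOrNothing) =
      total (p.exec O ForgeLog.start) (fun l ρ => ρ.trace.re * l.capped) := by
  refine congrArg List.sum (List.map_congr_left fun b hb => ?_)
  by_cases hq : b.log.queries ≤ 1
  · simp only [ForgeLog.capped, if_pos hq]
  · have h1 := List.all_zero_of_le_zero_le_of_sum_eq_zero (fun x hx => ?_) h
      (List.mem_map_of_mem hb)
    · simp only [ind, if_pos (not_le.mp hq), mul_one] at h1
      simp only [h1, zero_mul]
    · obtain ⟨b, hb, rfl⟩ := List.mem_map.mp hx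
      exact mul_nonneg (PosSemidef_trace_re_nonneg (hO.prog_exec_posSemidef p _ b hb))
        (ind_nonneg _ _)

/-- The invariant is that no count was made, or one was made and the program halted. The translation
principle is used with a relation that ignores the public side. -/
theorem total_reduced_queries (p : Prog N (PubForgeQuery (Fin (kappa c lam) × S.Qub lam) N)) :
    total (Prog.exec (S.forgeOracle sk N) ForgeLog.start (translate reduceCmd p))
      (fun l ρ => ρ.trace.re * ind (fun l => 1 < l.queries) l) = 0 := by
  have h := progValue_translate (pubForgeOracle S c sk N) (S.forgeOracle sk N) reduceCmd
    (fun _ k' => ∀ b, (b.log.queries = 0 ∨ b.log.queries = 1 ∧ b.halted = true) → k' b = 0) p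
    (fun block hb cmd hc k k' hk b hb => ?_)
    (fun i k₀ k₀' k₁ k₁' h₀ h₁ b hb => ?_)
    (k := fun _ => 0)
    (k' := fun b => b.state.trace.re * ind (fun l => 1 < l.queries) b.log) fun b hb => ?_
  · exact h ⟨false, ForgeLog.start, pure zeroKet⟩ (Or.inl rfl)
  · by_cases h : b.halted = true
    · rw [blockValue_halted _ _ _ _ h]
      exact hk b hb
    · have hq : b.log.queries = 0 := hb.resolve_right fun h' => h h'.2
      obtain ⟨hal, l, ρ⟩ := b
      obtain rfl : hal = false := by simpa using h
      have hcount : ∀ (r : ℕ) (e : Fin r × (Fin (kappa c lam) × S.Qub lam) ↪ Fin N),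
          blockValue (S.forgeOracle sk N)
            [.query (.count _ (flattenCoins e) 0 .ofIsEmpty), .halt] k' ⟨false, l, ρ⟩ = 0 := by
        intro r e
        rw [blockValue_count_halt]
        refine List.sum_eq_zero fun x hx => ?_
        obtain ⟨a, -, rfl⟩ := List.mem_map.mp hx
        exact hk _ (Or.inr ⟨by simpa using hq, rfl⟩)
      match cmd with
      | .gate g =>
        refine (blockValue_singleton _ _ _ _ rfl).trans ?_
        simp only [Cmd.exec, List.map_cons, List.map_nil, List.sum_cons, List.sum_nil, add_zero]
        exact hk _ (Or.inl hq)
      | .halt =>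
        refine (blockValue_singleton _ _ _ _ rfl).trans ?_
        simp only [Cmd.exec, List.map_cons, List.map_nil, List.sum_cons, List.sum_nil, add_zero]
        exact hk _ (Or.inl hq)
      | .query (.priv (.mint e)) =>
        exact (blockValue_mints _ _ _ _ _).trans (hk _ (Or.inl hq))
      | .query (.priv (.count r e b out)) => exact hcount r e
      | .query (.count r e b out) => exact hcount r e
  · dsimp only
    split_ifs with h
    · exact h₀ b hb
    · have hq : b.log.queries = 0 := hb.resolve_right fun h' => h h'.2
      rw [h₀ (b.measured i false) (Or.inl hq), h₁ (b.measured i true) (Or.inl hq), add_zero]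
  · rw [ind, if_neg (by omega), mul_zero]

end Reduction

/-! ### The cost of the reduction -/

section Cost

variable {N : ℕ} {Q Q' : Type}

/-- The query cost of a single command. -/
def Cmd.cost (cost : Q → ℕ) : Cmd N Q → ℕ
  | .query q => cost q
  | _ => 0

theorem queryCost_eq (cost : Q → ℕ) (p : Prog N Q) :
    Prog.queryCost cost p = (p.map fun block => (block.2.map (Cmd.cost cost)).sum).sum := by
  unfold Prog.queryCost
  refine congrArg List.sum (List.map_congr_left fun block _ => ?_)
  refine congrArg List.sum (List.map_congr_left fun cmd _ => ?_)
  cases cmd <;> rfl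

theorem Cmd.cost_le_queryCost (cost : Q → ℕ) {p : Prog N Q}
    {block : Option (Fin N) × List (Cmd N Q)} (hb : block ∈ p) {cmd : Cmd N Q}
    (hc : cmd ∈ block.2) : cmd.cost cost ≤ Prog.queryCost cost p := by
  rw [queryCost_eq]
  exact (List.single_le_sum (fun _ _ => Nat.zero_le _) _ (List.mem_map_of_mem hc)).trans
    (List.single_le_sum (fun _ _ => Nat.zero_le _) _
      (List.mem_map_of_mem (f := fun block => (block.2.map (Cmd.cost cost)).sum) hb))

theorem sum_map_flatMap_le {β γ : Type} (f : β → List γ) (g : γ → ℕ) (h : β → ℕ) (M : ℕ)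
    (hf : ∀ b, ((f b).map g).sum ≤ M * h b) (L : List β) :
    ((L.flatMap f).map g).sum ≤ M * (L.map h).sum := by
  induction L with
  | nil => simp
  | cons b L ih =>
    rw [List.flatMap_cons, List.map_append, List.sum_append, List.map_cons, List.sum_cons, mul_add]
    exact add_le_add (hf b) ih

theorem queryCost_translate_le (cost : Q → ℕ) (cost' : Q' → ℕ) (f : Cmd N Q → List (Cmd N Q'))
    {M : ℕ} (hf : ∀ cmd, ((f cmd).map (Cmd.cost cost')).sum ≤ M * cmd.cost cost) (p : Prog N Q) :
    Prog.queryCost cost' (translate f p) ≤ M * Prog.queryCost cost p := by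
  rw [queryCost_eq, queryCost_eq, translate, List.map_map, ← List.sum_map_mul_left]
  exact List.sum_le_sum fun block _ => sum_map_flatMap_le f _ _ M hf block.2

theorem time_translate_le (cost : Q → ℕ) (cost' : Q' → ℕ) (f : Cmd N Q → List (Cmd N Q'))
    {M : ℕ} (hM : 1 ≤ M) (hf : ∀ cmd, ((f cmd).map (Cmd.cost cost')).sum ≤ M * cmd.cost cost)
    (hl : ∀ cmd, (f cmd).length ≤ M) (p : Prog N Q) :
    Prog.time cost' (translate f p) ≤ M * Prog.time cost p := by
  unfold Prog.time
  rw [mul_add]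
  refine add_le_add ?_ (queryCost_translate_le cost cost' f hf p)
  rw [translate, List.map_map, ← List.sum_map_mul_left]
  refine List.sum_le_sum fun block _ => ?_
  have h := sum_map_flatMap_le f (fun _ => 1) (fun _ => 1) M (fun b => by simpa using hl b) block.2
  simp only [List.map_const', List.sum_replicate, smul_eq_mul, mul_one] at h
  rw [Function.comp, mul_add, mul_one]
  exact add_le_add hM h

theorem length_reduceCmd_le {k : ℕ} (cmd : Cmd N (PubForgeQuery (Fin k × Q) N)) :
    (reduceCmd cmd).length ≤ k + 2 := by
  match cmd with
  | .gate g => exact Nat.le_add_left 1 _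
  | .halt => exact Nat.le_add_left 1 _
  | .query (.priv (.mint e)) => simp [reduceCmd]
  | .query (.priv (.count r e _ _)) => exact Nat.le_add_left 2 _
  | .query (.count r e _ _) => exact Nat.le_add_left 2 _

/-- Minting expands into `k` queries, and a count of `r` coins becomes one of `r * k` coins at cost
`r * k + 1`; the factor `k + 2` covers both as well as the length of the translation. -/
theorem cost_reduceCmd_le {k : ℕ} (cmd : Cmd N (PubForgeQuery (Fin k × Q) N)) :
    ((reduceCmd cmd).map (Cmd.cost PrivForgeQuery.cost)).sum ≤
      (k + 2) * cmd.cost PubForgeQuery.cost := by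
  match cmd with
  | .gate g => exact Nat.zero_le _
  | .halt => exact Nat.zero_le _
  | .query (.priv (.mint e)) =>
    simp [reduceCmd, Cmd.cost, PrivForgeQuery.cost, PubForgeQuery.cost, Function.comp_def]
  | .query (.priv (.count r e _ _)) =>
    simp only [reduceCmd, Cmd.cost, PrivForgeQuery.cost, PubForgeQuery.cost, List.map_cons,
      List.map_nil, List.sum_cons, List.sum_nil]
    nlinarith
  | .query (.count r e _ _) =>
    simp only [reduceCmd, Cmd.cost, PrivForgeQuery.cost, PubForgeQuery.cost, List.map_cons,
      List.map_nil, List.sum_cons, List.sum_nil]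
    nlinarith

theorem Cmd.countSize_le_cost {W : Type} (cmd : Cmd N (PubForgeQuery W N)) :
    cmd.countSize ≤ cmd.cost PubForgeQuery.cost := by
  match cmd with
  | .gate g => exact Nat.zero_le _
  | .halt => exact Nat.zero_le _
  | .query (.priv (.mint e)) => exact Nat.zero_le _
  | .query (.priv (.count r e _ _)) => exact Nat.le_succ r
  | .query (.count r e _ _) => exact Nat.le_succ r

theorem elementary_of_mem_reduceCmd {k : ℕ} {cmd : Cmd N (PubForgeQuery (Fin k × Q) N)}
    (h : cmd.Elementary) : ∀ cmd' ∈ reduceCmd cmd, cmd'.Elementary := by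
  intro cmd' hc
  match cmd with
  | .gate g =>
    rw [List.mem_singleton.mp hc]
    exact h
  | .halt =>
    rw [List.mem_singleton.mp hc]
    trivial
  | .query (.priv (.mint e)) =>
    obtain ⟨i, -, rfl⟩ := List.mem_map.mp hc
    trivial
  | .query (.priv (.count r e _ _)) =>
    rcases List.mem_cons.mp hc with rfl | hc
    · trivial
    · rw [List.mem_singleton.mp hc]
      trivial
  | .query (.count r e _ _) =>
    rcases List.mem_cons.mp hc with rfl | hc
    · trivial
    · rw [List.mem_singleton.mp hc]
      trivial

theorem exists_queryCost_le {Q : ℕ → ℕ → Type} (cost : ∀ {lam N}, Q lam N → ℕ) (A : Adversary Q)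
    {M : Model} (h : A.Admissible cost M) :
    ∃ p : Polynomial ℕ, ∀ lam, Prog.queryCost cost (A.prog lam) ≤ p.eval lam := by
  cases M with
  | qpt =>
    obtain ⟨-, p, hp⟩ := h
    exact ⟨p, fun lam => ((Nat.le_add_left _ _).trans (Nat.le_add_left _ _)).trans (hp lam)⟩
  | unbounded => exact h

variable (S : PrivateCoinScheme) (c : ℝ)

theorem reduction_admissible (A : (PkQC S c).Forger) {M : Model}
    (h : A.Admissible PubForgeQuery.cost M) :
    (reduction S c A).Admissible PrivForgeQuery.cost M := by
  obtain ⟨K, hK⟩ := exists_kappa_le c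
  have hpoly : ∀ (p : Polynomial ℕ) (lam x : ℕ), x ≤ p.eval lam →
      (kappa c lam + 2) * x ≤ ((Polynomial.X + Polynomial.C (K + 2)) * p).eval lam := by
    intro p lam x hx
    rw [Polynomial.eval_mul, Polynomial.eval_add, Polynomial.eval_X, Polynomial.eval_C]
    exact Nat.mul_le_mul (by linarith [hK lam]) hx
  cases M with
  | qpt =>
    obtain ⟨h1, p, hp⟩ := h
    refine ⟨fun lam block hb cmd hc => ?_, (Polynomial.X + Polynomial.C (K + 2)) * p,
      fun lam => le_trans ?_ (hpoly p lam _ (hp lam))⟩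
    · obtain ⟨block', hb', rfl⟩ := List.mem_map.mp hb
      obtain ⟨cmd', hc', hc⟩ := List.mem_flatMap.mp hc
      exact elementary_of_mem_reduceCmd (h1 lam block' hb' cmd' hc') cmd hc
    · rw [mul_add]
      exact add_le_add (Nat.le_mul_of_pos_left _ (Nat.succ_pos _))
        (time_translate_le _ _ _ (by omega) cost_reduceCmd_le length_reduceCmd_le _)
  | unbounded =>
    obtain ⟨p, hp⟩ := h
    exact ⟨(Polynomial.X + Polynomial.C (K + 2)) * p, fun lam =>
      (queryCost_translate_le _ _ _ cost_reduceCmd_le _).trans (hpoly p lam _ (hp lam))⟩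

theorem reduction_nonadaptive (A : (PkQC S c).Forger) :
    PrivateCoinScheme.Forger.Nonadaptive (reduction S c A) := fun lam => by
  have h : ∀ sk : S.Key lam, total (Prog.exec (S.forgeOracle sk ((reduction S c A).qubits lam))
      ForgeLog.start ((reduction S c A).prog lam))
      (fun l ρ => ρ.trace.re * ind (fun l => 1 < l.queries) l) = 0 :=
    fun sk => total_reduced_queries (A.prog lam)
  simp only [PrivateCoinScheme.forgeExpectation, PrivateCoinScheme.keyAverage, h, mul_zero,
    tsum_zero]

end Cost

/-! ### Security against forgery -/

section Forgery

open Filter Asymptotics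

variable {S : PrivateCoinScheme} {c : ℝ}

/-- Nonadaptivity holds on average over the keys, hence for each key in the support, where utility
and capped utility agree and `total_capped_le` applies. The query cost bounds the size of any single
count. -/
theorem forgeExpectation_le (hcomplete : S.Complete) (hrank : S.RankOneProjective)
    (A : (PkQC S c).Forger) (hA : PublicCoinScheme.Forger.Nonadaptive A) {lam : ℕ}
    (hκ : 1 ≤ kappa c lam) {C : ℕ}
    (hC : Prog.queryCost PubForgeQuery.cost (A.prog lam) ≤ C) :
    (PkQC S c).forgeExpectation A ForgeLog.allOrNothing lam ≤
      C * S.forgeExpectation (reduction S c A) (ind fun l => 0 < l.flexible) lam +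
        2 * (1 / 2) ^ kappa c lam := by
  have hO := fun sk => pubForgeOracle_tracePreserving S c (lam := lam) sk (A.qubits lam)
  have hzero := S.eq_zero_of_keyAverage_eq_zero
    (fun sk => (total_ind_mem_Icc (hO sk) (A.prog lam) fun l => 1 < l.queries).1)
    (fun sk => (total_ind_mem_Icc (hO sk) (A.prog lam) fun l => 1 < l.queries).2) (hA lam)
  have hR := fun sk => total_ind_mem_Icc
    (S.forgeOracle_tracePreserving (lam := lam) sk (A.qubits lam))
    (translate reduceCmd (A.prog lam)) fun l => 0 < l.flexible
  refine S.keyAverage_le (Nat.cast_nonneg C) (by positivity) (fun sk => (hR sk).1)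
    (fun sk => (hR sk).2) fun sk hsk => ?_
  refine (total_allOrNothing_eq (hO sk) (A.prog lam) (hzero sk hsk)).trans_le ?_
  refine total_capped_le (S.verify_eq_pure_coin hcomplete hrank hsk) hκ (Nat.cast_nonneg C)
    (A.prog lam) fun block hb cmd hc => ?_
  exact_mod_cast (cmd.countSize_le_cost.trans (Cmd.cost_le_queryCost _ hb hc)).trans hC

theorem nonadaptivelyRationallyUnforgeable (hcomplete : S.Complete) (hrank : S.RankOneProjective)
    (hc : 1 < c) {M : Model} (hS : S.NonadaptiveUnforgeable M) :
    (PkQC S c).NonadaptivelyRationallyUnforgeable M := by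
  intro A hA hA'
  obtain ⟨ε, hε, hle⟩ := hS (reduction S c A) (reduction_admissible S c A hA)
    (reduction_nonadaptive S c A)
  obtain ⟨p, hp⟩ := exists_queryCost_le _ A hA
  refine .of_eventually ((hε.polynomial_mul (p.map (Nat.castRingHom ℝ))).add
    (superpolynomialDecay_two_pow_kappa hc)) ?_
  filter_upwards [(tendsto_kappa hc).eventually_ge_atTop 1] with lam hlam
  refine (forgeExpectation_le hcomplete hrank A hA' hlam (hp lam)).trans (add_le_add ?_ le_rfl)
  have h1 : (p.map (Nat.castRingHom ℝ)).eval (lam : ℝ) = ((p.eval lam : ℕ) : ℝ) := by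
    simp
  change _ ≤ (p.map (Nat.castRingHom ℝ)).eval (lam : ℝ) * ε lam
  rw [h1]
  exact mul_le_mul_of_nonneg_left (hle lam) (Nat.cast_nonneg _)

theorem nonadaptivelyRationallySecure (hcomplete : S.Complete) (hrank : S.RankOneProjective)
    (hc : 1 < c) {M : Model} (hS : S.NonadaptiveUnforgeable M) :
    (PkQC S c).NonadaptivelyRationallySecure M :=
  ⟨nonadaptivelyRationallyUnforgeable hcomplete hrank hc hS,
    secureAgainstPrivateSabotage S hcomplete hrank hc M,
    secureAgainstPublicSabotage S hcomplete hrank hc M⟩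

end Forgery

end QCoin

end

theorem mainTheorem7 (S : QCoin.PrivateCoinScheme) (hcomplete : S.Complete)
    (hrank : S.RankOneProjective) (c : ℝ) (hc : 1 < c) :
    (S.AdaptiveUnforgeable .qpt → (QCoin.PkQC S c).NonadaptivelyRationallySecure .qpt) ∧
      (S.NonadaptiveUnforgeable .unbounded →
        (QCoin.PkQC S c).NonadaptivelyRationallySecure .unbounded) :=
  -- Adaptive unforgeability covers nonadaptive forgers in particular, so both statements rest on
  -- the same reduction.
  ⟨fun h => QCoin.nonadaptivelyRationallySecure hcomplete hrank hc fun A hA _ => h A hA,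
    fun h => QCoin.nonadaptivelyRationallySecure hcomplete hrank hc h⟩
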